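/- Let $d\ge 2$ and $1\le k\le d-1$ be integers. **Notation.** Write points of $\mathbb{R}^{d(d+1)}$ as $x=(x_1,\dots,x_{d+1})$ with $x_i\in\mathbb{R}^d$, and let $\rho(x)$ be the determinant of the $(d+1)\times(d+1)$ matrix with columns $\binom{1}{x_i}$. Put $\gamma_n(z)=\prod_{j=0}^{n-1}\frac{1}{2\pi^{(z-j)/2}}\Gamma\big(\frac{z-j}{2}\big)$. Let $(A_s)_{s\in\mathbb{C}}$ be the analytic family of tempered distributions on $\mathbb{R}^{d(d+1)}$ that equals $\frac{1}{\gamma_d(s)}|\rho|^{s-d}$ for $\operatorname{Re}s>d-1$ (for every Schwartz function $\varphi$, $s\mapsto\langle A_s,\varphi\rangle$ is entire). The Fourier transform is $\widehat f(\xi)=\int f(x)e^{-ix\cdot\xi}\,dx$, extended to tempered distributions by duality, and $d\sigma$ is the surface measure of the unit sphere $\mathbb{S}^{d(d+1)-1}$ of $\mathbb{R}^{d(d+1)}$. Let $|\mathbb{S}^n|$ be the surface area of the unit sphere of $\mathbb{R}^{n+1}$. Let $\mathcal{G}_{d,d-k}$ be the Grassmannian of $(d-k)$-dimensional subspaces of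 $\mathbb{R}^d$, with $\mu_{\mathcal{G}}$ its rotation invariant measure of total mass $\frac{|\mathbb{S}^{d-1}|\cdots|\mathbb{S}^{k}|}{|\mathbb{S}^{d-k-1}|\cdots|\mathbb{S}^{0}|}$; $P_\Pi$ is the orthogonal projection onto $\Pi$; and $\operatorname{Var}_\omega$ is the $d\times d$ covariance matrix of the random vector taking the values $\omega_1,\dots,\omega_{d+1}$ with equal probability. Finally put $$\mathbf{C}_{d,k}=(2\pi)^{d(k+1)}(d+1)^{\frac{(d-1)(d-k)-2}{2}}\,|\mathbb{S}^{d(d-k)-1}|,\qquad \mathbf{D}_{d,k}=\frac{1}{\gamma_k(k)\,\gamma_{d-k}(d-k)} .$$ **Proposition.** The family $(A_s)$ exists, and the convolution $\widehat{A_k}*d\sigma$, that is, the functional $\varphi\mapsto\int\langle\widehat{A_k},\varphi(\cdot+\theta)\rangle\,d\sigma(\theta)$ on Schwartz functions, is given by integration against a function on $\mathbb{R}^{d(d+1)}$, also denoted $\widehat{A_k}*d\sigma$, which is continuous on the closed unit ball and is continuous, as a function on $\mathbb{R}^{d(d+1)}$, at every point $\omega$ of the unit sphere, except possibly at those with $\operatorname{Var}_\omega=0$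 when $d(d-k)=2$. For every $\omega\in\mathbb{S}^{d(d+1)-1}$, $$\widehat{A_k}*d\sigma(\omega)=\mathbf{C}_{d,k}\mathbf{D}_{d,k}\int_{\mathcal{G}_{d,d-k}}\big(\operatorname{tr}(P_\Pi\operatorname{Var}_\omega)\big)^{\frac{d(d-k)-2}{2}}\,d\mu_{\mathcal{G}}(\Pi),$$ where $0^0=1$ if $d(d-k)=2$. -/

import Mathlib

open scoped SchwartzMap FourierTransform RealInnerProductSpace

noncomputable section

namespace KPlane

/-! ### Fourier transform, convolution with the surface measure, density of a distribution -/

section General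

variable {E : Type*} [NormedAddCommGroup E] [InnerProductSpace ℝ E] [FiniteDimensional ℝ E]
  [MeasurableSpace E] [BorelSpace E]

/-- The dilation `x ↦ (2π)⁻¹ x`. -/
def dilation (E : Type*) [NormedAddCommGroup E] [InnerProductSpace ℝ E] : E ≃L[ℝ] E :=
  ContinuousLinearEquiv.smulLeft (Units.mk0 ((2 * Real.pi)⁻¹ : ℝ) (by positivity))

/-- The Fourier transform `φ̂(ξ) = ∫ φ(x) e^{-i x·ξ} dx` on Schwartz functions
(Mathlib's `𝓕` has the kernel `e^{-2πi x·ξ}`). -/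
def fourierS : 𝓢(E, ℂ) →L[ℂ] 𝓢(E, ℂ) :=
  (SchwartzMap.compCLMOfContinuousLinearEquiv ℂ (dilation E)).comp
    (FourierTransform.fourierCLM ℂ 𝓢(E, ℂ))

theorem fourierS_apply (φ : 𝓢(E, ℂ)) (ξ : E) :
    fourierS φ ξ = ∫ x, φ x * Complex.exp (-(Complex.I * (⟪x, ξ⟫ : ℝ))) := by
  have h : fourierS φ ξ = (𝓕 (φ : E → ℂ)) ((2 * Real.pi)⁻¹ • ξ) := by
    rw [← SchwartzMap.fourier_coe]
    rfl
  rw [h, Real.fourier_eq']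
  refine MeasureTheory.integral_congr_ae (Filter.Eventually.of_forall fun x => ?_)
  simp only [smul_eq_mul, inner_smul_right]
  rw [mul_comm]
  congr 2
  have : (Real.pi : ℂ) ≠ 0 := by exact_mod_cast Real.pi_ne_zero
  push_cast
  field_simp

/-- The Fourier transform of a tempered distribution, `⟨T̂, φ⟩ = ⟨T, φ̂⟩`. -/
def fourierT (T : 𝓢'(E, ℂ)) : 𝓢'(E, ℂ) :=
  PointwiseConvergenceCLM.precomp ℂ (fourierS (E := E)) T

/-- The surface measure `dσ` of the unit sphere of `E`. -/
abbrev sphereMeasure (E : Type*) [NormedAddCommGroup E] [InnerProductSpace ℝ E]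
    [FiniteDimensional ℝ E] [MeasurableSpace E] [BorelSpace E] :
    MeasureTheory.Measure (Metric.sphere (0 : E) 1) :=
  (MeasureTheory.volume : MeasureTheory.Measure E).toSphere

/-- The convolution `T * dσ` of a tempered distribution with the surface measure of the unit
sphere, as a functional: `⟨T * dσ, φ⟩ = ∫ ⟨T, φ(· + θ)⟩ dσ(θ)`. -/
def convSphere (T : 𝓢'(E, ℂ)) (φ : 𝓢(E, ℂ)) : ℂ :=
  ∫ θ, T (φ.compSubConstCLM ℂ (-(θ : E))) ∂(sphereMeasure E)

/-- The functional `S` on Schwartz functions is integration against the function `F`. -/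
def IsGivenBy (S : 𝓢(E, ℂ) → ℂ) (F : E → ℂ) : Prop :=
  ∀ φ : 𝓢(E, ℂ), MeasureTheory.Integrable (fun x => F x * φ x) ∧ S φ = ∫ x, F x * φ x

end General

/-! ### The distributions `A_s` -/

/-- The space `ℝ^{d(d+1)}` of points `x = (x_1, …, x_{d+1})` with `x_i ∈ ℝ^d`; the `l`-th
coordinate of `x_i` is `x (i, l)`. -/
abbrev Conf (d : ℕ) : Type := EuclideanSpace ℝ (Fin (d + 1) × Fin d)

/-- `γ_n(z) = ∏_{j=0}^{n-1} Γ((z-j)/2) / (2 π^{(z-j)/2})`. -/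
def gammaN (n : ℕ) (z : ℂ) : ℂ :=
  ∏ j ∈ Finset.range n,
    1 / (2 * (Real.pi : ℂ) ^ ((z - j) / 2)) * Complex.Gamma ((z - j) / 2)

/-- `ρ(x)`: the determinant of the matrix with first row `(1, …, 1)` and, below it, the columns
`x_1, …, x_{d+1}`. -/
def rho {d : ℕ} (x : Conf d) : ℝ :=
  Matrix.det (Matrix.of fun i j : Fin (d + 1) =>
    Fin.cases (motive := fun _ => ℝ) 1 (fun l => x (j, l)) i)

/-- `A` is the analytic family of tempered distributions `A_s = |ρ|^{s-d} / γ_d(s)`: it is given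
by this locally integrable function for `Re s > d - 1`, and depends analytically on `s ∈ ℂ`. -/
def IsDetFamily (d : ℕ) (A : ℂ → 𝓢'(Conf d, ℂ)) : Prop :=
  (∀ φ : 𝓢(Conf d, ℂ), Differentiable ℂ fun s => A s φ) ∧
  ∀ s : ℂ, (d : ℝ) - 1 < s.re →
    IsGivenBy (A s) fun x => (gammaN d s)⁻¹ * ((|rho x| : ℝ) : ℂ) ^ (s - d)

/-- By the identity theorem there is at most one such family. -/
theorem IsDetFamily.unique {d : ℕ} {A B : ℂ → 𝓢'(Conf d, ℂ)}
    (hA : IsDetFamily d A) (hB : IsDetFamily d B) : A = B := by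
  have key : ∀ φ : 𝓢(Conf d, ℂ), (fun s => A s φ) = fun s => B s φ := by
    intro φ
    have ha : AnalyticOnNhd ℂ (fun s => A s φ) Set.univ :=
      (hA.1 φ).differentiableOn.analyticOnNhd isOpen_univ
    have hb : AnalyticOnNhd ℂ (fun s => B s φ) Set.univ :=
      (hB.1 φ).differentiableOn.analyticOnNhd isOpen_univ
    refine ha.eq_of_eventuallyEq hb (z₀ := (d : ℂ)) ?_
    have ho : IsOpen {s : ℂ | (d : ℝ) - 1 < s.re} := isOpen_lt continuous_const Complex.continuous_re
    filter_upwards [ho.mem_nhds (show (d : ℝ) - 1 < (d : ℂ).re by simp)] with s hs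
    rw [(hA.2 s hs φ).2, (hB.2 s hs φ).2]
  funext s
  ext φ
  exact congrFun (key φ) s

open Classical in
/-- The analytic family `A_s`, `s ∈ ℂ`. -/
def detFamily (d : ℕ) : ℂ → 𝓢'(Conf d, ℂ) :=
  if h : ∃ A, IsDetFamily d A then h.choose else 0

/-! ### The Grassmannian and its uniform measure -/

/-- `|S^{n-1}|`, the surface area of the unit sphere of `ℝ^n`. -/
def sphereArea (n : ℕ) : ℝ :=
  (sphereMeasure (EuclideanSpace ℝ (Fin n))).real Set.univ

/-- The Grassmannian of `m`-dimensional linear subspaces of `ℝ^d`. -/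
structure Grass (d m : ℕ) : Type where
  plane : Submodule ℝ (EuclideanSpace ℝ (Fin d))
  finrank_plane : Module.finrank ℝ plane = m

/-- The matrix `P_W` of the orthogonal projection of `ℝ^d` onto `W`. -/
def projMatrix {d m : ℕ} (W : Grass d m) : Matrix (Fin d) (Fin d) ℝ :=
  Matrix.of fun i j => W.plane.starProjection (EuclideanSpace.single j 1) i

/-- The topology of the Grassmannian, through `W ↦ P_W`. -/
instance (d m : ℕ) : TopologicalSpace (Grass d m) :=
  TopologicalSpace.induced projMatrix inferInstance

instance (d m : ℕ) : MeasurableSpace (Grass d m) := borel _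

instance (d m : ℕ) : BorelSpace (Grass d m) := ⟨rfl⟩

/-- The orthogonal group `O(d)`. -/
abbrev Orth (d : ℕ) : Type := Matrix.orthogonalGroup (Fin d) ℝ

instance (d : ℕ) : MeasurableSpace (Orth d) := borel _

instance (d : ℕ) : BorelSpace (Orth d) := ⟨rfl⟩

instance (d : ℕ) : CompactSpace (Orth d) := by
  suffices h : IsCompact ((Matrix.orthogonalGroup (Fin d) ℝ : Submonoid _) :
      Set (Matrix (Fin d) (Fin d) ℝ)) from isCompact_iff_compactSpace.1 h
  have hK : IsCompact {M : Matrix (Fin d) (Fin d) ℝ | ∀ i j, M i j ∈ Set.Icc (-1 : ℝ) 1} := by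
    have := isCompact_univ_pi (X := fun _ : Fin d => Fin d → ℝ)
      (fun _ => isCompact_univ_pi (X := fun _ : Fin d => ℝ)
        (fun _ => isCompact_Icc (a := (-1 : ℝ)) (b := 1)))
    have he : {M : Matrix (Fin d) (Fin d) ℝ | ∀ i j, M i j ∈ Set.Icc (-1 : ℝ) 1} =
        Set.univ.pi fun _ : Fin d => Set.univ.pi fun _ : Fin d => Set.Icc (-1 : ℝ) 1 := by
      ext M
      exact ⟨fun h i _ j _ => h i j, fun h i j => h i trivial j trivial⟩
    rw [he]
    exact this
  refine hK.of_isClosed_subset ?_ ?_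
  · have : ((Matrix.orthogonalGroup (Fin d) ℝ : Submonoid _) : Set (Matrix (Fin d) (Fin d) ℝ)) =
        {M | M * star M = 1} := by
      ext M
      exact Matrix.mem_unitaryGroup_iff
    rw [this]
    exact isClosed_eq (by fun_prop) continuous_const
  · intro M hM i j
    have := entry_norm_bound_of_unitary (𝕜 := ℝ) hM i j
    rwa [Real.norm_eq_abs, abs_le] at this

/-- The Haar probability measure of `O(d)`. -/
def haarOrth (d : ℕ) : MeasureTheory.Measure (Orth d) :=
  MeasureTheory.Measure.haarMeasure ⊤

/-- The action of `O(d)` on the Grassmannian, `g W = {g x | x ∈ W}`. -/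
def rotate {d m : ℕ} (g : Orth d) (W : Grass d m) : Grass d m :=
  ⟨W.plane.map (Matrix.toEuclideanLin (g : Matrix (Fin d) (Fin d) ℝ)), by
    have hinj : Function.Injective (Matrix.toEuclideanLin (g : Matrix (Fin d) (Fin d) ℝ)) := by
      apply Function.LeftInverse.injective
        (g := Matrix.toEuclideanLin (star (g : Matrix (Fin d) (Fin d) ℝ)))
      intro x
      have h : star (g : Matrix (Fin d) (Fin d) ℝ) * (g : Matrix (Fin d) (Fin d) ℝ) = 1 :=
        Matrix.mem_unitaryGroup_iff'.1 g.2
      ext i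
      simp [Matrix.toLpLin_apply, Matrix.mulVec_mulVec, h]
    exact (Submodule.equivMapOfInjective _ hinj W.plane).finrank_eq.symm.trans W.finrank_plane⟩

/-- The subspace of `ℝ^d` spanned by the first `m` coordinate vectors. -/
def coordPlane (d m : ℕ) (hm : m ≤ d) : Grass d m :=
  ⟨Submodule.span ℝ (Set.range fun i : Fin m =>
      EuclideanSpace.single (Fin.castLE hm i) (1 : ℝ)), by
    have hli : LinearIndependent ℝ fun i : Fin m =>
        (EuclideanSpace.single (Fin.castLE hm i) (1 : ℝ) : EuclideanSpace ℝ (Fin d)) := by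
      have h := (EuclideanSpace.basisFun (Fin d) ℝ).orthonormal.linearIndependent.comp
        (Fin.castLE hm) (Fin.castLE_injective hm)
      simpa [Function.comp_def] using h
    simpa using finrank_span_eq_card hli⟩

/-- The uniform measure `μ_G` on the Grassmannian: the rotation invariant measure of total mass
`(|S^{d-1}| ⋯ |S^{d-m}|) / (|S^{m-1}| ⋯ |S^0|)`. -/
def grassMeasure (d m : ℕ) (hm : m ≤ d) : MeasureTheory.Measure (Grass d m) :=
  ENNReal.ofReal ((∏ i ∈ Finset.range m, sphereArea (d - i)) /
      ∏ i ∈ Finset.range m, sphereArea (m - i)) •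
    (haarOrth d).map fun g => rotate g (coordPlane d m hm)

/-! ### The covariance matrix, the weight and the constants -/

/-- The point `ξ_i ∈ ℝ^d` of the configuration `ξ`. -/
def point {d : ℕ} (ξ : Conf d) (i : Fin (d + 1)) : Fin d → ℝ := fun l => ξ (i, l)

/-- The mean `(ξ_1 + ⋯ + ξ_{d+1}) / (d+1)`. -/
def mean {d : ℕ} (ξ : Conf d) : Fin d → ℝ := ((d : ℝ) + 1)⁻¹ • ∑ i, point ξ i

/-- The covariance matrix `Var_ξ` of the random vector that takes the values `ξ_1, …, ξ_{d+1}`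
with equal probability. -/
def covMatrix {d : ℕ} (ξ : Conf d) : Matrix (Fin d) (Fin d) ℝ :=
  ((d : ℝ) + 1)⁻¹ •
    ∑ i, Matrix.vecMulVec (point ξ i - mean ξ) (point ξ i - mean ξ)

/-- The weight `I_{d,k}(ξ) = ∫ (tr (P_W Var_ξ))^{(d(d-k)-2)/2} dμ_G(W)`, the integral being over
the `(d-k)`-dimensional subspaces `W` of `ℝ^d`. -/
def weight (d k : ℕ) (ξ : Conf d) : ℝ :=
  ∫ W, (Matrix.trace (projMatrix W * covMatrix ξ)) ^ (((d : ℝ) * ((d : ℝ) - k) - 2) / 2)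
    ∂(grassMeasure d (d - k) (Nat.sub_le d k))

/-- `C_{d,k} = (2π)^{d(k+1)} (d+1)^{((d-1)(d-k)-2)/2} |S^{d(d-k)-1}|`. -/
def constC (d k : ℕ) : ℝ :=
  (2 * Real.pi) ^ (d * (k + 1)) *
    ((d : ℝ) + 1) ^ ((((d : ℝ) - 1) * ((d : ℝ) - k) - 2) / 2) *
    sphereArea (d * (d - k))

/-- `D_{d,k} = 1 / (γ_k(k) γ_{d-k}(d-k))`. -/
def constD (d k : ℕ) : ℂ :=
  1 / (gammaN k k * gammaN (d - k) ((d : ℂ) - k))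

end KPlane

end

open scoped ENNReal Kronecker

noncomputable section

open MeasureTheory Set

set_option linter.unusedSectionVars false

/-! ### Gamma factors -/

namespace KPlane

/-! Subtracting the first point of a configuration turns ρ into the determinant of the d × d matrix
Y of difference vectors (`rho_confEquiv`). So A_s is |det Y|^{s-d}/γ_d(s), tested against φ
integrated over the base point (`integrateBase`), and the first task is to continue this matrix
distribution in s and to find its value at s = k. Since |det| is invariant under O(d), the test
function f may be averaged over O(d) acting on the left (`avg`).

For left invariant functions, Lebesgue measure on square matrices reduces to block triangular ones
with density |det a|, where a is the upper left block (`exists_disintegration`). For d = k + p let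
`detIntegral` be the integral of |det a|^z |det ξ|^{-z} against the function obtained from f by
setting the lower left block to zero, integrating out the upper right block, putting a in the upper
left block and taking the Fourier transform at ξ in the lower right p × p block. For k, p > 0 it
converges for |Re z| < 1. After the reduction to triangular matrices, moving one index from ξ to a
is a Fourier transform in a single corner entry, and the one-dimensional functional equation
γ(z)∫|x|^{-z}u = γ(1-z)∫|t|^{z-1}û (`functional_equation_line`) gives `detIntegral_shift`. With the
normalisation of `normInt` and z = s - k, the integrals for neighbouring k agree where the strips k
- 1 < Re s < k + 1 overlap, so they glue to an entire function, `regInt`. The last region, k = d, is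
the convergent integral of |det|^{s-d}. At s = k both powers disappear and integrating over ξ is
Fourier inversion: A_k is, up to a constant, the O(d)-average of integration over the matrices with
p vanishing rows.

The Fourier transform of integration over a subspace is integration over its orthogonal complement.
Hence the transform of A_k is a constant times the average over g in O(d) of Lebesgue measure on the
space U_g of configurations with sum zero and all points in gΠ, where Π is a fixed (d-k)-dimensional
coordinate plane (`detDist_fourierS`). The matrix `spread` makes the parametrisation of U_g
isometric; its determinant produces a power of d + 1.

Convolving Lebesgue measure on U, of dimension n = d(d-k), with dσ gives the density |S^{n-1}| (1 -
|P_{U⊥}x|²)_+^{(n-2)/2}, a form of Archimedes' theorem (`lintegral_sphere_projection`). On the unit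
sphere this is |S^{n-1}| |P_U ω|^{n-2}, and |P_U ω|² = (d+1) tr(P_{gΠ} Var_ω) for U = U_g
(`norm_sq_sliceAdj`). The average over g is the integral over the Grassmannian, and its mass
combines with the gamma factors (`constD_mul_mass`).

For n > 2 the density is an average of continuous functions. For n = 2, that is d = 2 and k = 1, it
averages indicators of solid cylinders; at a point ω of the unit sphere the jump is felt only by
those g with P_U ω = 0, and they form a null set unless Var_ω = 0. -/

/-- The local factor `Γ(z/2) / (2 π^{z/2})`. -/
def gammaFactor (z : ℂ) : ℂ := 1 / (2 * (Real.pi : ℂ) ^ (z / 2)) * Complex.Gamma (z / 2)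

theorem gammaN_eq_prod (n : ℕ) (z : ℂ) : gammaN n z = ∏ j ∈ Finset.range n, gammaFactor (z - j) :=
  rfl

theorem gammaN_succ (n : ℕ) (z : ℂ) : gammaN (n + 1) z = gammaN n z * gammaFactor (z - n) := by
  simp [gammaN_eq_prod, Finset.prod_range_succ]

theorem gammaN_succ' (n : ℕ) (z : ℂ) : gammaN (n + 1) z = gammaFactor z * gammaN n (z - 1) := by
  rw [gammaN_eq_prod, Finset.prod_range_succ', mul_comm, gammaN_eq_prod]
  simp only [Nat.cast_zero, sub_zero]
  congr 1
  refine Finset.prod_congr rfl fun j _ => ?_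
  congr 1; push_cast; ring

theorem gammaFactor_ne_zero {z : ℂ} (hz : 0 < z.re) : gammaFactor z ≠ 0 := by
  have hπ : (Real.pi : ℂ) ≠ 0 := by exact_mod_cast Real.pi_ne_zero
  refine mul_ne_zero (one_div_ne_zero (mul_ne_zero two_ne_zero ?_)) ?_
  · simp [Complex.cpow_eq_zero_iff, hπ]
  · exact Complex.Gamma_ne_zero_of_re_pos (by simpa using hz)

theorem gammaN_ne_zero {n : ℕ} {z : ℂ} (hz : (n : ℝ) - 1 < z.re) : gammaN n z ≠ 0 := by
  rw [gammaN_eq_prod, Finset.prod_ne_zero_iff]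
  intro j hj
  refine gammaFactor_ne_zero ?_
  have : (j : ℝ) + 1 ≤ n := by exact_mod_cast Finset.mem_range.1 hj
  simp; linarith

/-- Because 1/Γ is entire, dividing by the gamma factors never creates a pole; the normalisation of
the family rests on this. -/
theorem differentiable_inv_gammaFactor : Differentiable ℂ fun z => (gammaFactor z)⁻¹ := by
  have h : (fun z => (gammaFactor z)⁻¹) =
      fun z => 2 * (Real.pi : ℂ) ^ (z / 2) * (Complex.Gamma (z / 2))⁻¹ := by
    funext z
    simp [gammaFactor, mul_comm]
  rw [h]
  have hπ : (Real.pi : ℂ) ≠ 0 := by exact_mod_cast Real.pi_ne_zero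
  refine Differentiable.mul (Differentiable.mul (by fun_prop) ?_)
    (Complex.differentiable_one_div_Gamma.comp (differentiable_id.div_const 2))
  exact (differentiable_id.div_const 2).const_cpow (Or.inl hπ)

theorem differentiable_inv_gammaN (n : ℕ) : Differentiable ℂ fun z => (gammaN n z)⁻¹ := by
  simp only [gammaN_eq_prod, ← Finset.prod_inv_distrib]
  refine Differentiable.fun_finsetProd fun j _ => ?_
  exact differentiable_inv_gammaFactor.comp (differentiable_id.sub_const _)

/-! ### The functional equation of `|x|^{-z}` on the line -/

/-- Fubini, since the Mellin transform of a ↦ e^{-πax²} at w/2 is Γ(w/2) π^{-w/2} |x|^{-w}. The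
hypothesis `hint` is exactly the absolute convergence of the double integral. -/
theorem mellin_gaussian_average {v : ℝ → ℂ} {w : ℂ} (hw : 0 < w.re)
    (hv : AEStronglyMeasurable v volume)
    (hint : Integrable fun x : ℝ => ‖v x‖ * |x| ^ (-w.re)) :
    mellin (fun a : ℝ => ∫ x : ℝ, v x * Complex.exp (-(Real.pi * a * x ^ 2 : ℝ))) (w / 2) =
      2 * gammaFactor w * ∫ x : ℝ, ((|x| : ℝ) : ℂ) ^ (-w) * v x := by
  have hw2 : 0 < (w / 2).re := by simpa using hw
  have hne : ∀ᵐ x : ℝ, x ≠ 0 := by simp [ae_iff]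
  set K : ℝ × ℝ → ℂ := fun p => (p.2 : ℂ) ^ (w / 2 - 1) *
    (v p.1 * Complex.exp (-(Real.pi * p.2 * p.1 ^ 2 : ℝ))) with hK
  have hr : ∀ x : ℝ, x ≠ 0 → 0 < Real.pi * x ^ 2 := fun x hx => by positivity
  have hpos1 : ∀ x : ℝ, x ≠ 0 → (1 / ((Real.pi * x ^ 2 : ℝ) : ℂ)) ^ (w / 2) =
      1 / (Real.pi : ℂ) ^ (w / 2) * ((|x| : ℝ) : ℂ) ^ (-w) := by
    intro x hx
    have e1 : (1 / ((Real.pi * x ^ 2 : ℝ) : ℂ)) = ((Real.pi⁻¹ : ℝ) : ℂ) * (((|x|⁻¹) ^ 2 : ℝ) : ℂ) := by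
      rw [inv_pow, sq_abs]; push_cast; rw [one_div, mul_inv]
    rw [e1, Complex.mul_cpow_ofReal_nonneg (by positivity) (by positivity)]
    congr 1
    · rw [Complex.ofReal_inv, Complex.inv_cpow, one_div]
      rw [Complex.arg_ofReal_of_nonneg Real.pi_pos.le]; exact Real.pi_pos.ne
    · rw [Complex.ofReal_pow, Complex.ofReal_inv, inv_pow, ← Complex.ofReal_pow,
        Complex.inv_cpow, Complex.cpow_neg]
      · congr 1
        have h0 : ((|x| : ℝ) : ℂ) ≠ 0 := by exact_mod_cast (abs_pos.2 hx).ne'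
        rw [show (((|x| ^ 2 : ℝ)) : ℂ) = ((|x| : ℝ) : ℂ) * ((|x| : ℝ) : ℂ) by push_cast; ring,
          Complex.mul_cpow_ofReal_nonneg (abs_nonneg _) (abs_nonneg _), ← Complex.cpow_add _ _ h0]
        congr 1; ring
      · rw [Complex.arg_ofReal_of_nonneg (by positivity)]; exact Real.pi_pos.ne
  have hmeas : AEStronglyMeasurable K (volume.prod (volume.restrict (Ioi (0 : ℝ)))) := by
    refine AEStronglyMeasurable.mul ?_ (AEStronglyMeasurable.mul ?_ ?_)
    · refine Measurable.aestronglyMeasurable ?_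
      exact (Complex.measurable_ofReal.comp measurable_snd).pow_const _
    · exact hv.comp_fst
    · refine Continuous.aestronglyMeasurable ?_; fun_prop
  have hIntK : Integrable K (volume.prod (volume.restrict (Ioi (0 : ℝ)))) := by
    rw [integrable_prod_iff hmeas]
    have hnorm : ∀ x : ℝ, ∀ a ∈ Ioi (0 : ℝ),
        ‖K (x, a)‖ = ‖v x‖ * (a ^ (w.re / 2 - 1) * Real.exp (-(Real.pi * x ^ 2 * a))) := by
      intro x a ha
      simp only [hK, norm_mul]
      rw [Complex.norm_cpow_eq_rpow_re_of_pos ha, ← Complex.ofReal_neg, Complex.norm_exp_ofReal]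
      simp only [Complex.sub_re, Complex.div_ofNat_re, Complex.one_re]
      rw [show Real.pi * a * x ^ 2 = Real.pi * x ^ 2 * a by ring]; ring
    constructor
    · filter_upwards [hne] with x hx
      have h1 : IntegrableOn (fun a : ℝ => a ^ (w.re / 2 - 1) * Real.exp (-(Real.pi * x ^ 2 * a)))
          (Ioi 0) := by
        have := integrableOn_rpow_mul_exp_neg_mul_rpow (p := 1) (s := w.re / 2 - 1)
          (b := Real.pi * x ^ 2) (by linarith) (by norm_num) (hr x hx)
        simpa using this
      refine Integrable.mono' (h1.const_mul ‖v x‖) ?_ ?_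
      · refine AEStronglyMeasurable.mul ?_ ?_
        · exact (Complex.measurable_ofReal.pow_const _).aestronglyMeasurable
        · exact (show Continuous fun a : ℝ => v x * Complex.exp (-(Real.pi * a * x ^ 2 : ℝ)) from
            continuous_const.mul (by fun_prop)).aestronglyMeasurable
      · filter_upwards [ae_restrict_mem measurableSet_Ioi] with a ha
        rw [hnorm x a ha]
    · have : ∀ᵐ x : ℝ, ‖v x‖ * |x| ^ (-w.re) *
          ((1 / Real.pi) ^ (w.re / 2) * Real.Gamma (w.re / 2)) =
          ∫ a in Ioi (0 : ℝ), ‖K (x, a)‖ := by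
        filter_upwards [hne] with x hx
        rw [setIntegral_congr_fun measurableSet_Ioi (fun a ha => hnorm x a ha),
          integral_const_mul, Real.integral_rpow_mul_exp_neg_mul_Ioi (by linarith) (hr x hx),
          mul_assoc, ← mul_assoc (|x| ^ _)]
        congr 2
        rw [show (1 / (Real.pi * x ^ 2)) = (1 / Real.pi) * (|x| ^ 2)⁻¹ by
          rw [sq_abs, one_div, mul_inv, one_div], Real.mul_rpow (by positivity) (by positivity),
          mul_comm]
        congr 1
        rw [← Real.rpow_natCast, ← Real.rpow_neg (abs_nonneg _), ← Real.rpow_mul (abs_nonneg _)]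
        congr 1; push_cast; ring
      exact (hint.mul_const _).congr this
  have h1 : mellin (fun a : ℝ => ∫ x : ℝ, v x * Complex.exp (-(Real.pi * a * x ^ 2 : ℝ))) (w / 2) =
      ∫ a in Ioi (0 : ℝ), ∫ x, K (x, a) := by
    rw [mellin]
    refine integral_congr_ae (Filter.Eventually.of_forall fun a => ?_)
    simp only [smul_eq_mul, hK, integral_const_mul]
  rw [h1, ← integral_integral_swap (f := fun x a => K (x, a)) hIntK, ← integral_const_mul]
  refine integral_congr_ae ?_
  filter_upwards [hne] with x hx
  have h2 : ∀ a ∈ Ioi (0 : ℝ), K (x, a) =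
      v x * ((a : ℂ) ^ (w / 2 - 1) * Complex.exp (-(((Real.pi * x ^ 2 : ℝ) : ℂ) * a))) := by
    intro a _
    simp only [hK]
    rw [show (((Real.pi * a * x ^ 2 : ℝ) : ℂ)) = ((Real.pi * x ^ 2 : ℝ) : ℂ) * a by push_cast; ring]
    ring
  rw [setIntegral_congr_fun measurableSet_Ioi h2, integral_const_mul,
    Complex.integral_cpow_mul_exp_neg_mul_Ioi hw2 (by simpa using hr x hx), hpos1 x hx, gammaFactor]
  have hπ : (Real.pi : ℂ) ^ (w / 2) ≠ 0 := by
    simp [Complex.cpow_eq_zero_iff, Real.pi_ne_zero]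
  field_simp

/-- Both sides are Mellin transforms of Gaussian averages, of u and of its Fourier transform, and
the Fourier transform exchanges the Gaussians of parameters a and 1/a. Only integrability is asked
of u, because u will be obtained by integrating out other variables. -/
theorem functional_equation_line {u : ℝ → ℂ} {z : ℂ} (h0 : 0 < z.re) (h1 : z.re < 1)
    (hu : Integrable u) (h2 : Integrable fun x : ℝ => ‖u x‖ * |x| ^ (-z.re))
    (h3 : Integrable fun t : ℝ => ‖𝓕 u t‖ * |t| ^ (z.re - 1)) :
    gammaFactor z * ∫ x : ℝ, ((|x| : ℝ) : ℂ) ^ (-z) * u x =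
      gammaFactor (1 - z) * ∫ t : ℝ, ((|t| : ℝ) : ℂ) ^ (z - 1) * 𝓕 u t := by
  have hFc : Continuous (𝓕 u) :=
    VectorFourier.fourierIntegral_continuous Real.continuous_fourierChar
      (by exact continuous_inner) hu
  have hA := mellin_gaussian_average h0 hu.1 h2
  have hB := mellin_gaussian_average (v := 𝓕 u) (w := 1 - z) (by simpa using h1)
    hFc.aestronglyMeasurable (by simpa using h3)
  -- Move the Fourier transform from u to the Gaussian of parameter a⁻¹.
  have key : ∀ a : ℝ, 0 < a → (∫ x : ℝ, u x * Complex.exp (-(Real.pi * a * x ^ 2 : ℝ))) =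
      (a : ℂ) ^ (-(1 / 2) : ℂ) • ∫ t : ℝ, 𝓕 u t * Complex.exp (-(Real.pi * a⁻¹ * t ^ 2 : ℝ)) := by
    intro a ha
    have hb : 0 < ((a⁻¹ : ℝ) : ℂ).re := by simpa using ha
    have hg : Integrable (fun x : ℝ => Complex.exp (-Real.pi * ((a⁻¹ : ℝ) : ℂ) * x ^ 2)) := by
      have := integrable_cexp_neg_mul_sq (b := Real.pi * ((a⁻¹ : ℝ) : ℂ))
        (by simpa using mul_pos Real.pi_pos (inv_pos.2 ha))
      simpa [neg_mul] using this
    have hF := fourier_gaussian_pi hb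
    have hdual := VectorFourier.integral_fourierIntegral_smul_eq_flip (L := innerₗ ℝ)
      (μ := volume) (ν := volume) Real.continuous_fourierChar (by exact continuous_inner) hu hg
    have hdual' : ∫ t : ℝ, 𝓕 u t * Complex.exp (-Real.pi * ((a⁻¹ : ℝ) : ℂ) * t ^ 2) =
        ∫ x : ℝ, u x * 𝓕 (fun x : ℝ => Complex.exp (-Real.pi * ((a⁻¹ : ℝ) : ℂ) * x ^ 2)) x := by
      simpa [flip_innerₗ, Real.fourier_eq, VectorFourier.fourierIntegral] using! hdual
    have ha' : (a : ℂ) ≠ 0 := by exact_mod_cast ha.ne'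
    have e1 : ∀ x : ℝ, Complex.exp (-Real.pi * ((a⁻¹ : ℝ) : ℂ) * x ^ 2) =
        Complex.exp (-(Real.pi * a⁻¹ * x ^ 2 : ℝ)) := by
      intro x; push_cast; ring_nf
    simp only [e1] at hdual' hF
    rw [hdual', hF, smul_eq_mul, ← integral_const_mul]
    refine integral_congr_ae (Filter.Eventually.of_forall fun x => ?_)
    have e2 : Complex.exp (-Real.pi / ((a⁻¹ : ℝ) : ℂ) * x ^ 2) =
        Complex.exp (-(Real.pi * a * x ^ 2 : ℝ)) := by
      congr 1; push_cast; field_simp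
    have e3 : (1 : ℂ) / ((a⁻¹ : ℝ) : ℂ) ^ (1 / 2 : ℂ) = (a : ℂ) ^ (1 / 2 : ℂ) := by
      rw [Complex.ofReal_inv, Complex.inv_cpow, one_div, inv_inv]
      rw [Complex.arg_ofReal_of_nonneg ha.le]; exact Real.pi_pos.ne
    simp only [e2, e3]
    rw [mul_left_comm, ← mul_assoc ((a : ℂ) ^ _), ← Complex.cpow_add _ _ ha']
    simp
  -- The factor a^{-1/2} shifts the Mellin variable and a ↦ a⁻¹ reflects it, so z/2 becomes (1 -
  -- z)/2.
  have hAB : mellin (fun a : ℝ => ∫ x : ℝ, u x * Complex.exp (-(Real.pi * a * x ^ 2 : ℝ))) (z / 2) =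
      mellin (fun a : ℝ => ∫ t : ℝ, 𝓕 u t * Complex.exp (-(Real.pi * a * t ^ 2 : ℝ)))
        ((1 - z) / 2) := by
    have e : mellin (fun a : ℝ => ∫ x : ℝ, u x * Complex.exp (-(Real.pi * a * x ^ 2 : ℝ))) (z / 2) =
        mellin (fun a : ℝ => (a : ℂ) ^ (-(1 / 2) : ℂ) •
          (fun b : ℝ => ∫ t : ℝ, 𝓕 u t * Complex.exp (-(Real.pi * b * t ^ 2 : ℝ))) a⁻¹) (z / 2) := by
      rw [mellin, mellin]
      refine setIntegral_congr_fun measurableSet_Ioi fun a ha => ?_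
      simp only [key a ha]
    rw [e, mellin_cpow_smul, mellin_comp_inv
      (fun b : ℝ => ∫ t : ℝ, 𝓕 u t * Complex.exp (-(Real.pi * b * t ^ 2 : ℝ)))]
    congr 1; ring
  rw [hA, hB] at hAB
  rw [mul_assoc, mul_assoc, neg_sub] at hAB
  exact mul_left_cancel₀ two_ne_zero hAB

/-! ### Rapidly decreasing functions and partial Fourier inversion -/

/-- `f` decreases faster than any power of the norm. -/
def RapidDecay {E : Type*} [NormedAddCommGroup E] (f : E → ℂ) : Prop :=
  ∀ N : ℕ, ∃ C : ℝ, ∀ x, ‖f x‖ ≤ C * ((1 + ‖x‖) ^ N)⁻¹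

theorem RapidDecay.comp {E E' : Type*} [NormedAddCommGroup E] [NormedAddCommGroup E'] {f : E → ℂ}
    (hf : RapidDecay f) {g : E' → E} {K : ℝ} (hg : ∀ y, ‖y‖ ≤ K * (1 + ‖g y‖)) :
    RapidDecay fun y => f (g y) := by
  intro N
  obtain ⟨C, hC⟩ := hf N
  have hK : 0 ≤ K := by
    have := (norm_nonneg _).trans (hg 0)
    exact nonneg_of_mul_nonneg_left this (by positivity)
  have hC0 : 0 ≤ C := by
    have := (norm_nonneg _).trans (hC 0)
    exact nonneg_of_mul_nonneg_left this (by positivity)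
  refine ⟨C * (1 + K) ^ N, fun y => (hC (g y)).trans ?_⟩
  rw [mul_assoc]
  refine mul_le_mul_of_nonneg_left ?_ hC0
  rw [inv_le_iff_one_le_mul₀ (by positivity), mul_assoc, mul_comm, mul_assoc, mul_comm,
    ← div_eq_mul_inv, ← mul_pow, ← div_pow]
  refine one_le_pow₀ ?_
  rw [le_div_iff₀ (by positivity)]
  nlinarith [hg y, norm_nonneg (g y)]

theorem RapidDecay.integrable {E : Type*} [NormedAddCommGroup E] [NormedSpace ℝ E]
    [FiniteDimensional ℝ E] [MeasurableSpace E] [BorelSpace E] {μ : Measure E}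
    [μ.IsAddHaarMeasure] {f : E → ℂ} (hf : RapidDecay f) (hm : AEStronglyMeasurable f μ) :
    Integrable f μ := by
  obtain ⟨C, hC⟩ := hf (Module.finrank ℝ E + 1)
  have h := (integrable_one_add_norm (E := E) (μ := μ)
    (r := (Module.finrank ℝ E + 1 : ℕ)) (by push_cast; linarith)).const_mul C
  refine h.mono' hm (Filter.Eventually.of_forall fun x => (hC x).trans (le_of_eq ?_))
  rw [Real.rpow_neg (by positivity), Real.rpow_natCast]

theorem _root_.SchwartzMap.rapidDecay {E : Type*} [NormedAddCommGroup E] [NormedSpace ℝ E]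
    (f : 𝓢(E, ℂ)) : RapidDecay f := by
  intro N
  have h := fun x => SchwartzMap.one_add_le_sup_seminorm_apply (𝕜 := ℂ) (m := (N, 0)) (k := N)
    (n := 0) le_rfl le_rfl f x
  simp only [norm_iteratedFDeriv_zero] at h
  exact ⟨_, fun x => by
    rw [← div_eq_mul_inv, le_div_iff₀ (by positivity), mul_comm]; exact h x⟩

/-- A continuous function that is rapidly decreasing together with its Fourier transform. -/
structure IsNice {E : Type*} [NormedAddCommGroup E] [InnerProductSpace ℝ E]
    [FiniteDimensional ℝ E] [MeasurableSpace E] [BorelSpace E] (f : E → ℂ) : Prop where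
  continuous : Continuous f
  rapidDecay : RapidDecay f
  rapidDecay_fourier : RapidDecay (𝓕 f)

theorem continuous_fourier_of_integrable {E : Type*} [NormedAddCommGroup E] [InnerProductSpace ℝ E]
    [FiniteDimensional ℝ E] [MeasurableSpace E] [BorelSpace E] {f : E → ℂ} (hf : Integrable f) :
    Continuous (𝓕 f) :=
  VectorFourier.fourierIntegral_continuous Real.continuous_fourierChar
    (by exact continuous_inner) hf

theorem _root_.SchwartzMap.isNice {E : Type*} [NormedAddCommGroup E] [InnerProductSpace ℝ E]
    [FiniteDimensional ℝ E] [MeasurableSpace E] [BorelSpace E] (f : 𝓢(E, ℂ)) :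
    IsNice (f : E → ℂ) :=
  ⟨f.continuous, f.rapidDecay, by rw [← SchwartzMap.fourier_coe]; exact (𝓕 f).rapidDecay⟩

section PartialInversion

variable {E E₁ E₂ : Type*} [NormedAddCommGroup E] [InnerProductSpace ℝ E]
    [FiniteDimensional ℝ E] [MeasurableSpace E] [BorelSpace E]
    [NormedAddCommGroup E₁] [InnerProductSpace ℝ E₁]
    [FiniteDimensional ℝ E₁] [MeasurableSpace E₁] [BorelSpace E₁]
    [NormedAddCommGroup E₂] [NormedSpace ℝ E₂]
    [FiniteDimensional ℝ E₂] [MeasureSpace E₂] [BorelSpace E₂]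
    [(volume : Measure E₂).IsAddHaarMeasure]

theorem IsNice.integrable {f : E → ℂ} (hf : IsNice f) : Integrable f :=
  hf.rapidDecay.integrable hf.continuous.aestronglyMeasurable

theorem IsNice.continuous_fourier {f : E → ℂ} (hf : IsNice f) : Continuous (𝓕 f) :=
  continuous_fourier_of_integrable hf.integrable

theorem exists_norm_le_of_equiv {F F' : Type*} [NormedAddCommGroup F] [NormedSpace ℝ F]
    [NormedAddCommGroup F'] [NormedSpace ℝ F'] (J : F ≃L[ℝ] F') :
    ∃ K : ℝ, 0 ≤ K ∧ ∀ x, ‖x‖ ≤ K * ‖J x‖ :=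
  ⟨‖(J.symm : F' →L[ℝ] F)‖, norm_nonneg _, fun x => by
    simpa using (J.symm : F' →L[ℝ] F).le_opNorm (J x)⟩

/-- Integrating `f` against a character along a subspace amounts to integrating `𝓕 f` against a
character along an affine subspace. -/
theorem partial_fourier_inversion {f : E → ℂ} (hf : IsNice f) (J : (E₁ × E₂) ≃L[ℝ] E)
    (hJ : MeasurePreserving J (volume.prod volume) volume) (ι : E₁ →ₗ[ℝ] E)
    (hι : ∀ v u w, ⟪ι v, J (u, w)⟫ = ⟪v, u⟫) (θ : E) (hθ : ∀ u, ⟪θ, J (u, 0)⟫ = 0) (u : E₁) :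
    (∫ w, Complex.exp (-(2 * Real.pi * Complex.I * ⟪θ, J (u, w)⟫)) * f (J (u, w))) =
      ∫ v, Complex.exp (2 * Real.pi * Complex.I * ⟪v, u⟫) * 𝓕 f (ι v + θ) := by
  obtain ⟨K, hK0, hK⟩ := exists_norm_le_of_equiv J
  set e : E → ℂ := fun x => Complex.exp (-(2 * Real.pi * Complex.I * ⟪θ, x⟫)) with he
  have hen : ∀ x, ‖e x‖ = 1 := by
    intro x
    simp only [he]
    rw [show (-(2 * Real.pi * Complex.I * (⟪θ, x⟫ : ℝ)) : ℂ) =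
      ((-(2 * Real.pi * ⟪θ, x⟫) : ℝ) : ℂ) * Complex.I by push_cast; ring]
    exact Complex.norm_exp_ofReal_mul_I _
  have hec : Continuous e := by fun_prop
  -- The Fourier transform of h is the restriction of 𝓕 f to the affine subspace θ + ι E₁, so the
  -- claim is Fourier inversion for h.
  set h : E₁ → ℂ := fun u => ∫ w, e (J (u, w)) * f (J (u, w)) with hh
  have hgc : Continuous fun p : E₁ × E₂ => e (J p) * f (J p) :=
    (hec.comp J.continuous).mul (hf.continuous.comp J.continuous)
  have hgi : Integrable (fun p : E₁ × E₂ => e (J p) * f (J p)) (volume.prod volume) := by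
    have hi : Integrable (fun x => e x * f x) :=
      hf.integrable.mono (hec.mul hf.continuous).aestronglyMeasurable
        (Filter.Eventually.of_forall fun x => by rw [norm_mul, hen, one_mul])
    exact (hJ.integrable_comp_emb J.toHomeomorph.measurableEmbedding).2 hi
  have hhi : Integrable h := hgi.integral_prod_left
  have hhc : Continuous h := by
    obtain ⟨C, hC⟩ := hf.rapidDecay (Module.finrank ℝ E₂ + 1)
    have hC0 : 0 ≤ C := by
      have := (norm_nonneg _).trans (hC 0)
      exact nonneg_of_mul_nonneg_left this (by positivity)
    have hb := ((integrable_one_add_norm (E := E₂) (μ := volume)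
      (r := (Module.finrank ℝ E₂ + 1 : ℕ)) (by push_cast; linarith)).const_mul
        (C * (1 + K) ^ (Module.finrank ℝ E₂ + 1)))
    refine continuous_of_dominated (fun u => ?_) (fun u => ?_) hb ?_
    · exact (hgc.comp (Continuous.prodMk_right u)).aestronglyMeasurable
    · refine Filter.Eventually.of_forall fun w => ?_
      rw [norm_mul, hen, one_mul]
      refine (hC _).trans ?_
      rw [mul_assoc]
      refine mul_le_mul_of_nonneg_left ?_ hC0
      rw [Real.rpow_neg (by positivity), Real.rpow_natCast, inv_le_iff_one_le_mul₀ (by positivity),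
        mul_assoc, mul_comm, mul_assoc, mul_comm, ← div_eq_mul_inv, ← mul_pow, ← div_pow]
      refine one_le_pow₀ ?_
      rw [le_div_iff₀ (by positivity)]
      have h1 : ‖w‖ ≤ ‖(u, w)‖ := le_max_right _ _
      have h2 := hK (u, w)
      nlinarith [norm_nonneg (J (u, w))]
    · exact Filter.Eventually.of_forall fun w => hgc.comp (Continuous.prodMk_left w)
  have hθ' : ∀ u w, ⟪θ, J (u, w)⟫ = ⟪θ, J (0, w)⟫ := by
    intro u w
    have : J (u, w) = J (u, 0) + J (0, w) := by rw [← map_add]; simp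
    rw [this, inner_add_right, hθ, zero_add]
  have hhF : ∀ v, 𝓕 h v = 𝓕 f (ι v + θ) := by
    intro v
    rw [Real.fourier_eq', Real.fourier_eq']
    rw [← hJ.integral_comp J.toHomeomorph.measurableEmbedding, integral_prod]
    · refine integral_congr_ae (Filter.Eventually.of_forall fun u => ?_)
      simp only [hh]
      rw [← integral_smul]
      refine integral_congr_ae (Filter.Eventually.of_forall fun w => ?_)
      simp only [he, smul_eq_mul]
      rw [← mul_assoc, ← Complex.exp_add]
      congr 2
      rw [inner_add_right, real_inner_comm (ι v), hι, real_inner_comm θ, real_inner_comm v u]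
      push_cast; ring
    · have hi : Integrable (fun x => Complex.exp (((-2 * Real.pi * ⟪x, ι v + θ⟫ : ℝ) : ℂ) *
          Complex.I) • f x) := by
        refine hf.integrable.mono (Continuous.aestronglyMeasurable ?_)
          (Filter.Eventually.of_forall fun x => ?_)
        · exact Continuous.smul (f := fun x => Complex.exp
            (((-2 * Real.pi * ⟪x, ι v + θ⟫ : ℝ) : ℂ) * Complex.I)) (by fun_prop) hf.continuous
        · rw [norm_smul, Complex.norm_exp_ofReal_mul_I, one_mul]
      exact (hJ.integrable_comp_emb J.toHomeomorph.measurableEmbedding).2 hi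
  -- Pairing ι v with J (v, 0) gives ‖v‖², so ι is bounded below and the restriction of 𝓕 f still
  -- decays rapidly.
  have hιn : ∀ v, ‖v‖ ≤ (‖(J : (E₁ × E₂) →L[ℝ] E)‖ * (1 + ‖θ‖)) * (1 + ‖ι v + θ‖) := by
    intro v
    have h0 : ‖J (v, 0)‖ ≤ ‖(J : (E₁ × E₂) →L[ℝ] E)‖ * ‖v‖ := by
      simpa [Prod.norm_def] using (J : (E₁ × E₂) →L[ℝ] E).le_opNorm (v, 0)
    have hM : 0 ≤ ‖(J : (E₁ × E₂) →L[ℝ] E)‖ := ContinuousLinearMap.opNorm_nonneg _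
    set M := ‖(J : (E₁ × E₂) →L[ℝ] E)‖
    have h1 : ‖v‖ * ‖v‖ ≤ (M * ‖ι v‖) * ‖v‖ := by
      calc ‖v‖ * ‖v‖ = ⟪ι v, J (v, 0)⟫ := by rw [hι, real_inner_self_eq_norm_mul_norm]
        _ ≤ ‖ι v‖ * ‖J (v, 0)‖ := real_inner_le_norm _ _
        _ ≤ ‖ι v‖ * (M * ‖v‖) := by gcongr
        _ = _ := by ring
    have h2 : ‖v‖ ≤ M * ‖ι v‖ := by
      rcases (norm_nonneg v).eq_or_lt with hv | hv
      · rw [← hv]; positivity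
      · exact le_of_mul_le_mul_right h1 hv
    have h3 : ‖ι v‖ ≤ ‖ι v + θ‖ + ‖θ‖ := by
      simpa using norm_sub_le (ι v + θ) θ
    refine h2.trans ?_
    rw [mul_assoc]
    refine mul_le_mul_of_nonneg_left ?_ hM
    nlinarith [norm_nonneg θ, norm_nonneg (ι v + θ)]
  have hFi : Integrable (𝓕 h) := by
    rw [show 𝓕 h = fun v => 𝓕 f (ι v + θ) from funext hhF]
    refine (hf.rapidDecay_fourier.comp hιn).integrable ?_
    refine (hf.continuous_fourier.comp ?_).aestronglyMeasurable
    exact (LinearMap.continuous_of_finiteDimensional ι).add continuous_const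
  have hinv := congrFun (hhc.fourierInv_fourier_eq hhi hFi) u
  rw [Real.fourierInv_eq'] at hinv
  change h u = _
  rw [← hinv]
  refine integral_congr_ae (Filter.Eventually.of_forall fun v => ?_)
  simp only [hhF, smul_eq_mul]
  congr 2
  push_cast; ring

end PartialInversion

/-! ### Coordinates: joining blocks of variables, matrices as functions of two indices -/

section Join

variable {κ₁ κ₂ ι : Type} [Fintype κ₁] [Fintype κ₂] [Fintype ι]

/-- Two blocks of real variables put together along a partition of the index set. -/
def join (ε : κ₁ ⊕ κ₂ ≃ ι) : ((κ₁ → ℝ) × (κ₂ → ℝ)) ≃L[ℝ] (ι → ℝ) :=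
  LinearEquiv.toContinuousLinearEquiv
    { toFun := fun p i => Sum.elim p.1 p.2 (ε.symm i)
      invFun := fun x => (fun i => x (ε (Sum.inl i)), fun i => x (ε (Sum.inr i)))
      map_add' := fun p q => by
        funext i; rcases h : ε.symm i with j | j <;> simp [h]
      map_smul' := fun c p => by
        funext i; rcases h : ε.symm i with j | j <;> simp [h]
      left_inv := fun p => by simp
      right_inv := fun x => by
        funext i
        obtain ⟨j, rfl⟩ := ε.surjective i
        rcases j with j | j <;> simp }

theorem join_apply (ε : κ₁ ⊕ κ₂ ≃ ι) (p : (κ₁ → ℝ) × (κ₂ → ℝ)) (i : ι) :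
    join ε p i = Sum.elim p.1 p.2 (ε.symm i) := rfl

@[simp] theorem join_inl (ε : κ₁ ⊕ κ₂ ≃ ι) (p : (κ₁ → ℝ) × (κ₂ → ℝ)) (i : κ₁) :
    join ε p (ε (Sum.inl i)) = p.1 i := by simp [join_apply]

@[simp] theorem join_inr (ε : κ₁ ⊕ κ₂ ≃ ι) (p : (κ₁ → ℝ) × (κ₂ → ℝ)) (i : κ₂) :
    join ε p (ε (Sum.inr i)) = p.2 i := by simp [join_apply]

theorem measurePreserving_join (ε : κ₁ ⊕ κ₂ ≃ ι) :
    MeasurePreserving (join ε) (volume.prod volume) volume := by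
  have h1 := (volume_measurePreserving_sumPiEquivProdPi (fun _ : κ₁ ⊕ κ₂ => ℝ)).symm
  have h2 := volume_measurePreserving_piCongrLeft (fun _ : ι => ℝ) ε
  have h3 := h2.comp h1
  have he : ⇑(join ε) = MeasurableEquiv.piCongrLeft (fun _ : ι => ℝ) ε ∘
      (MeasurableEquiv.sumPiEquivProdPi fun _ : κ₁ ⊕ κ₂ => ℝ).symm := ?_
  · rw [he]; exact h3
  funext p
  funext i
  obtain ⟨j, rfl⟩ := ε.surjective i
  rcases j with j | j
  · simp only [join_inl, Function.comp_apply]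
    rw [MeasurableEquiv.coe_piCongrLeft, Equiv.piCongrLeft_apply_apply]; rfl
  · simp only [join_inr, Function.comp_apply]
    rw [MeasurableEquiv.coe_piCongrLeft, Equiv.piCongrLeft_apply_apply]; rfl

theorem lintegral_join (ε : κ₁ ⊕ κ₂ ≃ ι) {F : (ι → ℝ) → ℝ≥0∞} (hF : Measurable F) :
    ∫⁻ x, F x = ∫⁻ x₁, ∫⁻ x₂, F (join ε (x₁, x₂)) := by
  rw [← (measurePreserving_join ε).lintegral_comp hF, lintegral_prod]
  exact (hF.comp (join ε).continuous.measurable).aemeasurable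

/-- The sum of the squares of the coordinates. -/
def nsq {ι : Type} [Fintype ι] (x : ι → ℝ) : ℝ := ∑ i, x i ^ 2

theorem nsq_nonneg (x : ι → ℝ) : 0 ≤ nsq x := Finset.sum_nonneg fun _ _ => sq_nonneg _

theorem continuous_nsq : Continuous (nsq : (ι → ℝ) → ℝ) := by unfold nsq; fun_prop

theorem nsq_join (ε : κ₁ ⊕ κ₂ ≃ ι) (p : (κ₁ → ℝ) × (κ₂ → ℝ)) :
    nsq (join ε p) = nsq p.1 + nsq p.2 := by
  unfold nsq
  rw [← ε.sum_comp, Fintype.sum_sum_type]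
  simp

end Join

section Mat

variable {m n q : Type} [Fintype m] [Fintype n] [Fintype q]

/-- The matrix with the given entries. -/
def mat (X : m × n → ℝ) : Matrix m n ℝ := Matrix.of fun i j => X (i, j)

/-- The entries of a matrix. -/
def unmat (M : Matrix m n ℝ) : m × n → ℝ := fun p => M p.1 p.2

@[simp] theorem mat_unmat (M : Matrix m n ℝ) : mat (unmat M) = M := rfl

@[simp] theorem unmat_mat (X : m × n → ℝ) : unmat (mat X) = X := rfl

@[fun_prop] theorem continuous_mat : Continuous (mat : (m × n → ℝ) → Matrix m n ℝ) :=
  continuous_matrix fun _ _ => continuous_apply _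

@[fun_prop] theorem continuous_unmat : Continuous (unmat : Matrix m n ℝ → (m × n → ℝ)) :=
  continuous_pi fun p => continuous_apply_apply p.1 p.2

/-- Multiplication by a matrix on the left. -/
def lmul (h : Matrix m m ℝ) (X : m × n → ℝ) : m × n → ℝ := unmat (h * mat X)

/-- Multiplication by a matrix on the right. -/
def rmul (X : m × n → ℝ) (B : Matrix n n ℝ) : m × n → ℝ := unmat (mat X * B)

@[fun_prop] theorem continuous_lmul (h : Matrix m m ℝ) :
    Continuous (lmul h : (m × n → ℝ) → (m × n → ℝ)) := by
  unfold lmul; fun_prop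

@[fun_prop] theorem continuous_rmul (B : Matrix n n ℝ) :
    Continuous (fun X : m × n → ℝ => rmul X B) := by
  unfold rmul; fun_prop

variable [DecidableEq m] [DecidableEq n]

theorem lmul_eq (h : Matrix m m ℝ) :
    (lmul h : (m × n → ℝ) → (m × n → ℝ)) = Matrix.toLin' (h ⊗ₖ (1 : Matrix n n ℝ)) := by
  funext X p
  simp [lmul, unmat, Matrix.mul_apply, mat, Matrix.mulVec, dotProduct, Matrix.one_apply,
    Fintype.sum_prod_type]

theorem rmul_eq (B : Matrix n n ℝ) :
    (fun X : m × n → ℝ => rmul X B) = Matrix.toLin' ((1 : Matrix m m ℝ) ⊗ₖ B.transpose) := by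
  funext X p
  simp [rmul, unmat, Matrix.mul_apply, mat, Matrix.mulVec, dotProduct, Matrix.one_apply,
    Fintype.sum_prod_type, mul_comm]

theorem lintegral_mulVec {ι : Type} [Fintype ι] [DecidableEq ι] {M : Matrix ι ι ℝ} (hM : M.det ≠ 0)
    {F : (ι → ℝ) → ℝ≥0∞} (hF : Measurable F) :
    ENNReal.ofReal |M.det| * ∫⁻ x, F (Matrix.toLin' M x) = ∫⁻ x, F x := by
  have h := Real.map_matrix_volume_pi_eq_smul_volume_pi hM
  have hc : Measurable (Matrix.toLin' M) :=
    (LinearMap.continuous_of_finiteDimensional _).measurable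
  rw [← lintegral_map hF hc, h, lintegral_smul_measure, smul_eq_mul, ← mul_assoc,
    ← ENNReal.ofReal_mul (abs_nonneg _), ← abs_mul, mul_inv_cancel₀ hM]
  simp

/-- As a linear map on the entries, left multiplication is h ⊗ 1: it acts separately on each of the
n columns, which explains the power of the determinant. -/
theorem lintegral_lmul {h : Matrix m m ℝ} (hh : h.det ≠ 0) {F : (m × n → ℝ) → ℝ≥0∞}
    (hF : Measurable F) :
    ENNReal.ofReal (|h.det| ^ Fintype.card n) * ∫⁻ X, F (lmul h X) = ∫⁻ X, F X := by
  have hd : (h ⊗ₖ (1 : Matrix n n ℝ)).det = h.det ^ Fintype.card n := by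
    simp [Matrix.det_kronecker]
  rw [lmul_eq, ← abs_pow, ← hd]
  exact lintegral_mulVec (by rw [hd]; exact pow_ne_zero _ hh) hF

theorem lintegral_rmul {B : Matrix n n ℝ} (hB : B.det ≠ 0) {F : (m × n → ℝ) → ℝ≥0∞}
    (hF : Measurable F) :
    ENNReal.ofReal (|B.det| ^ Fintype.card m) * ∫⁻ X, F (rmul X B) = ∫⁻ X, F X := by
  have hd : ((1 : Matrix m m ℝ) ⊗ₖ B.transpose).det = B.det ^ Fintype.card m := by
    simp [Matrix.det_kronecker]
  have he : ∀ X : m × n → ℝ, rmul X B = Matrix.toLin' ((1 : Matrix m m ℝ) ⊗ₖ B.transpose) X :=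
    fun X => congrFun (rmul_eq B) X
  simp only [he]
  rw [← abs_pow, ← hd]
  exact lintegral_mulVec (by rw [hd]; exact pow_ne_zero _ hB) hF

theorem lmul_lmul (h h' : Matrix m m ℝ) (X : m × n → ℝ) : lmul h (lmul h' X) = lmul (h * h') X := by
  simp [lmul, Matrix.mul_assoc]

theorem rmul_lmul (h : Matrix m m ℝ) (X : m × n → ℝ) (B : Matrix n n ℝ) :
    rmul (lmul h X) B = lmul h (rmul X B) := by
  simp [lmul, rmul, Matrix.mul_assoc]

/-- Invariance under the orthogonal group acting on the left. -/
def IsLeftInvariant {R : Type*} (G : (m × n → ℝ) → R) : Prop :=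
  ∀ h ∈ Matrix.orthogonalGroup m ℝ, ∀ X, G (lmul h X) = G X

theorem abs_det_of_mem_orthogonal {h : Matrix m m ℝ} (hh : h ∈ Matrix.orthogonalGroup m ℝ) :
    |h.det| = 1 := by
  have h1 : h.det * h.det = 1 := by
    have := congrArg Matrix.det ((Matrix.mem_orthogonalGroup_iff _ _).1 hh)
    simpa [Matrix.det_mul, Matrix.star_eq_conjTranspose] using this
  rcases mul_self_eq_one_iff.1 h1 with h | h <;> simp [h]

theorem isLeftInvariant_nsq : IsLeftInvariant (nsq : (m × n → ℝ) → ℝ) := by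
  intro h hh X
  have key : ∀ X : m × n → ℝ, nsq X = ((mat X).transpose * mat X).trace := by
    intro X
    simp [nsq, Matrix.trace, Matrix.mul_apply, mat, Fintype.sum_prod_type, sq]
    rw [Finset.sum_comm]
  have hh' := (Matrix.mem_orthogonalGroup_iff' _ _).1 hh
  rw [key, key, lmul, mat_unmat, Matrix.transpose_mul, Matrix.mul_assoc, ← Matrix.mul_assoc _ h,
    show h.transpose * h = 1 from hh', Matrix.one_mul]

end Mat

/-! ### Disintegration of Lebesgue measure on matrices along the last column -/

variable {α : Type} [Fintype α] [DecidableEq α]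

/-- A zero row is appended to a square matrix. -/
def extendZero (A : α × α → ℝ) : (α ⊕ Unit) × α → ℝ :=
  fun p => Sum.elim (fun i => A (i, p.2)) (fun _ => 0) p.1

@[fun_prop] theorem continuous_extendZero :
    Continuous (extendZero : (α × α → ℝ) → ((α ⊕ Unit) × α → ℝ)) := by
  refine continuous_pi fun p => ?_
  rcases p with ⟨i | i, j⟩
  · exact continuous_apply _
  · exact continuous_const

theorem rmul_extendZero (A : α × α → ℝ) (B : Matrix α α ℝ) :
    rmul (extendZero A) B = extendZero (rmul A B) := by
  funext p
  rcases p with ⟨i | i, j⟩ <;> simp [rmul, extendZero, unmat, mat, Matrix.mul_apply]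

theorem nsq_extendZero (A : α × α → ℝ) : nsq (extendZero A) = nsq A := by
  simp [nsq, Fintype.sum_prod_type, extendZero]

/-- The Gram determinant of the columns. -/
def gramDet (X : (α ⊕ Unit) × α → ℝ) : ℝ := ((mat X).transpose * mat X).det

theorem continuous_gramDet : Continuous (gramDet : ((α ⊕ Unit) × α → ℝ) → ℝ) := by
  unfold gramDet
  exact ((continuous_mat.matrix_transpose).matrix_mul continuous_mat).matrix_det

theorem isLeftInvariant_gramDet : IsLeftInvariant (gramDet : ((α ⊕ Unit) × α → ℝ) → ℝ) := by
  intro h hh X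
  have hh' := (Matrix.mem_orthogonalGroup_iff' _ _).1 hh
  rw [gramDet, gramDet, lmul, mat_unmat, Matrix.transpose_mul, Matrix.mul_assoc,
    ← Matrix.mul_assoc _ h, hh', Matrix.one_mul]

theorem gramDet_extendZero (A : α × α → ℝ) : gramDet (extendZero A) = (mat A).det ^ 2 := by
  have : (mat (extendZero A)).transpose * mat (extendZero A) = (mat A).transpose * mat A := by
    ext i j
    simp [Matrix.mul_apply, mat, extendZero]
  rw [gramDet, this, Matrix.det_mul, Matrix.det_transpose, sq]

/-- Every matrix with one more row than columns becomes one with a zero row after an orthogonal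
transformation. -/
theorem exists_eq_lmul_extendZero (X : (α ⊕ Unit) × α → ℝ) :
    ∃ h ∈ Matrix.orthogonalGroup (α ⊕ Unit) ℝ, ∃ A : α × α → ℝ, X = lmul h (extendZero A) := by
  set W : Submodule ℝ (EuclideanSpace ℝ (α ⊕ Unit)) :=
    Submodule.span ℝ (Set.range fun j : α => WithLp.toLp 2 fun i => X (i, j)) with hW
  have hlt : Module.finrank ℝ W < Module.finrank ℝ (EuclideanSpace ℝ (α ⊕ Unit)) := by
    refine (finrank_range_le_card _).trans_lt ?_
    simp
  -- The columns cannot span the whole space, so there is a unit normal ν; h is an orthonormal basis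
  -- with ν in the last place, and the last row of hᵀX vanishes.
  have hne : Wᗮ ≠ ⊥ := by
    intro h
    rw [Submodule.orthogonal_eq_bot_iff] at h
    rw [h, finrank_top] at hlt
    exact lt_irrefl _ hlt
  obtain ⟨y, hy, hy0⟩ := Submodule.exists_mem_ne_zero_of_ne_bot hne
  set ν : EuclideanSpace ℝ (α ⊕ Unit) := (‖y‖⁻¹ : ℝ) • y with hν
  have hν1 : ‖ν‖ = 1 := by rw [hν, norm_smul]; simp [norm_ne_zero_iff.2 hy0]
  have hνW : ν ∈ Wᗮ := Submodule.smul_mem _ _ hy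
  have hon : Orthonormal ℝ (({Sum.inr ()} : Set (α ⊕ Unit)).domRestrict fun _ => ν) := by
    constructor
    · intro i; exact hν1
    · intro i j hij
      exact absurd (Subsingleton.elim i j) hij
  obtain ⟨b, hb⟩ := hon.exists_orthonormalBasis_extension_of_card_eq (by simp)
  have hbν : b (Sum.inr ()) = ν := hb _ rfl
  set h : Matrix (α ⊕ Unit) (α ⊕ Unit) ℝ := Matrix.of fun i j => b j i with hh
  have hho : h ∈ Matrix.orthogonalGroup (α ⊕ Unit) ℝ := by
    rw [Matrix.mem_orthogonalGroup_iff']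
    ext i j
    have := orthonormal_iff_ite.1 b.orthonormal i j
    simp only [Matrix.mul_apply, Matrix.transpose_apply, hh, Matrix.of_apply, Matrix.one_apply]
    rw [← this, PiLp.inner_apply]
    exact Finset.sum_congr rfl fun k _ => by simp [mul_comm]
  refine ⟨h, hho, fun p => (h.transpose * mat X) (Sum.inl p.1) p.2, ?_⟩
  have hX : X = lmul h (unmat (h.transpose * mat X)) := by
    rw [lmul, mat_unmat, ← Matrix.mul_assoc, (Matrix.mem_orthogonalGroup_iff _ _).1 hho,
      Matrix.one_mul, unmat_mat]
  conv_lhs => rw [hX]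
  congr 1
  funext p
  rcases p with ⟨i | i, j⟩
  · rfl
  · have hin : (WithLp.toLp 2 fun i => X (i, j)) ∈ W := Submodule.subset_span ⟨j, rfl⟩
    have h0 := Submodule.inner_left_of_mem_orthogonal hin hνW
    simp only [extendZero, unmat, Matrix.mul_apply, Sum.elim_inr]
    rw [← h0, PiLp.inner_apply]
    refine Finset.sum_congr rfl fun k _ => ?_
    simp [hh, mat, hbν, mul_comm]

/-- Along each line x + t v the determinant is the characteristic polynomial of -T x evaluated at t,
which has finitely many zeros; Fubini in the direction v does the rest. -/
theorem ae_det_ne_zero_of_add_smul {E : Type*} [NormedAddCommGroup E] [NormedSpace ℝ E]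
    [FiniteDimensional ℝ E] [MeasurableSpace E] [BorelSpace E] {μ : Measure E}
    [μ.IsAddHaarMeasure] (T : E →ₗ[ℝ] Matrix α α ℝ) (v : E) (hv : T v = 1) :
    ∀ᵐ x ∂μ, (T x).det ≠ 0 := by
  have hc : Continuous fun x => (T x).det :=
    (LinearMap.continuous_of_finiteDimensional T).matrix_det
  refine ae_mem_of_ae_add_linearMap_mem (LinearMap.toSpanSingleton ℝ E v) (volume : Measure ℝ) μ
    (isOpen_ne_fun hc continuous_const).measurableSet (s := {x | (T x).det ≠ 0}) fun x => ?_
  have hfin : {t : ℝ | ¬ (T (x + LinearMap.toSpanSingleton ℝ E v t)).det ≠ 0}.Finite := by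
    refine ((-T x).charpoly.roots.toFinset.finite_toSet).subset fun t ht => ?_
    simp only [mem_ofPred_eq, not_not] at ht
    simp only [Finset.mem_coe, Multiset.mem_toFinset]
    rw [Polynomial.mem_roots (Matrix.charpoly_monic _).ne_zero, Polynomial.IsRoot,
      Matrix.eval_charpoly]
    rw [← ht]
    congr 1
    simp [hv, Matrix.smul_one_eq_diagonal, add_comm]
  rw [ae_iff]
  exact hfin.measure_zero _

/-- A null vector of XᵀX is a null vector of X, hence of its upper square block, and that block is
almost surely invertible. -/
theorem ae_gramDet_ne_zero : ∀ᵐ X : (α ⊕ Unit) × α → ℝ, gramDet X ≠ 0 := by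
  let T : ((α ⊕ Unit) × α → ℝ) →ₗ[ℝ] Matrix α α ℝ :=
    { toFun := fun X => Matrix.of fun i j => X (Sum.inl i, j)
      map_add' := fun _ _ => rfl
      map_smul' := fun _ _ => rfl }
  have h := ae_det_ne_zero_of_add_smul (μ := volume) T (extendZero (unmat 1)) (by ext i j; rfl)
  filter_upwards [h] with X hX h0
  apply hX
  obtain ⟨v, hv0, hv⟩ := Matrix.exists_mulVec_eq_zero_iff.2 h0
  refine Matrix.exists_mulVec_eq_zero_iff.1 ⟨v, hv0, ?_⟩
  have h1 : (mat X).mulVec v = 0 := by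
    rw [← Matrix.mulVec_mulVec] at hv
    have h2 : dotProduct ((mat X).mulVec v) ((mat X).mulVec v) = 0 := by
      have := congrArg (dotProduct v) hv
      rw [dotProduct_zero, Matrix.dotProduct_mulVec, Matrix.vecMul_transpose] at this
      exact this
    exact dotProduct_self_eq_zero.1 h2
  funext i
  exact congrFun h1 (Sum.inl i)

theorem ae_det_mat_ne_zero : ∀ᵐ A : α × α → ℝ, (mat A).det ≠ 0 := by
  let T : (α × α → ℝ) →ₗ[ℝ] Matrix α α ℝ :=
    { toFun := mat
      map_add' := fun _ _ => rfl
      map_smul' := fun _ _ => rfl }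
  exact ae_det_ne_zero_of_add_smul (μ := volume) T (unmat 1) rfl

theorem inv_mat_eq (A : α × α → ℝ) : (mat A)⁻¹ = (mat A).det⁻¹ • (mat A).adjugate := by
  rw [Matrix.inv_def, Ring.inverse_eq_inv']

theorem measurable_inv_mat : Measurable fun A : α × α → ℝ => unmat (mat A)⁻¹ := by
  refine measurable_pi_lambda _ fun p => ?_
  simp only [unmat, inv_mat_eq, Matrix.smul_apply, smul_eq_mul]
  refine Measurable.mul ?_ ?_
  · exact (continuous_mat.matrix_det).measurable.inv
  · exact ((continuous_mat.matrix_adjugate).matrix_elem p.1 p.2).measurable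

theorem continuousAt_inv_mat {A : α × α → ℝ} (hA : (mat A).det ≠ 0) :
    ContinuousAt (fun A : α × α → ℝ => unmat (mat A)⁻¹) A := by
  refine continuousAt_pi.2 fun p => ?_
  simp only [unmat, inv_mat_eq, Matrix.smul_apply, smul_eq_mul]
  refine ContinuousAt.mul ?_ ?_
  · exact (continuous_mat.matrix_det).continuousAt.inv₀ hA
  · exact ((continuous_mat.matrix_adjugate).matrix_elem p.1 p.2).continuousAt

theorem isCompact_nsq_le {ι : Type} [Fintype ι] (R : ℝ) : IsCompact {x : ι → ℝ | nsq x ≤ R} := by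
  refine Metric.isCompact_of_isClosed_isBounded (isClosed_le continuous_nsq continuous_const) ?_
  refine (Metric.isBounded_closedBall (x := (0 : ι → ℝ)) (r := R + 1)).subset fun x hx => ?_
  have hR : 0 ≤ R := (nsq_nonneg x).trans hx
  rw [mem_closedBall_zero_iff, pi_norm_le_iff_of_nonneg (by linarith)]
  intro i
  have : x i ^ 2 ≤ R :=
    (Finset.single_le_sum (f := fun i => x i ^ 2) (fun _ _ => sq_nonneg _)
      (Finset.mem_univ i)).trans hx
  rw [Real.norm_eq_abs]
  exact abs_le_of_sq_le_sq (by nlinarith) (by linarith)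

-- Polar decomposition without Haar measure on a Stiefel manifold. An invariant test function φ is
-- inserted and ∬ φ(X) G(XA) |det A| dX dA is evaluated in both orders; each order yields one side,
-- times a constant depending on φ only.
set_option maxHeartbeats 1000000 in
theorem exists_disintegration_extendZero :
    ∃ c : ℝ, 0 < c ∧ ∀ G : ((α ⊕ Unit) × α → ℝ) → ℝ≥0∞, Measurable G → IsLeftInvariant G →
      ∫⁻ X, G X = ENNReal.ofReal c *
        ∫⁻ A : α × α → ℝ, ENNReal.ofReal |(mat A).det| * G (extendZero A) := by
  set q := Fintype.card α with hq
  -- Bounds chosen so that S is compact, stays away from the degenerate matrices, and has the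
  -- identity completed by a zero row (square norm q, Gram determinant 1) in its interior.
  set S : Set ((α ⊕ Unit) × α → ℝ) := {X | nsq X ≤ q + 1 ∧ 1 / 2 ≤ gramDet X} with hS
  have hSm : MeasurableSet S :=
    ((isClosed_le continuous_nsq continuous_const).inter
      (isClosed_le continuous_const continuous_gramDet)).measurableSet
  set φ : ((α ⊕ Unit) × α → ℝ) → ℝ≥0∞ := S.indicator 1 with hφ
  have hφm : Measurable φ := measurable_one.indicator hSm
  have hφi : IsLeftInvariant φ := by
    intro h hh X
    have : lmul h X ∈ S ↔ X ∈ S := by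
      simp only [hS, mem_ofPred_eq, isLeftInvariant_nsq h hh, isLeftInvariant_gramDet h hh]
    by_cases hX : X ∈ S
    · rw [hφ, indicator_of_mem hX, indicator_of_mem (this.2 hX)]; rfl
    · rw [hφ, indicator_of_notMem hX, indicator_of_notMem (fun hc => hX (this.1 hc))]
  have hdetm : Measurable fun A : α × α → ℝ => |(mat A).det| :=
    (continuous_mat.matrix_det).measurable.norm
  -- The density |det A|^{-q} of Haar measure on GL_q: one factor |det A| from the integrand, and
  -- |det A|^{-(q+1)} from the substitution X ↦ XA⁻¹.
  set κ : (α × α → ℝ) → ℝ := fun A => |(mat A).det| * (|(mat A).det| ^ (q + 1))⁻¹ with hκ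
  have hκm : Measurable κ := hdetm.mul (hdetm.pow_const _).inv
  have hκ0 : ∀ A, 0 ≤ κ A := fun A => by positivity
  set C₁ : ℝ≥0∞ := ∫⁻ A : α × α → ℝ, φ (extendZero (unmat (mat A)⁻¹)) * ENNReal.ofReal (κ A)
    with hC₁
  set C₂ : ℝ≥0∞ := ∫⁻ X, φ X * ENNReal.ofReal ((√(gramDet X) ^ (q + 1))⁻¹) with hC₂
  have hextm : Measurable fun A : α × α → ℝ => extendZero (unmat (mat A)⁻¹) :=
    continuous_extendZero.measurable.comp measurable_inv_mat
  have key : ∀ G : ((α ⊕ Unit) × α → ℝ) → ℝ≥0∞, Measurable G → IsLeftInvariant G →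
      C₁ * ∫⁻ X, G X =
        C₂ * ∫⁻ A : α × α → ℝ, ENNReal.ofReal |(mat A).det| * G (extendZero A) := by
    intro G hG hGi
    have hrc : Continuous fun p : ((α ⊕ Unit) × α → ℝ) × (α × α → ℝ) => rmul p.1 (mat p.2) :=
      continuous_unmat.comp (((continuous_mat.comp continuous_fst)).matrix_mul
        (continuous_mat.comp continuous_snd))
    -- With X fixed, write X = h (B; 0), so that invariance leaves G at (BA; 0). The substitution A
    -- ↦ BA and the weight contribute |det B|^{q+1}, where |det B| is the square root of the Gram
    -- determinant.
    have hJ1 : ∫⁻ X, ∫⁻ A : α × α → ℝ, φ X * (G (rmul X (mat A)) * ENNReal.ofReal |(mat A).det|) =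
        C₂ * ∫⁻ A : α × α → ℝ, ENNReal.ofReal |(mat A).det| * G (extendZero A) := by
      have hFm : Measurable fun A : α × α → ℝ =>
          ENNReal.ofReal |(mat A).det| * G (extendZero A) :=
        hdetm.ennreal_ofReal.mul (hG.comp continuous_extendZero.measurable)
      rw [hC₂, ← lintegral_mul_const]
      · refine lintegral_congr fun X => ?_
        by_cases hX : X ∈ S
        · rw [lintegral_const_mul, mul_assoc]
          · congr 1
            obtain ⟨h, hh, B, hB⟩ := exists_eq_lmul_extendZero X
            have hgd : gramDet X = (mat B).det ^ 2 := by
              rw [hB, isLeftInvariant_gramDet h hh, gramDet_extendZero]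
            have hb : (mat B).det ≠ 0 := by
              intro h0
              have := hX.2
              rw [hgd, h0] at this
              norm_num at this
            have hb' : 0 < |(mat B).det| := abs_pos.2 hb
            have h1 := lintegral_lmul (n := α) hb hFm
            have h2 : ∀ A : α × α → ℝ,
                ENNReal.ofReal |(mat (lmul (mat B) A)).det| * G (extendZero (lmul (mat B) A)) =
                ENNReal.ofReal |(mat B).det| *
                  (G (rmul X (mat A)) * ENNReal.ofReal |(mat A).det|) := by
              intro A
              have e1 : extendZero (lmul (mat B) A) = rmul (extendZero B) (mat A) := by
                rw [rmul_extendZero]; rfl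
              rw [e1, hB, rmul_lmul, hGi h hh, lmul, mat_unmat, Matrix.det_mul, abs_mul,
                ENNReal.ofReal_mul (abs_nonneg _)]
              ring
            simp only [h2] at h1
            rw [lintegral_const_mul, ← mul_assoc, ← ENNReal.ofReal_mul (by positivity),
              ← pow_succ] at h1
            · rw [hgd, Real.sqrt_sq_eq_abs, ← h1, ← mul_assoc, ← ENNReal.ofReal_mul (by positivity),
                inv_mul_cancel₀ (by positivity)]
              simp
            · exact (hG.comp (hrc.comp (Continuous.prodMk_right X)).measurable).mul
                hdetm.ennreal_ofReal
          · exact (hG.comp (hrc.comp (Continuous.prodMk_right X)).measurable).mul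
                hdetm.ennreal_ofReal
        · simp [hφ, indicator_of_notMem hX]
      · exact hφm.mul (((Real.continuous_sqrt.measurable.comp
          continuous_gramDet.measurable).pow_const _).inv.ennreal_ofReal)
    -- With A fixed, substitute X ↦ XA⁻¹. The remaining integral over A is against Haar measure of
    -- GL_q, so it does not depend on X and equals C₁.
    have hJ2 : ∫⁻ X, ∫⁻ A : α × α → ℝ, φ X * (G (rmul X (mat A)) * ENNReal.ofReal |(mat A).det|) =
        C₁ * ∫⁻ X, G X := by
      rw [lintegral_lintegral_swap]
      · have h1 : ∀ A : α × α → ℝ,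
            ∫⁻ X, φ X * (G (rmul X (mat A)) * ENNReal.ofReal |(mat A).det|) =
            ∫⁻ X, φ (rmul X (mat A)⁻¹) * ENNReal.ofReal (κ A) * G X := by
          intro A
          by_cases hA : (mat A).det = 0
          · simp [hκ, hA]
          have hA' : 0 < |(mat A).det| := abs_pos.2 hA
          have hu : IsUnit (mat A).det := isUnit_iff_ne_zero.2 hA
          have hFm : Measurable fun X : (α ⊕ Unit) × α → ℝ => φ (rmul X (mat A)⁻¹) * G X :=
            (hφm.comp (continuous_rmul _).measurable).mul hG
          have h2 := lintegral_rmul (m := α ⊕ Unit) hA hFm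
          have h3 : ∀ X : (α ⊕ Unit) × α → ℝ, rmul (rmul X (mat A)) (mat A)⁻¹ = X := by
            intro X
            simp [rmul, Matrix.mul_assoc, Matrix.mul_nonsing_inv _ hu]
          simp only [h3] at h2
          simp only [← mul_assoc, mul_right_comm _ (ENNReal.ofReal (κ A))]
          have hFm' : Measurable fun X : (α ⊕ Unit) × α → ℝ => φ X * G (rmul X (mat A)) :=
            hφm.mul (hG.comp (continuous_rmul _).measurable)
          rw [lintegral_mul_const _ hFm', lintegral_mul_const _ hFm, ← h2, mul_right_comm,
            ← ENNReal.ofReal_mul (by positivity), mul_comm]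
          congr 2
          rw [hκ]
          simp only [Fintype.card_sum, Fintype.card_unit, ← hq]
          field_simp
        simp only [h1]
        rw [lintegral_lintegral_swap]
        · rw [← lintegral_const_mul _ hG]
          refine lintegral_congr_ae ?_
          filter_upwards [ae_gramDet_ne_zero] with X hX
          have hm1 : Measurable fun A : α × α → ℝ =>
              φ (rmul X (mat A)⁻¹) * ENNReal.ofReal (κ A) := by
            refine (hφm.comp ?_).mul hκm.ennreal_ofReal
            have : Continuous fun B : α × α → ℝ => rmul X (mat B) :=
              hrc.comp (Continuous.prodMk_right X)
            exact this.measurable.comp measurable_inv_mat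
          rw [lintegral_mul_const _ hm1]
          congr 1
          obtain ⟨h, hh, B, hB⟩ := exists_eq_lmul_extendZero X
          have hgd : gramDet X = (mat B).det ^ 2 := by
            rw [hB, isLeftInvariant_gramDet h hh, gramDet_extendZero]
          have hb : (mat B).det ≠ 0 := fun h0 => hX (by rw [hgd, h0]; simp)
          have hb' : 0 < |(mat B).det| := abs_pos.2 hb
          have hbu : IsUnit (mat B).det := isUnit_iff_ne_zero.2 hb
          have h2 := lintegral_rmul (m := α) hb hm1
          rw [← h2, hC₁, ← lintegral_const_mul]
          · refine lintegral_congr fun A => ?_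
            rw [mul_left_comm, ← ENNReal.ofReal_mul (by positivity)]
            have e1 : φ (rmul X (mat (rmul A (mat B)))⁻¹) =
                φ (extendZero (unmat (mat A)⁻¹)) := by
              rw [hB, rmul_lmul, hφi h hh, rmul_extendZero]
              congr 2
              rw [rmul, rmul, mat_unmat, Matrix.mul_inv_rev, ← Matrix.mul_assoc,
                Matrix.mul_nonsing_inv _ hbu, Matrix.one_mul]
            rw [e1]
            congr 2
            simp only [hκ, rmul, mat_unmat, Matrix.det_mul, abs_mul]
            by_cases hA : (mat A).det = 0
            · simp [hA]
            have hA' : 0 < |(mat A).det| := abs_pos.2 hA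
            rw [← hq]
            field_simp
            ring
          · exact (hm1.comp (continuous_rmul _).measurable)
        · refine Measurable.aemeasurable (((hφm.comp ?_).mul
            (hκm.comp measurable_fst).ennreal_ofReal).mul (hG.comp measurable_snd))
          exact hrc.measurable.comp (measurable_snd.prodMk (measurable_inv_mat.comp measurable_fst))
      · exact Measurable.aemeasurable ((hφm.comp measurable_fst).mul ((hG.comp hrc.measurable).mul
          (hdetm.comp measurable_snd).ennreal_ofReal))
    rw [← hJ2, hJ1]
  -- It remains to see that both constants are positive and finite. K is the trace of S on square
  -- matrices, and the integrand of C₁ lives on the inverses of elements of K.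
  set K : Set (α × α → ℝ) := {B | nsq B ≤ q + 1 ∧ 1 / 2 ≤ (mat B).det ^ 2} with hK
  have hφK : ∀ B : α × α → ℝ, extendZero B ∈ S ↔ B ∈ K := by
    intro B
    simp only [hS, hK, mem_ofPred_eq, nsq_extendZero, gramDet_extendZero]
  have hKc : IsCompact K := by
    have hcl : IsClosed {B : α × α → ℝ | 1 / 2 ≤ (mat B).det ^ 2} :=
      isClosed_le continuous_const ((continuous_mat.matrix_det).pow 2)
    exact (isCompact_nsq_le (q + 1 : ℝ)).inter_right hcl
  have hKd : ∀ B ∈ K, (mat B).det ≠ 0 := by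
    intro B hB h0
    have := hB.2
    rw [h0] at this
    norm_num at this
  have hone : ∀ᶠ B in nhds (unmat (1 : Matrix α α ℝ)), nsq B < q + 1 ∧ 1 / 2 < (mat B).det ^ 2 := by
    have h1 : nsq (unmat (1 : Matrix α α ℝ)) < q + 1 := by
      have : nsq (unmat (1 : Matrix α α ℝ)) = q := by
        simp only [nsq, unmat, Fintype.sum_prod_type, Matrix.one_apply]
        simp [hq]
      rw [this]; linarith
    have h2 : (1 : ℝ) / 2 < (mat (unmat (1 : Matrix α α ℝ))).det ^ 2 := by
      rw [mat_unmat, Matrix.det_one]; norm_num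
    exact ((continuous_nsq.tendsto _).eventually_lt_const h1).and
      ((((continuous_mat.matrix_det).pow 2).tendsto _).eventually_const_lt h2)
  have hC₂pos : C₂ ≠ 0 := by
    refine (lt_of_lt_of_le ?_ (le_refl C₂)).ne'
    rw [hC₂, lintegral_pos_iff_support]
    · refine Measure.measure_pos_of_mem_nhds volume (x := extendZero (unmat (1 : Matrix α α ℝ))) ?_
      have h1 : nsq (extendZero (unmat (1 : Matrix α α ℝ))) < q + 1 := by
        rw [nsq_extendZero]; exact hone.self_of_nhds.1
      have h2 : 1 / 2 < gramDet (extendZero (unmat (1 : Matrix α α ℝ))) := by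
        rw [gramDet_extendZero]; exact hone.self_of_nhds.2
      filter_upwards [(continuous_nsq.tendsto _).eventually_lt_const h1,
        (continuous_gramDet.tendsto _).eventually_const_lt h2] with X hX1 hX2
      have hX : X ∈ S := ⟨hX1.le, hX2.le⟩
      have hg : 0 < gramDet X := by linarith
      simp only [Function.mem_support, hφ, indicator_of_mem hX, Pi.one_apply, one_mul]
      exact (ENNReal.ofReal_pos.2 (by positivity)).ne'
    · exact hφm.mul (((Real.continuous_sqrt.measurable.comp
          continuous_gramDet.measurable).pow_const _).inv.ennreal_ofReal)
  have hC₂fin : C₂ ≠ ⊤ := by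
    have hle : C₂ ≤ ∫⁻ X, {X : (α ⊕ Unit) × α → ℝ | nsq X ≤ q + 1}.indicator
        (fun _ => ENNReal.ofReal ((√(1 / 2) ^ (q + 1))⁻¹)) X := by
      refine lintegral_mono fun X => ?_
      by_cases hX : X ∈ S
      · have hX' : X ∈ {X : (α ⊕ Unit) × α → ℝ | nsq X ≤ q + 1} := hX.1
        simp only [hφ, indicator_of_mem hX, indicator_of_mem hX', Pi.one_apply, one_mul]
        have := hX.2
        gcongr
      · simp [hφ, indicator_of_notMem hX]
    refine (lt_of_le_of_lt hle ?_).ne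
    rw [lintegral_indicator_const (isClosed_le continuous_nsq continuous_const).measurableSet]
    exact ENNReal.mul_lt_top ENNReal.ofReal_lt_top (isCompact_nsq_le _).measure_lt_top
  have hC₁pos : C₁ ≠ 0 := by
    refine (lt_of_lt_of_le ?_ (le_refl C₁)).ne'
    rw [hC₁, lintegral_pos_iff_support]
    · refine Measure.measure_pos_of_mem_nhds volume (x := unmat (1 : Matrix α α ℝ)) ?_
      have hd1 : (mat (unmat (1 : Matrix α α ℝ))).det ≠ 0 := by simp
      have hca := continuousAt_inv_mat hd1
      have hone' : ∀ᶠ B in nhds (unmat (mat (unmat (1 : Matrix α α ℝ)))⁻¹),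
          nsq B < q + 1 ∧ 1 / 2 < (mat B).det ^ 2 := by
        rw [mat_unmat, inv_one]; exact hone
      filter_upwards [hca.eventually hone', ((continuous_mat.matrix_det).tendsto
        (unmat (1 : Matrix α α ℝ))).eventually_ne hd1] with A hA hA0
      have hX : extendZero (unmat (mat A)⁻¹) ∈ S := (hφK _).2 ⟨hA.1.le, hA.2.le⟩
      have hA' : 0 < |(mat A).det| := abs_pos.2 hA0
      simp only [Function.mem_support, hφ, indicator_of_mem hX, Pi.one_apply, one_mul]
      exact (ENNReal.ofReal_pos.2 (by positivity)).ne'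
    · exact (hφm.comp hextm).mul hκm.ennreal_ofReal
  have hC₁fin : C₁ ≠ ⊤ := by
    set T : Set (α × α → ℝ) := (fun B => unmat (mat B)⁻¹) '' K with hT
    have hTc : IsCompact T := hKc.image_of_continuousOn fun B hB =>
      (continuousAt_inv_mat (hKd B hB)).continuousWithinAt
    obtain ⟨M, hM⟩ := hKc.exists_bound_of_continuousOn (f := fun B => |(mat B).det| ^ q)
      (by fun_prop)
    have hle : C₁ ≤ ∫⁻ A, T.indicator (fun _ => ENNReal.ofReal M) A := by
      refine lintegral_mono fun A => ?_
      by_cases hA0 : (mat A).det = 0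
      · simp [hκ, hA0]
      have hA' : 0 < |(mat A).det| := abs_pos.2 hA0
      by_cases hA : extendZero (unmat (mat A)⁻¹) ∈ S
      · have hAK := (hφK _).1 hA
        have hAT : A ∈ T := ⟨_, hAK, by
          simp [Matrix.nonsing_inv_nonsing_inv _ (isUnit_iff_ne_zero.2 hA0)]⟩
        simp only [hφ, indicator_of_mem hA, indicator_of_mem hAT, Pi.one_apply, one_mul]
        refine ENNReal.ofReal_le_ofReal ((le_of_eq ?_).trans ((le_abs_self _).trans (hM _ hAK)))
        simp only [hκ, mat_unmat, Matrix.det_nonsing_inv, Ring.inverse_eq_inv', abs_inv]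
        rw [inv_pow, pow_succ]
        field_simp
      · simp [hφ, indicator_of_notMem hA]
    refine (lt_of_le_of_lt hle ?_).ne
    rw [lintegral_indicator_const hTc.isClosed.measurableSet]
    exact ENNReal.mul_lt_top ENNReal.ofReal_lt_top hTc.measure_lt_top
  refine ⟨(C₂ / C₁).toReal, ?_, fun G hG hGi => ?_⟩
  · exact ENNReal.toReal_pos (ENNReal.div_ne_zero.2 ⟨hC₂pos, hC₁fin⟩)
      (ENNReal.div_ne_top hC₂fin hC₁pos)
  · rw [ENNReal.ofReal_toReal (ENNReal.div_ne_top hC₂fin hC₁pos), div_eq_mul_inv, mul_right_comm,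
      ← key G hG hGi, mul_right_comm, ENNReal.mul_inv_cancel hC₁pos hC₁fin, one_mul]

/-! ### Reduction of square matrices to block triangular ones -/

section Square

variable {α : Type} [Fintype α] [DecidableEq α]

/-- The block triangular matrix with upper left block `a`, last column `(v, t)` and last row
`(0, t)`. -/
def tri (p : (α × α → ℝ) × ((α → ℝ) × ℝ)) : (α ⊕ Unit) × (α ⊕ Unit) → ℝ :=
  unmat (Matrix.fromBlocks (mat p.1) (Matrix.of fun i _ => p.2.1 i) 0 (Matrix.of fun _ _ => p.2.2))

@[simp] theorem tri_inl_inl (p : (α × α → ℝ) × ((α → ℝ) × ℝ)) (i j : α) :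
    tri p (Sum.inl i, Sum.inl j) = p.1 (i, j) := rfl

@[simp] theorem tri_inl_inr (p : (α × α → ℝ) × ((α → ℝ) × ℝ)) (i : α) (u : Unit) :
    tri p (Sum.inl i, Sum.inr u) = p.2.1 i := rfl

@[simp] theorem tri_inr_inl (p : (α × α → ℝ) × ((α → ℝ) × ℝ)) (u : Unit) (j : α) :
    tri p (Sum.inr u, Sum.inl j) = 0 := rfl

@[simp] theorem tri_inr_inr (p : (α × α → ℝ) × ((α → ℝ) × ℝ)) (u u' : Unit) :
    tri p (Sum.inr u, Sum.inr u') = p.2.2 := rfl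

theorem continuous_tri :
    Continuous (tri : (α × α → ℝ) × ((α → ℝ) × ℝ) → ((α ⊕ Unit) × (α ⊕ Unit) → ℝ)) := by
  refine continuous_pi fun p => ?_
  rcases p with ⟨i | i, j | j⟩ <;> simp only [tri_inl_inl, tri_inl_inr, tri_inr_inl, tri_inr_inr] <;>
    fun_prop

theorem det_tri (p : (α × α → ℝ) × ((α → ℝ) × ℝ)) :
    (mat (tri p)).det = (mat p.1).det * p.2.2 := by
  rw [tri, mat_unmat, Matrix.det_fromBlocks_zero₂₁]
  simp

theorem nsq_tri (p : (α × α → ℝ) × ((α → ℝ) × ℝ)) :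
    nsq (tri p) = nsq p.1 + nsq p.2.1 + p.2.2 ^ 2 := by
  simp [nsq, Fintype.sum_prod_type, Finset.sum_add_distrib]
  try ring

/-- The index set of a matrix, with the last column put apart. -/
def lastColumn (α : Type) : ((α ⊕ Unit) × α) ⊕ (α ⊕ Unit) ≃ (α ⊕ Unit) × (α ⊕ Unit) where
  toFun := Sum.elim (fun p => (p.1, Sum.inl p.2)) (fun i => (i, Sum.inr ()))
  invFun := fun p => Sum.elim (fun j => Sum.inl (p.1, j)) (fun _ => Sum.inr p.1) p.2
  left_inv := by rintro (⟨i, j⟩ | i) <;> rfl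
  right_inv := by rintro ⟨i, j | j⟩ <;> rfl

theorem join_lastColumn_inl (X : (α ⊕ Unit) × α → ℝ) (x : α ⊕ Unit → ℝ) (i : α ⊕ Unit) (j : α) :
    join (lastColumn α) (X, x) (i, Sum.inl j) = X (i, j) := rfl

theorem join_lastColumn_inr (X : (α ⊕ Unit) × α → ℝ) (x : α ⊕ Unit → ℝ) (i : α ⊕ Unit) (u : Unit) :
    join (lastColumn α) (X, x) (i, Sum.inr u) = x i := rfl

theorem lmul_join_lastColumn (h : Matrix (α ⊕ Unit) (α ⊕ Unit) ℝ) (X : (α ⊕ Unit) × α → ℝ)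
    (x : α ⊕ Unit → ℝ) :
    lmul h (join (lastColumn α) (X, x)) = join (lastColumn α) (lmul h X, h.mulVec x) := by
  funext p
  rcases p with ⟨i, j | j⟩
  · rw [join_lastColumn_inl]; rfl
  · rw [join_lastColumn_inr]; rfl

/-- A vector with one coordinate appended. -/
def snoc (p : (α → ℝ) × ℝ) : α ⊕ Unit → ℝ := Sum.elim p.1 fun _ => p.2

theorem measurePreserving_snoc :
    MeasurePreserving (snoc : (α → ℝ) × ℝ → (α ⊕ Unit → ℝ)) := by
  have h1 := (volume_preserving_funUnique Unit ℝ).symm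
  have h2 := (MeasurePreserving.id (volume : Measure (α → ℝ))).prod h1
  exact (measurePreserving_join (Equiv.refl (α ⊕ Unit))).comp h2

theorem join_lastColumn_extendZero (p : (α × α → ℝ) × ((α → ℝ) × ℝ)) :
    join (lastColumn α) (extendZero p.1, snoc p.2) = tri p := by
  funext q
  rcases q with ⟨i | i, j | j⟩ <;> rfl

/-- The integral of G over its last column is a left invariant function of the other columns, since
an orthogonal map of the last column preserves Lebesgue measure. The rectangular case applies to it.
-/
theorem exists_disintegration :
    ∃ c : ℝ, 0 < c ∧ ∀ G : ((α ⊕ Unit) × (α ⊕ Unit) → ℝ) → ℝ≥0∞, Measurable G →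
      IsLeftInvariant G →
      ∫⁻ Y, G Y = ENNReal.ofReal c *
        ∫⁻ p : (α × α → ℝ) × ((α → ℝ) × ℝ), ENNReal.ofReal |(mat p.1).det| * G (tri p) := by
  obtain ⟨c, hc, h⟩ := exists_disintegration_extendZero (α := α)
  refine ⟨c, hc, fun G hG hGi => ?_⟩
  have hjm : Measurable fun p : ((α ⊕ Unit) × α → ℝ) × (α ⊕ Unit → ℝ) =>
      G (join (lastColumn α) p) := hG.comp (join _).continuous.measurable
  rw [lintegral_join (lastColumn α) hG, h _ hjm.lintegral_prod_right']
  · congr 1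
    have hdm : Measurable fun A : α × α → ℝ => ENNReal.ofReal |(mat A).det| :=
      (continuous_mat.matrix_det).measurable.norm.ennreal_ofReal
    rw [Measure.volume_eq_prod, lintegral_prod]
    · refine lintegral_congr fun A => ?_
      have hm : Measurable fun x => G (join (lastColumn α) (extendZero A, x)) :=
        hjm.comp measurable_prodMk_left
      have hmt : Measurable fun y : (α → ℝ) × ℝ => G (tri (A, y)) :=
        hG.comp (continuous_tri.comp (Continuous.prodMk_right A)).measurable
      show _ = ∫⁻ y : (α → ℝ) × ℝ, ENNReal.ofReal |(mat A).det| * G (tri (A, y))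
      rw [lintegral_const_mul _ hmt, ← measurePreserving_snoc.lintegral_comp hm]
      congr 1
      exact lintegral_congr fun a => by rw [← join_lastColumn_extendZero]
    · exact ((hdm.comp measurable_fst).mul (hG.comp continuous_tri.measurable)).aemeasurable
  · intro k hk X
    have hd : k.det ≠ 0 := by
      intro h0
      have := abs_det_of_mem_orthogonal hk
      rw [h0] at this; simp at this
    have hm : Measurable fun x => G (join (lastColumn α) (lmul k X, x)) :=
      hjm.comp measurable_prodMk_left
    have h1 := lintegral_mulVec hd hm
    rw [abs_det_of_mem_orthogonal hk, ENNReal.ofReal_one, one_mul] at h1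
    show ∫⁻ y, G (join (lastColumn α) (lmul k X, y)) = ∫⁻ y, G (join (lastColumn α) (X, y))
    rw [← h1]
    refine lintegral_congr fun x => ?_
    rw [Matrix.toLin'_apply, ← lmul_join_lastColumn, hGi k hk]

variable (α) in
/-- The constant in the disintegration of Lebesgue measure on square matrices. -/
def disConst : ℝ := (exists_disintegration (α := α)).choose

variable (α) in
theorem disConst_pos : 0 < disConst α := (exists_disintegration (α := α)).choose_spec.1

theorem lintegral_of_isLeftInvariant {G : ((α ⊕ Unit) × (α ⊕ Unit) → ℝ) → ℝ≥0∞} (hG : Measurable G)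
    (hGi : IsLeftInvariant G) :
    ∫⁻ Y, G Y = ENNReal.ofReal (disConst α) *
      ∫⁻ p : (α × α → ℝ) × ((α → ℝ) × ℝ), ENNReal.ofReal |(mat p.1).det| * G (tri p) :=
  (exists_disintegration (α := α)).choose_spec.2 G hG hGi

/-- Passes from nonnegative to complex functions through the positive and negative parts of real and
imaginary parts. `P` stands for an invariance property inherited by every f ∘ G. -/
theorem integral_eq_of_lintegral_eq {X : Type*} [MeasurableSpace X] {μ ν : Measure X}
    {P : (X → ℝ≥0∞) → Prop} (h : ∀ G, Measurable G → P G → ∫⁻ x, G x ∂μ = ∫⁻ x, G x ∂ν)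
    {G : X → ℂ} (hG : Measurable G) (hP : ∀ f : ℂ → ℝ≥0∞, P fun x => f (G x)) :
    (Integrable G μ ↔ Integrable G ν) ∧ ∫ x, G x ∂μ = ∫ x, G x ∂ν := by
  have hi : Integrable G μ ↔ Integrable G ν := by
    have := h _ hG.enorm (hP fun z => ‖z‖ₑ)
    rw [Integrable, Integrable, HasFiniteIntegral, HasFiniteIntegral, this]
    simp [hG.aestronglyMeasurable]
  refine ⟨hi, ?_⟩
  by_cases hGi : Integrable G μ
  · have hGi' := hi.1 hGi
    have r1 : Integrable (fun x => (G x).re) μ := hGi.re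
    have r2 : Integrable (fun x => (G x).re) ν := hGi'.re
    have i1 : Integrable (fun x => (G x).im) μ := hGi.im
    have i2 : Integrable (fun x => (G x).im) ν := hGi'.im
    have hre : ∫ x, (G x).re ∂μ = ∫ x, (G x).re ∂ν := by
      rw [integral_eq_lintegral_pos_part_sub_lintegral_neg_part r1,
        integral_eq_lintegral_pos_part_sub_lintegral_neg_part r2,
        h (fun x => ENNReal.ofReal (G x).re) (Complex.measurable_re.comp hG).ennreal_ofReal
          (hP fun z => ENNReal.ofReal z.re),
        h (fun x => ENNReal.ofReal (-(G x).re)) (Complex.measurable_re.comp hG).neg.ennreal_ofReal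
          (hP fun z => ENNReal.ofReal (-z.re))]
    have him : ∫ x, (G x).im ∂μ = ∫ x, (G x).im ∂ν := by
      rw [integral_eq_lintegral_pos_part_sub_lintegral_neg_part i1,
        integral_eq_lintegral_pos_part_sub_lintegral_neg_part i2,
        h (fun x => ENNReal.ofReal (G x).im) (Complex.measurable_im.comp hG).ennreal_ofReal
          (hP fun z => ENNReal.ofReal z.im),
        h (fun x => ENNReal.ofReal (-(G x).im)) (Complex.measurable_im.comp hG).neg.ennreal_ofReal
          (hP fun z => ENNReal.ofReal (-z.im))]
    rw [← integral_re_add_im hGi, ← integral_re_add_im hGi']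
    simp only [RCLike.re_to_complex, RCLike.im_to_complex, hre, him]
  · rw [integral_undef hGi, integral_undef (fun hc => hGi (hi.2 hc))]

theorem integral_of_isLeftInvariant {G : ((α ⊕ Unit) × (α ⊕ Unit) → ℝ) → ℂ} (hG : Measurable G)
    (hGi : IsLeftInvariant G) :
    (Integrable G ↔ Integrable fun p : (α × α → ℝ) × ((α → ℝ) × ℝ) =>
      ((|(mat p.1).det| : ℝ) : ℂ) * G (tri p)) ∧
    ∫ Y, G Y = disConst α *
      ∫ p : (α × α → ℝ) × ((α → ℝ) × ℝ), ((|(mat p.1).det| : ℝ) : ℂ) * G (tri p) := by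
  have hdm : Measurable fun p : (α × α → ℝ) × ((α → ℝ) × ℝ) =>
      ENNReal.ofReal (disConst α * |(mat p.1).det|) :=
    ((((continuous_mat.matrix_det).measurable.norm).comp measurable_fst).const_mul _).ennreal_ofReal
  -- The triangular side is encoded as a measure ν that agrees with Lebesgue measure on invariant
  -- functions.
  set ν : Measure ((α ⊕ Unit) × (α ⊕ Unit) → ℝ) := Measure.map tri
    ((volume : Measure ((α × α → ℝ) × ((α → ℝ) × ℝ))).withDensity fun p =>
      ENNReal.ofReal (disConst α * |(mat p.1).det|)) with hν
  have hc := disConst_pos α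
  have h := integral_eq_of_lintegral_eq (μ := volume) (ν := ν) (P := IsLeftInvariant) (G := G)
    (fun G hG hGi => by
      have hGm : Measurable fun p : (α × α → ℝ) × ((α → ℝ) × ℝ) => G (tri p) :=
        hG.comp continuous_tri.measurable
      rw [lintegral_of_isLeftInvariant hG hGi, hν, lintegral_map hG continuous_tri.measurable,
        lintegral_withDensity_eq_lintegral_mul _ hdm hGm,
        ← lintegral_const_mul]
      · refine lintegral_congr fun p => ?_
        simp only [Pi.mul_apply, ENNReal.ofReal_mul hc.le]
        ring
      · exact ((((continuous_mat.matrix_det).measurable.norm).comp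
          measurable_fst).ennreal_ofReal).mul (hG.comp continuous_tri.measurable))
    hG (fun f h hh X => congrArg f (hGi h hh X))
  have htop : ∀ᵐ p : (α × α → ℝ) × ((α → ℝ) × ℝ),
      ENNReal.ofReal (disConst α * |(mat p.1).det|) < ∞ :=
    Filter.Eventually.of_forall fun p => ENNReal.ofReal_lt_top
  have hto : ∀ p : (α × α → ℝ) × ((α → ℝ) × ℝ),
      (ENNReal.ofReal (disConst α * |(mat p.1).det|)).toReal • G (tri p) =
      (disConst α : ℂ) * (((|(mat p.1).det| : ℝ) : ℂ) * G (tri p)) := by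
    intro p
    rw [ENNReal.toReal_ofReal (by positivity), Complex.real_smul]
    push_cast; ring
  constructor
  · rw [h.1, hν, integrable_map_measure hG.aestronglyMeasurable continuous_tri.aemeasurable,
      integrable_withDensity_iff_integrable_smul' hdm htop]
    simp only [Function.comp_apply, hto]
    rw [integrable_const_mul_iff]
    exact isUnit_iff_ne_zero.2 (by exact_mod_cast hc.ne')
  · rw [h.2, hν, integral_map continuous_tri.aemeasurable hG.aestronglyMeasurable,
      integral_withDensity_eq_integral_toReal_smul hdm htop, ← integral_const_mul]
    exact integral_congr_ae (Filter.Eventually.of_forall hto)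

end Square

/-! ### The constant of the reduction, from Gaussian integrals -/

/-- An index type with `n` elements, in a form adapted to induction on `n`. -/
def Idx : ℕ → Type
  | 0 => Empty
  | n + 1 => Idx n ⊕ Unit

instance instFintypeIdx : (n : ℕ) → Fintype (Idx n)
  | 0 => inferInstanceAs (Fintype Empty)
  | n + 1 => letI := instFintypeIdx n; inferInstanceAs (Fintype (Idx n ⊕ Unit))

instance instDecidableEqIdx : (n : ℕ) → DecidableEq (Idx n)
  | 0 => inferInstanceAs (DecidableEq Empty)
  | n + 1 => letI := instDecidableEqIdx n; inferInstanceAs (DecidableEq (Idx n ⊕ Unit))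

instance : IsEmpty (Idx 0) := inferInstanceAs (IsEmpty Empty)

theorem card_idx (n : ℕ) : Fintype.card (Idx n) = n := by
  induction n with
  | zero => exact Fintype.card_empty
  | succ n ih =>
    have : Fintype.card (Idx (n + 1)) = Fintype.card (Idx n ⊕ Unit) := rfl
    rw [this, Fintype.card_sum, ih, Fintype.card_unit]

/-- The real version of `gammaFactor`. -/
def gammaReal (s : ℝ) : ℝ := 1 / (2 * Real.pi ^ (s / 2)) * Real.Gamma (s / 2)

theorem ofReal_gammaReal (s : ℝ) : ((gammaReal s : ℝ) : ℂ) = gammaFactor s := by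
  rw [gammaReal, gammaFactor]
  push_cast
  rw [Complex.ofReal_cpow Real.pi_pos.le, ← Complex.Gamma_ofReal]
  push_cast
  rfl

theorem gammaReal_pos {s : ℝ} (hs : 0 < s) : 0 < gammaReal s := by
  unfold gammaReal
  have := Real.Gamma_pos_of_pos (half_pos hs)
  positivity

theorem integral_abs_rpow_mul_gaussian {r : ℝ} (hr : -1 < r) :
    ∫ t : ℝ, |t| ^ r * Real.exp (-Real.pi * t ^ 2) = 2 * gammaReal (r + 1) := by
  have h := integral_comp_abs (f := fun t => t ^ r * Real.exp (-Real.pi * t ^ 2))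
  simp only [sq_abs] at h
  rw [h]
  have h2 := integral_rpow_mul_exp_neg_mul_rpow (p := 2) (q := r) (b := Real.pi) (by norm_num) hr
    Real.pi_pos
  simp only [Real.rpow_two] at h2
  rw [h2, gammaReal, neg_div, Real.rpow_neg Real.pi_pos.le]
  ring

/-- The Bochner integral of a non-integrable function is 0 by convention, whereas this one is
positive. -/
theorem integrable_abs_rpow_mul_gaussian {r : ℝ} (hr : -1 < r) :
    Integrable fun t : ℝ => |t| ^ r * Real.exp (-Real.pi * t ^ 2) := by
  by_contra h
  have h1 := integral_abs_rpow_mul_gaussian hr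
  rw [integral_undef h] at h1
  have := gammaReal_pos (s := r + 1) (by linarith)
  linarith

theorem lintegral_abs_rpow_mul_gaussian {r : ℝ} (hr : -1 < r) :
    ∫⁻ t : ℝ, ENNReal.ofReal (|t| ^ r * Real.exp (-Real.pi * t ^ 2)) =
      ENNReal.ofReal (2 * gammaReal (r + 1)) := by
  rw [← integral_abs_rpow_mul_gaussian hr, ofReal_integral_eq_lintegral_ofReal
    (integrable_abs_rpow_mul_gaussian hr) (Filter.Eventually.of_forall fun t => by positivity)]

theorem lintegral_gaussian_nsq {ι : Type} [Fintype ι] :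
    ∫⁻ v : ι → ℝ, ENNReal.ofReal (Real.exp (-Real.pi * nsq v)) = 1 := by
  have h0 : ∀ v : ι → ℝ, Real.exp (-Real.pi * nsq v) = ∏ i, Real.exp (-Real.pi * v i ^ 2) := by
    intro v
    rw [← Real.exp_sum, nsq, Finset.mul_sum]
  have h1 : Integrable fun t : ℝ => Real.exp (-Real.pi * t ^ 2) :=
    integrable_exp_neg_mul_sq Real.pi_pos
  have h3 : Integrable fun v : ι → ℝ => ∏ i, Real.exp (-Real.pi * v i ^ 2) :=
    Integrable.fintype_prod fun _ => h1
  simp only [h0]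
  rw [← ofReal_integral_eq_lintegral_ofReal h3
    (Filter.Eventually.of_forall fun v => Finset.prod_nonneg fun i _ => (Real.exp_pos _).le)]
  have h2 := integral_fintype_prod_volume_eq_prod (ι := ι) (𝕜 := ℝ) (E := fun _ => ℝ)
    (fun _ t => Real.exp (-Real.pi * t ^ 2))
  rw [h2, integral_gaussian, div_self Real.pi_ne_zero, Real.sqrt_one]
  simp

/-- The density `|det a|^r w(a)` on square matrices. -/
theorem measurable_abs_det_rpow {α : Type} [Fintype α] [DecidableEq α] (r : ℝ) :
    Measurable fun a : α × α → ℝ => |(mat a).det| ^ r :=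
  (continuous_mat.matrix_det.measurable.norm).pow_const r

theorem abs_det_lmul {α : Type} [Fintype α] [DecidableEq α] {h : Matrix α α ℝ}
    (hh : h ∈ Matrix.orthogonalGroup α ℝ) (X : α × α → ℝ) :
    |(mat (lmul h X)).det| = |(mat X).det| := by
  have : mat (lmul h X) = h * mat X := rfl
  rw [this, Matrix.det_mul, abs_mul, abs_det_of_mem_orthogonal hh, one_mul]

section Step

variable {α : Type} [Fintype α] [DecidableEq α]

/-- Splitting off the last row and column in the integral of a power of the determinant. -/
theorem lintegral_abs_det_rpow_mul_nsq (r : ℝ) {w : ℝ → ℝ} (hw : Continuous w) :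
    ∫⁻ a : (α ⊕ Unit) × (α ⊕ Unit) → ℝ, ENNReal.ofReal (|(mat a).det| ^ r * w (nsq a)) =
    ENNReal.ofReal (disConst α) *
        ∫⁻ p : (α × α → ℝ) × ((α → ℝ) × ℝ), ENNReal.ofReal |(mat p.1).det| *
          ENNReal.ofReal (|(mat (tri p)).det| ^ r * w (nsq p.1 + nsq p.2.1 + p.2.2 ^ 2)) := by
  have hG : Measurable fun a : (α ⊕ Unit) × (α ⊕ Unit) → ℝ =>
      ENNReal.ofReal (|(mat a).det| ^ r * w (nsq a)) :=
    ((measurable_abs_det_rpow _).mul (hw.comp continuous_nsq).measurable).ennreal_ofReal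
  rw [lintegral_of_isLeftInvariant hG fun h hh X => by
      simp only [abs_det_lmul hh, isLeftInvariant_nsq h hh]]
  simp only [nsq_tri]

theorem lintegral_abs_det_rpow_mul {r : ℝ} (hr : -1 < r)
    {w₁ w₂ w₃ : ℝ → ℝ} (h₁ : Continuous w₁) (h₂ : Continuous w₂)
    (h₃ : Continuous w₃) (p₁ : ∀ x, 0 ≤ w₁ x) (p₂ : ∀ x, 0 ≤ w₂ x) :
    ∫⁻ p : (α × α → ℝ) × ((α → ℝ) × ℝ), ENNReal.ofReal |(mat p.1).det| *
          ENNReal.ofReal (|(mat (tri p)).det| ^ r *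
            (w₁ (nsq p.1) * w₂ (nsq p.2.1) * w₃ (p.2.2 ^ 2))) =
        (∫⁻ a : α × α → ℝ, ENNReal.ofReal (|(mat a).det| ^ (r + 1) * w₁ (nsq a))) *
        ((∫⁻ v : α → ℝ, ENNReal.ofReal (w₂ (nsq v))) *
        ∫⁻ t : ℝ, ENNReal.ofReal (|t| ^ r * w₃ (t ^ 2))) := by
  have m₁ : Measurable fun a : α × α → ℝ =>
      ENNReal.ofReal (|(mat a).det| ^ (r + 1) * w₁ (nsq a)) :=
    ((measurable_abs_det_rpow _).mul (h₁.comp continuous_nsq).measurable).ennreal_ofReal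
  have m₂ : Measurable fun v : α → ℝ => ENNReal.ofReal (w₂ (nsq v)) :=
    (h₂.comp continuous_nsq).measurable.ennreal_ofReal
  have m₃ : Measurable fun t : ℝ => ENNReal.ofReal (|t| ^ r * w₃ (t ^ 2)) :=
    ((continuous_abs.measurable.pow_const r).mul (by fun_prop)).ennreal_ofReal
  have m₄ : Measurable fun z : (α → ℝ) × ℝ =>
      ENNReal.ofReal (w₂ (nsq z.1)) * ENNReal.ofReal (|z.2| ^ r * w₃ (z.2 ^ 2)) :=
    (m₂.comp measurable_fst).mul (m₃.comp measurable_snd)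
  rw [← lintegral_prod_mul m₂.aemeasurable m₃.aemeasurable]
  have := lintegral_prod_mul (μ := volume) (ν := (volume : Measure (α → ℝ)).prod volume)
    m₁.aemeasurable m₄.aemeasurable
  rw [← this]
  refine lintegral_congr fun p => ?_
  have e : |(mat p.1).det| ^ (r + 1) = |(mat p.1).det| * |(mat p.1).det| ^ r := by
    by_cases h0 : |(mat p.1).det| = 0
    · rw [h0, Real.zero_rpow (by linarith), zero_mul]
    · rw [Real.rpow_add_one h0, mul_comm]
  rw [← ENNReal.ofReal_mul (p₂ _), ← ENNReal.ofReal_mul (mul_nonneg (by positivity) (p₁ _)),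
    ← ENNReal.ofReal_mul (abs_nonneg _), det_tri, abs_mul,
    Real.mul_rpow (abs_nonneg _) (abs_nonneg _), e]
  congr 1
  ring

end Step

/-- Splitting off a row and a column raises the exponent by one, through the density |det a|. What
splits off is a Gaussian vector of mass 1 and the one-dimensional integral 2γ(r + 1). -/
theorem lintegral_abs_det_rpow_mul_gaussian (n : ℕ) {r : ℝ} (hr : -1 < r) :
    ∫⁻ a : Idx n × Idx n → ℝ, ENNReal.ofReal (|(mat a).det| ^ r * Real.exp (-Real.pi * nsq a)) =
      ENNReal.ofReal ((∏ j ∈ Finset.range n, disConst (Idx j)) *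
        ∏ j ∈ Finset.range n, (2 * gammaReal (r + j + 1))) := by
  induction n generalizing r with
  | zero =>
    simp [Matrix.det_isEmpty, nsq, volume_pi]
  | succ n ih =>
    have hc : Continuous fun x : ℝ => Real.exp (-Real.pi * x) := by fun_prop
    have hp : ∀ x : ℝ, 0 ≤ Real.exp (-Real.pi * x) := fun x => (Real.exp_pos _).le
    refine (lintegral_abs_det_rpow_mul_nsq (α := Idx n) r hc).trans ?_
    have h : ∀ x y z : ℝ, Real.exp (-Real.pi * (x + y + z)) =
        Real.exp (-Real.pi * x) * Real.exp (-Real.pi * y) * Real.exp (-Real.pi * z) := by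
      intro x y z
      rw [← Real.exp_add, ← Real.exp_add]
      ring_nf
    simp only [h]
    rw [lintegral_abs_det_rpow_mul (α := Idx n) hr hc hc hc hp hp]
    · have e : ∀ j : ℕ, (r + 1 + j + 1 : ℝ) = r + ((j + 1 : ℕ) : ℝ) + 1 := by
        intro j; push_cast; ring
      have hpos : ∀ j : ℕ, 0 < gammaReal (r + j + 1) := fun j =>
        gammaReal_pos (by have : (0 : ℝ) ≤ j := j.cast_nonneg
                          linarith)
      have q₁ : 0 ≤ (∏ j ∈ Finset.range n, disConst (Idx j)) *
          ∏ j ∈ Finset.range n, (2 * gammaReal (r + ((j + 1 : ℕ) : ℝ) + 1)) :=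
        mul_nonneg (Finset.prod_nonneg fun j _ => (disConst_pos _).le)
          (Finset.prod_nonneg fun j _ => mul_nonneg zero_le_two (hpos _).le)
      rw [lintegral_gaussian_nsq, lintegral_abs_rpow_mul_gaussian hr, ih (by linarith), one_mul]
      simp only [e]
      rw [← ENNReal.ofReal_mul q₁, ← ENNReal.ofReal_mul (disConst_pos _).le,
        Finset.prod_range_succ, Finset.prod_range_succ' (fun j : ℕ => 2 * gammaReal (r + j + 1))]
      congr 1
      simp only [Nat.cast_zero, add_zero]
      ring

/-- At r = 0 the Gaussian has mass 1 for every n, so consecutive products can be compared. The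
constant is thus half the area of the n-sphere. -/
theorem disConst_idx (n : ℕ) : disConst (Idx n) * (2 * gammaReal (n + 1)) = 1 := by
  have key : ∀ n : ℕ, (∏ j ∈ Finset.range n, disConst (Idx j)) *
        ∏ j ∈ Finset.range n, (2 * gammaReal (j + 1)) = 1 := by
    intro n
    have h := lintegral_abs_det_rpow_mul_gaussian n (r := 0) (by norm_num)
    simp only [Real.rpow_zero, one_mul, zero_add] at h
    rw [lintegral_gaussian_nsq] at h
    exact (ENNReal.ofReal_eq_one.1 h.symm)
  have h1 := key (n + 1)
  rw [Finset.prod_range_succ, Finset.prod_range_succ] at h1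
  have h2 := key n
  linear_combination h1 - disConst (Idx n) * (2 * gammaReal (n + 1)) * h2

/-! ### Polynomial decay and convergence of determinant integrals -/

/-- The weight `(1 + |x|²)^{-N}` as a function of `|x|²`. -/
def decay (N : ℕ) (x : ℝ) : ℝ := ((1 + |x|) ^ N)⁻¹

theorem decay_pos (N : ℕ) (x : ℝ) : 0 < decay N x := by unfold decay; positivity

theorem continuous_decay (N : ℕ) : Continuous (decay N) := by
  unfold decay
  exact Continuous.inv₀ (by fun_prop) fun x => by positivity

theorem decay_le_one (N : ℕ) (x : ℝ) : decay N x ≤ 1 := by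
  unfold decay
  exact inv_le_one_of_one_le₀ (one_le_pow₀ (by linarith [abs_nonneg x]))

theorem decay_anti {M N : ℕ} (h : M ≤ N) (x : ℝ) : decay N x ≤ decay M x := by
  unfold decay
  exact inv_anti₀ (by positivity) (pow_le_pow_right₀ (by linarith [abs_nonneg x]) h)

theorem decay_le_decay (N : ℕ) {x y : ℝ} (hx : 0 ≤ x) (h : x ≤ y) : decay N y ≤ decay N x := by
  unfold decay
  rw [abs_of_nonneg hx, abs_of_nonneg (hx.trans h)]
  gcongr

theorem decay_add (M N : ℕ) (x : ℝ) : decay (M + N) x = decay M x * decay N x := by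
  unfold decay
  rw [pow_add, mul_inv]

/-- The weighted integral of `|det a|^r` is finite for large weights. -/
theorem lintegral_decay_lt_top {ι : Type} [Fintype ι] {N : ℕ} (hN : Fintype.card ι < N) :
    ∫⁻ v : ι → ℝ, ENNReal.ofReal (decay N (nsq v)) < ∞ := by
  have h1 : Integrable fun v : ι → ℝ => (2 : ℝ) ^ N * (1 + ‖v‖) ^ (-(2 * N : ℝ)) := by
    refine (integrable_one_add_norm ?_).const_mul _
    rw [Module.finrank_fintype_fun_eq_card]
    have : (Fintype.card ι : ℝ) < N := by exact_mod_cast hN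
    have : (0 : ℝ) ≤ N := N.cast_nonneg
    linarith
  refine lt_of_le_of_lt (lintegral_mono fun v => ENNReal.ofReal_le_ofReal ?_)
    h1.lintegral_lt_top
  have h2 : ‖v‖ ^ 2 ≤ nsq v := by
    rcases isEmpty_or_nonempty ι with h | h
    · simp [nsq, Subsingleton.elim v 0]
    · obtain ⟨i, -, hi⟩ := Finset.exists_mem_eq_sup' Finset.univ_nonempty fun i => ‖v i‖
      have h4 : ‖v‖ ≤ ‖v i‖ := (pi_norm_le_iff_of_nonneg (norm_nonneg _)).2 fun j => by
        rw [← hi]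
        exact Finset.le_sup' (fun i => ‖v i‖) (Finset.mem_univ j)
      calc ‖v‖ ^ 2 ≤ ‖v i‖ ^ 2 := by gcongr
        _ = v i ^ 2 := by rw [Real.norm_eq_abs, sq_abs]
        _ ≤ nsq v := Finset.single_le_sum (f := fun i => v i ^ 2) (fun j _ => sq_nonneg _)
          (Finset.mem_univ i)
  have h3 : (1 + ‖v‖) ^ 2 ≤ 2 * (1 + |nsq v|) := by
    rw [abs_of_nonneg (nsq_nonneg v)]
    nlinarith [sq_nonneg (1 - ‖v‖)]
  have h5 : (1 + ‖v‖) ^ (-(2 * N : ℝ)) = (((1 + ‖v‖) ^ 2) ^ N)⁻¹ := by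
    rw [Real.rpow_neg (by positivity), ← pow_mul, ← Real.rpow_natCast]
    push_cast
    rfl
  rw [h5, decay, ← div_eq_mul_inv, inv_eq_one_div, div_le_div_iff₀ (by positivity) (by positivity),
    one_mul, ← mul_pow]
  gcongr

/-- Compared with a Gaussian for |t| ≤ 1, where only r > -1 matters, and with 1/(1 + t²) for |t| ≥
1. -/
theorem exists_lintegral_abs_rpow_mul_decay_lt_top {r : ℝ} (hr : -1 < r) :
    ∃ N₀, ∀ N, N₀ ≤ N → ∫⁻ t : ℝ, ENNReal.ofReal (|t| ^ r * decay N (t ^ 2)) < ∞ := by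
  obtain ⟨m, hm⟩ := exists_nat_ge r
  refine ⟨m + 1, fun N hN => ?_⟩
  have h1 : Integrable fun t : ℝ => Real.exp Real.pi * (|t| ^ r * Real.exp (-Real.pi * t ^ 2)) +
      (1 + t ^ 2)⁻¹ :=
    ((integrable_abs_rpow_mul_gaussian hr).const_mul _).add integrable_inv_one_add_sq
  refine lt_of_le_of_lt (lintegral_mono fun t => ENNReal.ofReal_le_ofReal ?_)
    h1.lintegral_lt_top
  have hp : 0 ≤ Real.exp Real.pi * (|t| ^ r * Real.exp (-Real.pi * t ^ 2)) := by positivity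
  rcases le_total |t| 1 with ht | ht
  · have h2 : t ^ 2 ≤ 1 := by rw [← sq_abs]; exact pow_le_one₀ (abs_nonneg _) ht
    have h3 : 1 ≤ Real.exp Real.pi * Real.exp (-Real.pi * t ^ 2) := by
      rw [← Real.exp_add]
      exact Real.one_le_exp (by nlinarith [Real.pi_pos])
    have h4 : |t| ^ r * decay N (t ^ 2) ≤ |t| ^ r * 1 := by
      gcongr; exact decay_le_one _ _
    have h5 : |t| ^ r * 1 ≤ |t| ^ r * (Real.exp Real.pi * Real.exp (-Real.pi * t ^ 2)) := by gcongr
    have : 0 ≤ (1 + t ^ 2)⁻¹ := by positivity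
    nlinarith
  · have h2 : |t| ^ r ≤ (1 + t ^ 2) ^ m := by
      calc |t| ^ r ≤ |t| ^ (m : ℝ) := Real.rpow_le_rpow_of_exponent_le ht hm
        _ = |t| ^ m := Real.rpow_natCast _ _
        _ ≤ (1 + t ^ 2) ^ m := by
          gcongr
          rw [← sq_abs]; nlinarith
    have h3 : decay N (t ^ 2) ≤ decay (m + 1) (t ^ 2) := decay_anti hN _
    have h4 : |t| ^ r * decay N (t ^ 2) ≤ (1 + t ^ 2) ^ m * decay (m + 1) (t ^ 2) :=
      mul_le_mul h2 h3 (decay_pos _ _).le (by positivity)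
    have h5 : (1 + t ^ 2) ^ m * decay (m + 1) (t ^ 2) = (1 + t ^ 2)⁻¹ := by
      rw [decay, abs_of_nonneg (sq_nonneg t), pow_succ (1 + t ^ 2) m, mul_inv, ← mul_assoc,
        mul_inv_cancel₀ (by positivity), one_mul]
    linarith

/-- The same induction as for the Gaussian. The condition r > -1 comes from the corner entry alone,
as the smaller block carries the exponent r + 1. -/
theorem exists_lintegral_abs_det_rpow_mul_decay_lt_top (n : ℕ) {r : ℝ} (hr : -1 < r) :
    ∃ N₀, ∀ N, N₀ ≤ N →
      ∫⁻ a : Idx n × Idx n → ℝ, ENNReal.ofReal (|(mat a).det| ^ r * decay N (nsq a)) < ∞ := by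
  induction n generalizing r with
  | zero =>
    refine ⟨0, fun N _ => ?_⟩
    simp [Matrix.det_isEmpty, nsq, volume_pi]
  | succ n ih =>
    obtain ⟨N₁, h₁⟩ := ih (r := r + 1) (by linarith)
    obtain ⟨N₂, h₂⟩ := exists_lintegral_abs_rpow_mul_decay_lt_top hr
    set M := N₁ + N₂ + n + 1 with hM
    -- The weight does not factor as the Gaussian does; three copies of M give one factor for each
    -- of the block, the column and the corner.
    refine ⟨3 * M, fun N hN => ?_⟩
    refine lt_of_eq_of_lt
      (lintegral_abs_det_rpow_mul_nsq (α := Idx n) r (continuous_decay N)) ?_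
    refine ENNReal.mul_lt_top ENNReal.ofReal_lt_top (lt_of_le_of_lt (lintegral_mono
      (g := fun p => ENNReal.ofReal |(mat p.1).det| *
          ENNReal.ofReal (|(mat (tri p)).det| ^ r *
            (decay M (nsq p.1) * decay M (nsq p.2.1) * decay M (p.2.2 ^ 2)))) fun p => ?_) ?_)
    · have q1 := nsq_nonneg p.1
      have q2 := nsq_nonneg p.2.1
      have q3 := sq_nonneg p.2.2
      dsimp only
      gcongr
      refine (decay_anti hN _).trans ?_
      have e3 : 3 * M = M + M + M := by ring
      rw [e3, decay_add, decay_add]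
      have d1 := (decay_pos M (nsq p.1)).le
      have d2 := (decay_pos M (nsq p.2.1)).le
      have d3 := (decay_pos M (nsq p.1 + nsq p.2.1 + p.2.2 ^ 2)).le
      refine mul_le_mul (mul_le_mul (decay_le_decay M q1 (by linarith))
        (decay_le_decay M q2 (by linarith)) d3 d1) (decay_le_decay M q3 (by linarith)) d3
        (mul_nonneg d1 d2)
    · rw [lintegral_abs_det_rpow_mul hr (continuous_decay M) (continuous_decay M)
        (continuous_decay M) (fun x => (decay_pos M x).le) fun x => (decay_pos M x).le]
      exact ENNReal.mul_lt_top (h₁ M (by omega)) (ENNReal.mul_lt_top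
        (lintegral_decay_lt_top (by rw [card_idx]; omega)) (h₂ M (by omega)))

/-! ### Fourier transforms in some of the coordinates -/

/-- The character `e^{2πit}`. -/
def chr (t : ℝ) : ℂ := Complex.exp (2 * Real.pi * Complex.I * t)

@[fun_prop] theorem continuous_chr : Continuous chr := by unfold chr; fun_prop

@[simp] theorem norm_chr (t : ℝ) : ‖chr t‖ = 1 := by
  rw [chr, Complex.norm_exp]; simp

theorem chr_add (s t : ℝ) : chr (s + t) = chr s * chr t := by
  unfold chr
  rw [← Complex.exp_add]; push_cast; ring_nf

@[simp] theorem chr_zero : chr 0 = 1 := by simp [chr]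

theorem chr_neg (t : ℝ) : chr (-t) = Complex.exp (-(2 * Real.pi * Complex.I * t)) := by
  unfold chr; push_cast; ring_nf

section Coordinates

variable {κ₁ κ₂ κ : Type} [Fintype κ₁] [Fintype κ₂] [Fintype κ]

theorem norm_sq_toLp (x : κ → ℝ) : ‖WithLp.toLp 2 x‖ ^ 2 = nsq x := by
  rw [EuclideanSpace.norm_sq_eq]; simp [nsq]

theorem inner_toLp (x y : κ → ℝ) :
    (⟪WithLp.toLp 2 x, WithLp.toLp 2 y⟫ : ℝ) = x ⬝ᵥ y := by
  simp [PiLp.inner_apply, dotProduct, mul_comm]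

theorem dotProduct_join (ε : κ₁ ⊕ κ₂ ≃ κ) (p q : (κ₁ → ℝ) × (κ₂ → ℝ)) :
    join ε p ⬝ᵥ join ε q = p.1 ⬝ᵥ q.1 + p.2 ⬝ᵥ q.2 := by
  unfold dotProduct
  rw [← ε.sum_comp, Fintype.sum_sum_type]
  simp

/-- Integrating a nice function against a character in some of the coordinates amounts to
integrating its Fourier transform against a character in the others. -/
theorem integral_chr_mul_join {f : EuclideanSpace ℝ κ → ℂ} (hf : IsNice f) (ε : κ₁ ⊕ κ₂ ≃ κ)
    (u : κ₁ → ℝ) (η : κ₂ → ℝ) :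
    ∫ w, chr (-(η ⬝ᵥ w)) * f (WithLp.toLp 2 (join ε (u, w))) =
      ∫ v, chr (v ⬝ᵥ u) * 𝓕 f (WithLp.toLp 2 (join ε (v, η))) := by
  set J : (EuclideanSpace ℝ κ₁ × (κ₂ → ℝ)) ≃L[ℝ] EuclideanSpace ℝ κ :=
    (((EuclideanSpace.equiv κ₁ ℝ).prodCongr (ContinuousLinearEquiv.refl ℝ (κ₂ → ℝ))).trans
      (join ε)).trans (EuclideanSpace.equiv κ ℝ).symm with hJ
  have hJa : ∀ p, J p = WithLp.toLp 2 (join ε (WithLp.ofLp p.1, p.2)) := fun p => rfl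
  have hJm : MeasurePreserving J (volume.prod volume) volume := by
    have h1 : MeasurePreserving (Prod.map (WithLp.ofLp : EuclideanSpace ℝ κ₁ → (κ₁ → ℝ))
        (id : (κ₂ → ℝ) → (κ₂ → ℝ))) (volume.prod volume) (volume.prod volume) :=
      (PiLp.volume_preserving_ofLp κ₁).prod (MeasurePreserving.id _)
    exact ((PiLp.volume_preserving_toLp κ).comp (measurePreserving_join ε)).comp h1
  have hin : ∀ p q, (⟪J p, J q⟫ : ℝ) = WithLp.ofLp p.1 ⬝ᵥ WithLp.ofLp q.1 + p.2 ⬝ᵥ q.2 := by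
    intro p q
    rw [hJa, hJa, inner_toLp, dotProduct_join]
  have hin1 : ∀ v w : EuclideanSpace ℝ κ₁, (⟪v, w⟫ : ℝ) = WithLp.ofLp v ⬝ᵥ WithLp.ofLp w :=
    fun v w => inner_toLp _ _
  have h := partial_fourier_inversion hf J hJm
    ((J : (EuclideanSpace ℝ κ₁ × (κ₂ → ℝ)) →ₗ[ℝ] EuclideanSpace ℝ κ) ∘ₗ LinearMap.inl ℝ _ _)
    (fun v u w => by
      show (⟪J (v, 0), J (u, w)⟫ : ℝ) = _
      rw [hin, hin1]; simp) (J (0, η)) (fun u => by rw [hin]; simp) (WithLp.toLp 2 u)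
  simp only [hin, hin1] at h
  rw [← (PiLp.volume_preserving_ofLp κ₁).integral_comp
    (MeasurableEquiv.toLp 2 (κ₁ → ℝ)).symm.measurableEmbedding]
  refine (integral_congr_ae (Filter.Eventually.of_forall fun w => ?_)).trans
    (h.trans (integral_congr_ae (Filter.Eventually.of_forall fun v => ?_)))
  · simp only [chr_neg, hJa, WithLp.ofLp_zero, zero_dotProduct, zero_add]
  · have : J (v, 0) + J (0, η) = J (v, η) := by rw [← map_add]; simp
    show Complex.exp _ * 𝓕 f (J (v, 0) + J (0, η)) = chr (v.ofLp ⬝ᵥ u) * _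
    rw [this]; rfl

/-- `|f(x)| ≤ C (1 + |x|²)^{-M}`, in coordinates. -/
def DecayBound (M : ℕ) (C : ℝ) (f : EuclideanSpace ℝ κ → ℂ) : Prop :=
  ∀ x : κ → ℝ, ‖f (WithLp.toLp 2 x)‖ ≤ C * decay M (nsq x)

theorem DecayBound.nonneg {M : ℕ} {C : ℝ} {f : EuclideanSpace ℝ κ → ℂ} (h : DecayBound M C f) :
    0 ≤ C := by
  have := (norm_nonneg _).trans (h 0)
  exact nonneg_of_mul_nonneg_left this (decay_pos _ _)

theorem DecayBound.mono {M N : ℕ} {C D : ℝ} {f : EuclideanSpace ℝ κ → ℂ} (h : DecayBound M C f)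
    (hN : N ≤ M) (hC : C ≤ D) : DecayBound N D f := fun x =>
  (h x).trans (mul_le_mul hC (decay_anti hN _) (decay_pos _ _).le (h.nonneg.trans hC))

theorem RapidDecay.exists_decayBound {f : EuclideanSpace ℝ κ → ℂ} (h : RapidDecay f) (M : ℕ) :
    ∃ C, DecayBound M C f := by
  obtain ⟨C, hC⟩ := h (2 * M)
  have hC0 : 0 ≤ C := by
    have := (norm_nonneg _).trans (hC 0)
    exact nonneg_of_mul_nonneg_left this (by positivity)
  refine ⟨C, fun x => (hC _).trans ?_⟩
  rw [decay, ← norm_sq_toLp, abs_of_nonneg (sq_nonneg _), pow_mul]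
  have : 0 ≤ ‖WithLp.toLp 2 x‖ := norm_nonneg _
  gcongr
  nlinarith

theorem rapidDecay_of_decayBound {f : EuclideanSpace ℝ κ → ℂ} (h : ∀ M, ∃ C, DecayBound M C f) :
    RapidDecay f := by
  intro M
  obtain ⟨C, hC⟩ := h M
  have hC0 := hC.nonneg
  refine ⟨C * 2 ^ M, fun x => ?_⟩
  have h1 := hC (WithLp.ofLp x)
  rw [← norm_sq_toLp, WithLp.toLp_ofLp, decay, abs_of_nonneg (sq_nonneg _)] at h1
  refine h1.trans ?_
  rw [mul_assoc]
  gcongr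
  have : 0 ≤ ‖x‖ := norm_nonneg _
  rw [← inv_inv ((2 : ℝ) ^ M), ← mul_inv, ← inv_pow 2 M, ← mul_pow]
  gcongr
  nlinarith [sq_nonneg (‖x‖ - 1)]

theorem integrable_decay_nsq {N : ℕ} (hN : Fintype.card κ < N) :
    Integrable fun v : κ → ℝ => decay N (nsq v) := by
  refine ⟨((continuous_decay N).comp continuous_nsq).aestronglyMeasurable, ?_⟩
  rw [hasFiniteIntegral_iff_ofReal (Filter.Eventually.of_forall fun v => (decay_pos _ _).le)]
  exact lintegral_decay_lt_top hN

/-- A quantity below two bounds is below their geometric mean: separate decay of order 2N in x and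
in y becomes joint decay of order N. -/
theorem norm_le_decay_mul_decay {z : ℂ} {C D x y : ℝ} {N : ℕ} (hC : 0 ≤ C) (hD : 0 ≤ D)
    (h1 : ‖z‖ ≤ C * decay (2 * N) x) (h2 : ‖z‖ ≤ D * decay (2 * N) y) :
    ‖z‖ ≤ (C + D) * (decay N x * decay N y) := by
  have e : ∀ x, decay (2 * N) x = decay N x ^ 2 := fun x => by rw [two_mul, decay_add, sq]
  rw [e] at h1 h2
  have dx := decay_pos N x
  have dy := decay_pos N y
  refine (sq_le_sq₀ (norm_nonneg _) (by positivity)).1 ?_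
  have h3 : ‖z‖ * ‖z‖ ≤ (C * decay N x ^ 2) * (D * decay N y ^ 2) :=
    mul_le_mul h1 h2 (norm_nonneg _) (by positivity)
  have h4 : C * D ≤ (C + D) ^ 2 := by nlinarith [mul_nonneg hC hD]
  calc ‖z‖ ^ 2 ≤ C * D * (decay N x * decay N y) ^ 2 := by rw [sq]; nlinarith
    _ ≤ (C + D) ^ 2 * (decay N x * decay N y) ^ 2 := by gcongr
    _ = _ := by ring

/-- Integrals over some of the coordinates inherit the decay in the others. -/
theorem DecayBound.norm_integral_le {M N : ℕ} {C : ℝ} {f : EuclideanSpace ℝ κ → ℂ}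
    (hf : DecayBound (M + N) C f) (hN : Fintype.card κ₂ < N) (ε : κ₁ ⊕ κ₂ ≃ κ) (u : κ₁ → ℝ)
    {c : (κ₂ → ℝ) → ℂ} (hc : ∀ w, ‖c w‖ ≤ 1) :
    ‖∫ w, c w * f (WithLp.toLp 2 (join ε (u, w)))‖ ≤
      C * (∫ w : κ₂ → ℝ, decay N (nsq w)) * decay M (nsq u) := by
  have h1 : ∀ w, ‖c w * f (WithLp.toLp 2 (join ε (u, w)))‖ ≤
      C * decay M (nsq u) * decay N (nsq w) := by
    intro w
    rw [norm_mul]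
    have h2 := hf (join ε (u, w))
    rw [nsq_join, decay_add] at h2
    have q1 := nsq_nonneg u
    have q2 := nsq_nonneg w
    have h3 : decay M (nsq u + nsq w) * decay N (nsq u + nsq w) ≤
        decay M (nsq u) * decay N (nsq w) :=
      mul_le_mul (decay_le_decay _ q1 (by linarith)) (decay_le_decay _ q2 (by linarith))
        (decay_pos _ _).le (decay_pos _ _).le
    have h4 := mul_le_mul_of_nonneg_left h3 hf.nonneg
    calc _ ≤ 1 * ‖f (WithLp.toLp 2 (join ε (u, w)))‖ := by gcongr; exact hc w
      _ ≤ _ := by rw [one_mul, mul_assoc]; exact h2.trans h4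
  refine (norm_integral_le_of_norm_le ((integrable_decay_nsq hN).const_mul _)
    (Filter.Eventually.of_forall h1)).trans (le_of_eq ?_)
  rw [integral_const_mul]; ring

end Coordinates

theorem integral_comp_of_measurePreserving {X Y : Type*} [MeasurableSpace X] [MeasurableSpace Y]
    {μ : Measure X} {ν : Measure Y} {g : X → Y} (hg : MeasurePreserving g μ ν) {F : Y → ℂ}
    (hF : AEStronglyMeasurable F ν) : ∫ x, F (g x) ∂μ = ∫ y, F y ∂ν := by
  rw [← hg.map_eq] at hF ⊢
  rw [integral_map hg.measurable.aemeasurable hF]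

/-! ### The block Fourier transform of a function of a matrix -/

section Blocks

variable {α β γ : Type} [Fintype α] [Fintype β] [Fintype γ] [DecidableEq α] [DecidableEq β]
  [DecidableEq γ]

/-- The partition of the columns of a matrix into two blocks. -/
def colE (e : α ⊕ β ≃ γ) : (γ × α) ⊕ (γ × β) ≃ γ × γ :=
  (Equiv.prodSumDistrib γ α β).symm.trans ((Equiv.refl γ).prodCongr e)

@[simp] theorem join_colE_inl (e : α ⊕ β ≃ γ) (U : γ × α → ℝ) (W : γ × β → ℝ) (l : γ) (j : α) :
    join (colE e) (U, W) (l, e (Sum.inl j)) = U (l, j) := join_inl (colE e) (U, W) (l, j)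

@[simp] theorem join_colE_inr (e : α ⊕ β ≃ γ) (U : γ × α → ℝ) (W : γ × β → ℝ) (l : γ) (j : β) :
    join (colE e) (U, W) (l, e (Sum.inr j)) = W (l, j) := join_inr (colE e) (U, W) (l, j)

/-- A matrix completed by zeros below. -/
def padTop {δ : Type} (e : α ⊕ β ≃ γ) (a : α × δ → ℝ) : γ × δ → ℝ :=
  fun p => Sum.elim (fun i => a (i, p.2)) (fun _ => 0) (e.symm p.1)

/-- A matrix completed by zeros above. -/
def padBot {δ : Type} (e : α ⊕ β ≃ γ) (a : β × δ → ℝ) : γ × δ → ℝ :=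
  fun p => Sum.elim (fun _ => 0) (fun i => a (i, p.2)) (e.symm p.1)

variable {δ : Type} [Fintype δ] [DecidableEq δ]

@[simp] theorem padTop_inl (e : α ⊕ β ≃ γ) (a : α × δ → ℝ) (i : α) (j : δ) :
    padTop e a (e (Sum.inl i), j) = a (i, j) := by simp [padTop]

@[simp] theorem padTop_inr (e : α ⊕ β ≃ γ) (a : α × δ → ℝ) (i : β) (j : δ) :
    padTop e a (e (Sum.inr i), j) = 0 := by simp [padTop]

@[simp] theorem padBot_inl (e : α ⊕ β ≃ γ) (a : β × δ → ℝ) (i : α) (j : δ) :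
    padBot e a (e (Sum.inl i), j) = 0 := by simp [padBot]

@[simp] theorem padBot_inr (e : α ⊕ β ≃ γ) (a : β × δ → ℝ) (i : β) (j : δ) :
    padBot e a (e (Sum.inr i), j) = a (i, j) := by simp [padBot]

theorem continuous_padTop (e : α ⊕ β ≃ γ) :
    Continuous (padTop e : (α × δ → ℝ) → (γ × δ → ℝ)) := by
  refine continuous_pi fun ⟨l, j⟩ => ?_
  obtain ⟨i | i, rfl⟩ := e.surjective l
  · simp only [padTop_inl]; fun_prop
  · simp only [padTop_inr]; fun_prop

theorem continuous_padBot (e : α ⊕ β ≃ γ) :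
    Continuous (padBot e : (β × δ → ℝ) → (γ × δ → ℝ)) := by
  refine continuous_pi fun ⟨l, j⟩ => ?_
  obtain ⟨i | i, rfl⟩ := e.surjective l
  · simp only [padBot_inl]; fun_prop
  · simp only [padBot_inr]; fun_prop

theorem nsq_padTop (e : α ⊕ β ≃ γ) (a : α × δ → ℝ) : nsq (padTop e a) = nsq a := by
  unfold nsq
  rw [Fintype.sum_prod_type, ← e.sum_comp, Fintype.sum_sum_type, Fintype.sum_prod_type]
  simp

theorem nsq_padBot (e : α ⊕ β ≃ γ) (a : β × δ → ℝ) : nsq (padBot e a) = nsq a := by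
  unfold nsq
  rw [Fintype.sum_prod_type, ← e.sum_comp, Fintype.sum_sum_type, Fintype.sum_prod_type]
  simp

/-- The block diagonal matrix. -/
def blockDiag (e : α ⊕ β ≃ γ) (h : Matrix α α ℝ) (k : Matrix β β ℝ) : Matrix γ γ ℝ :=
  Matrix.reindex e e (Matrix.fromBlocks h 0 0 k)

theorem blockDiag_mem (e : α ⊕ β ≃ γ) {h : Matrix α α ℝ} {k : Matrix β β ℝ}
    (hh : h ∈ Matrix.orthogonalGroup α ℝ) (hk : k ∈ Matrix.orthogonalGroup β ℝ) :
    blockDiag e h k ∈ Matrix.orthogonalGroup γ ℝ := by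
  rw [Matrix.mem_orthogonalGroup_iff] at hh hk ⊢
  simp only [blockDiag, Matrix.reindex_apply, Matrix.transpose_submatrix, Matrix.submatrix_mul_equiv,
    Matrix.fromBlocks_transpose, Matrix.fromBlocks_multiply]
  simp [hh, hk]

theorem lmul_apply {m n : Type} [Fintype m] (H : Matrix m m ℝ) (X : m × n → ℝ)
    (l : m) (j : n) : lmul H X (l, j) = ∑ i, H l i * X (i, j) := by
  simp [lmul, unmat, mat, Matrix.mul_apply]

theorem lmul_blockDiag_padTop (e : α ⊕ β ≃ γ) (h : Matrix α α ℝ) (k : Matrix β β ℝ)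
    (a : α × δ → ℝ) : lmul (blockDiag e h k) (padTop e a) = padTop e (lmul h a) := by
  funext ⟨l, j⟩
  obtain ⟨i | i, rfl⟩ := e.surjective l <;>
    rw [lmul_apply, ← e.sum_comp, Fintype.sum_sum_type] <;>
    simp [blockDiag, lmul_apply]

theorem lmul_blockDiag_padBot (e : α ⊕ β ≃ γ) (h : Matrix α α ℝ) (k : Matrix β β ℝ)
    (a : β × δ → ℝ) : lmul (blockDiag e h k) (padBot e a) = padBot e (lmul k a) := by
  funext ⟨l, j⟩
  obtain ⟨i | i, rfl⟩ := e.surjective l <;>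
    rw [lmul_apply, ← e.sum_comp, Fintype.sum_sum_type] <;>
    simp [blockDiag, lmul_apply]

theorem lmul_join_colE (e : α ⊕ β ≃ γ) (H : Matrix γ γ ℝ) (U : γ × α → ℝ) (W : γ × β → ℝ) :
    lmul H (join (colE e) (U, W)) = join (colE e) (lmul H U, lmul H W) := by
  funext ⟨l, j⟩
  obtain ⟨i | i, rfl⟩ := e.surjective j <;> simp [lmul_apply]

theorem dotProduct_lmul {m n : Type} [Fintype m] [Fintype n] [DecidableEq m] {h : Matrix m m ℝ}
    (hh : h ∈ Matrix.orthogonalGroup m ℝ) (X Y : m × n → ℝ) : lmul h X ⬝ᵥ lmul h Y = X ⬝ᵥ Y := by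
  have key : ∀ X Y : m × n → ℝ, X ⬝ᵥ Y = ((mat X).transpose * mat Y).trace := by
    intro X Y
    simp only [dotProduct, Matrix.trace, Matrix.diag, Matrix.mul_apply, mat,
      Fintype.sum_prod_type, Matrix.transpose_apply, Matrix.of_apply]
    rw [Finset.sum_comm]
  have hh' := (Matrix.mem_orthogonalGroup_iff' _ _).1 hh
  rw [key, key, lmul, mat_unmat, lmul, mat_unmat, Matrix.transpose_mul, Matrix.mul_assoc,
    ← Matrix.mul_assoc _ h, show h.transpose * h = 1 from hh', Matrix.one_mul]

theorem measurePreserving_lmul {m n : Type} [Fintype m] [Fintype n] [DecidableEq m] [DecidableEq n]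
    {h : Matrix m m ℝ} (hh : h ∈ Matrix.orthogonalGroup m ℝ) :
    MeasurePreserving (lmul h : (m × n → ℝ) → (m × n → ℝ)) := by
  have hm : Measurable (lmul h : (m × n → ℝ) → (m × n → ℝ)) := (continuous_lmul h).measurable
  refine ⟨hm, Measure.ext fun s hs => ?_⟩
  have hd : h.det ≠ 0 := by
    intro h0
    have := abs_det_of_mem_orthogonal hh
    rw [h0] at this; simp at this
  have h1 := lintegral_lmul (n := n) hd (F := s.indicator 1) (measurable_one.indicator hs)
  rw [abs_det_of_mem_orthogonal hh, one_pow, ENNReal.ofReal_one, one_mul,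
    lintegral_indicator_one hs] at h1
  rw [Measure.map_apply hm hs, ← h1, ← lintegral_indicator_one (hm hs)]
  rfl

theorem integrable_mul_comp {κ ι : Type} [Fintype κ] [Fintype ι] {f : EuclideanSpace ℝ κ → ℂ}
    (hf : Continuous f) (hd : RapidDecay f) {g : (ι → ℝ) → (κ → ℝ)} (hg : Continuous g)
    (hn : ∀ x, nsq x ≤ nsq (g x)) {c : (ι → ℝ) → ℂ} (hc : Continuous c) (hc1 : ∀ x, ‖c x‖ ≤ 1) :
    Integrable fun x => c x * f (WithLp.toLp 2 (g x)) := by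
  obtain ⟨C, hC⟩ := hd.exists_decayBound (Fintype.card ι + 1)
  refine ((integrable_decay_nsq (N := Fintype.card ι + 1) (Nat.lt_succ_self _)).const_mul C).mono'
    (Continuous.aestronglyMeasurable (by fun_prop)) (Filter.Eventually.of_forall fun x => ?_)
  rw [norm_mul]
  calc _ ≤ 1 * ‖f (WithLp.toLp 2 (g x))‖ := by gcongr; exact hc1 x
    _ ≤ C * decay (Fintype.card ι + 1) (nsq (g x)) := by rw [one_mul]; exact hC _
    _ ≤ _ := mul_le_mul_of_nonneg_left (decay_le_decay _ (nsq_nonneg _) (hn x)) hC.nonneg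

theorem integral_join {κ₁ κ₂ ι : Type} [Fintype κ₁] [Fintype κ₂] [Fintype ι] (ε : κ₁ ⊕ κ₂ ≃ ι)
    {F : (ι → ℝ) → ℂ} (hF : Integrable F) :
    ∫ x, F x = ∫ x₁, ∫ x₂, F (join ε (x₁, x₂)) := by
  rw [← integral_comp_of_measurePreserving (measurePreserving_join ε) hF.aestronglyMeasurable,
    integral_prod]
  exact ((measurePreserving_join ε).integrable_comp hF.aestronglyMeasurable).2 hF

/-- The partial Fourier transform of `f` in the lower right block, the lower left block being
zero and the upper right block being integrated out. -/
def blockFourier (e : α ⊕ β ≃ γ) (f : EuclideanSpace ℝ (γ × γ) → ℂ) (a : α × α → ℝ)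
    (ξ : β × β → ℝ) : ℂ :=
  ∫ w, chr (-(padBot e ξ ⬝ᵥ w)) * f (WithLp.toLp 2 (join (colE e) (padTop e a, w)))

variable {f : EuclideanSpace ℝ (γ × γ) → ℂ}

/-- In this form ξ is an argument of 𝓕 f and a is a frequency, so decay of 𝓕 f yields decay in ξ,
just as decay of f yields decay in a. -/
theorem blockFourier_eq_dual (hf : IsNice f) (e : α ⊕ β ≃ γ) (a : α × α → ℝ) (ξ : β × β → ℝ) :
    blockFourier e f a ξ =
      ∫ v, chr (v ⬝ᵥ padTop e a) * 𝓕 f (WithLp.toLp 2 (join (colE e) (v, padBot e ξ))) :=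
  integral_chr_mul_join hf (colE e) _ _

theorem join_swap {κ₁ κ₂ ι : Type} [Fintype κ₁] [Fintype κ₂] [Fintype ι] (ε : κ₁ ⊕ κ₂ ≃ ι)
    (u : κ₁ → ℝ) (v : κ₂ → ℝ) : join ε (u, v) = join ((Equiv.sumComm κ₂ κ₁).trans ε) (v, u) := by
  funext i
  obtain ⟨j | j, rfl⟩ := ε.surjective i <;> simp [join_apply]

/-- Decay in a is read off the definition, decay in ξ off the dual form. M and K are chosen before f
and the bound is linear in C; this uniformity is what finally makes the distributions continuous. -/
theorem exists_norm_blockFourier_le (e : α ⊕ β ≃ γ) (N : ℕ) :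
    ∃ M : ℕ, ∃ K : ℝ, 0 ≤ K ∧ ∀ (f : EuclideanSpace ℝ (γ × γ) → ℂ) (C : ℝ), IsNice f →
      DecayBound M C f → DecayBound M C (𝓕 f) → ∀ a ξ,
      ‖blockFourier e f a ξ‖ ≤ K * C * (decay N (nsq a) * decay N (nsq ξ)) := by
  set L := Fintype.card (γ × α) + Fintype.card (γ × β) + 1 with hL
  have i1 : 0 ≤ ∫ w : γ × β → ℝ, decay L (nsq w) := integral_nonneg fun _ => (decay_pos _ _).le
  have i2 : 0 ≤ ∫ w : γ × α → ℝ, decay L (nsq w) := integral_nonneg fun _ => (decay_pos _ _).le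
  refine ⟨2 * N + L, (∫ w : γ × β → ℝ, decay L (nsq w)) + ∫ w : γ × α → ℝ, decay L (nsq w),
    by positivity, fun f C hf h1 h2 a ξ => ?_⟩
  have hC := h1.nonneg
  have b1 := h1.norm_integral_le (by omega) (colE e) (padTop e a)
    (c := fun w => chr (-(padBot e ξ ⬝ᵥ w))) fun w => (norm_chr _).le
  have b2 := h2.norm_integral_le (by omega) ((Equiv.sumComm (γ × β) (γ × α)).trans (colE e))
    (padBot e ξ) (c := fun v => chr (v ⬝ᵥ padTop e a)) fun w => (norm_chr _).le
  simp only [← join_swap] at b2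
  rw [← blockFourier_eq_dual hf, nsq_padBot] at b2
  rw [nsq_padTop] at b1
  have := norm_le_decay_mul_decay (by positivity) (by positivity) b1 b2
  refine this.trans (le_of_eq ?_)
  ring

theorem continuous_blockFourier (hf : IsNice f) (e : α ⊕ β ≃ γ) :
    Continuous fun p : (α × α → ℝ) × (β × β → ℝ) => blockFourier e f p.1 p.2 := by
  obtain ⟨C, hC⟩ := hf.rapidDecay.exists_decayBound (Fintype.card (γ × β) + 1)
  have h1 := continuous_padTop (δ := α) e
  have h2 := continuous_padBot (δ := β) e
  have h3 := hf.continuous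
  refine continuous_of_dominated
    (bound := fun w => C * decay (Fintype.card (γ × β) + 1) (nsq w)) (fun p => ?_)
    (fun p => Filter.Eventually.of_forall fun w => ?_)
    ((integrable_decay_nsq (Nat.lt_succ_self _)).const_mul C)
    (Filter.Eventually.of_forall fun w => ?_)
  · exact Continuous.aestronglyMeasurable (by fun_prop)
  · rw [norm_mul, norm_chr, one_mul]
    refine (hC _).trans (mul_le_mul_of_nonneg_left (decay_le_decay _ (nsq_nonneg _) ?_) hC.nonneg)
    rw [nsq_join]
    linarith [nsq_nonneg (padTop e p.1)]
  · fun_prop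

/-- The block diagonal matrix of h and k acts on the argument of f; the substitution in w by the
same matrix preserves both the measure and the phase. -/
theorem blockFourier_lmul (hf : IsNice f)
    (hi : IsLeftInvariant fun X : γ × γ → ℝ => f (WithLp.toLp 2 X)) (e : α ⊕ β ≃ γ)
    {h : Matrix α α ℝ} (hh : h ∈ Matrix.orthogonalGroup α ℝ) {k : Matrix β β ℝ}
    (hk : k ∈ Matrix.orthogonalGroup β ℝ) (a : α × α → ℝ) (ξ : β × β → ℝ) :
    blockFourier e f (lmul h a) (lmul k ξ) = blockFourier e f a ξ := by
  have hH := blockDiag_mem e hh hk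
  have h3 := hf.continuous
  unfold blockFourier
  rw [← integral_comp_of_measurePreserving (measurePreserving_lmul hH)
    (Continuous.aestronglyMeasurable (by fun_prop))]
  refine integral_congr_ae (Filter.Eventually.of_forall fun w => ?_)
  dsimp only
  rw [← lmul_blockDiag_padBot e h k, dotProduct_lmul hH, ← lmul_blockDiag_padTop e h k,
    ← lmul_join_colE]
  congr 1
  exact hi _ hH _

end Blocks

section Value

variable {α β γ : Type} [Fintype α] [Fintype β] [Fintype γ] [DecidableEq α] [DecidableEq β]
  [DecidableEq γ]

/-- The partition of the entries of a matrix into the upper right block and the others. -/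
def upperRightE (e : α ⊕ β ≃ γ) : ((γ × α) ⊕ (β × β)) ⊕ (α × β) ≃ γ × γ where
  toFun := Sum.elim (Sum.elim (fun p => (p.1, e (Sum.inl p.2)))
    fun p => (e (Sum.inr p.1), e (Sum.inr p.2))) fun p => (e (Sum.inl p.1), e (Sum.inr p.2))
  invFun := fun q => Sum.elim (fun j => Sum.inl (Sum.inl (q.1, j)))
    (fun j => Sum.elim (fun i => Sum.inr (i, j)) (fun i => Sum.inl (Sum.inr (i, j))) (e.symm q.1))
    (e.symm q.2)
  left_inv := by rintro ((⟨l, j⟩ | ⟨i, j⟩) | ⟨i, j⟩) <;> simp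
  right_inv := by
    rintro ⟨l, m⟩
    obtain ⟨j | j, rfl⟩ := e.surjective m
    · simp
    · obtain ⟨i | i, rfl⟩ := e.surjective l <;> simp

theorem join_upperRightE (e : α ⊕ β ≃ γ) (V : γ × α → ℝ) (ξ : β × β → ℝ) (b : α × β → ℝ) :
    join (upperRightE e) (join (Equiv.refl _) (V, ξ), b) =
      join (colE e) (V, fun p => Sum.elim (fun i => b (i, p.2)) (fun i => ξ (i, p.2)) (e.symm p.1)) := by
  funext ⟨l, m⟩
  obtain ⟨j | j, rfl⟩ := e.surjective m
  · rw [join_colE_inl]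
    exact (join_inl (upperRightE e) _ (Sum.inl (l, j))).trans (join_inl (Equiv.refl _) _ (l, j))
  · rw [join_colE_inr]
    obtain ⟨i | i, rfl⟩ := e.surjective l
    · simp only [Equiv.symm_apply_apply, Sum.elim_inl]
      exact join_inr (upperRightE e) _ (i, j)
    · simp only [Equiv.symm_apply_apply, Sum.elim_inr]
      exact (join_inl (upperRightE e) _ (Sum.inr (i, j))).trans
        (join_inr (Equiv.refl _) _ (i, j))

theorem nsq_le_nsq_join_left {κ₁ κ₂ ι : Type} [Fintype κ₁] [Fintype κ₂] [Fintype ι]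
    (ε : κ₁ ⊕ κ₂ ≃ ι) (v : κ₁ → ℝ) (η : κ₂ → ℝ) : nsq v ≤ nsq (join ε (v, η)) := by
  rw [nsq_join]; linarith [nsq_nonneg η]

theorem nsq_le_nsq_join_right {κ₁ κ₂ ι : Type} [Fintype κ₁] [Fintype κ₂] [Fintype ι]
    (ε : κ₁ ⊕ κ₂ ≃ ι) (v : κ₁ → ℝ) (η : κ₂ → ℝ) : nsq η ≤ nsq (join ε (v, η)) := by
  rw [nsq_join]; linarith [nsq_nonneg v]

variable {f : EuclideanSpace ℝ (γ × γ) → ℂ}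

/-- The matrix entries of `v ↦ 𝓕 f (v, η)`, integrated against a character, in two steps. -/
theorem integral_chr_mul_fourier_join {κ κ₁ κ₂ κ₃ κ₄ : Type} [Fintype κ] [Fintype κ₁] [Fintype κ₂]
    [Fintype κ₃] [Fintype κ₄] {f : EuclideanSpace ℝ κ → ℂ} (hf : IsNice f)
    (ε : κ₁ ⊕ κ₂ ≃ κ) (ε' : κ₃ ⊕ κ₄ ≃ κ₁) (u : κ₁ → ℝ) (η : κ₂ → ℝ) :
    ∫ v, chr (v ⬝ᵥ u) * 𝓕 f (WithLp.toLp 2 (join ε (v, η))) =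
      ∫ y, ∫ v, chr (join ε' (v, y) ⬝ᵥ u) * 𝓕 f (WithLp.toLp 2 (join ε (join ε' (v, y), η))) := by
  have hi : Integrable fun v => chr (v ⬝ᵥ u) * 𝓕 f (WithLp.toLp 2 (join ε (v, η))) :=
    integrable_mul_comp hf.continuous_fourier hf.rapidDecay_fourier (by fun_prop)
      (fun v => nsq_le_nsq_join_left ε v η) (by fun_prop) fun v => (norm_chr _).le
  rw [integral_join ((Equiv.sumComm κ₄ κ₃).trans ε') hi]
  simp only [← join_swap]

/-- Integrating out the frequency sets the lower right block to zero. -/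
theorem integral_blockFourier (hf : IsNice f) (e : α ⊕ β ≃ γ) (a : α × α → ℝ) :
    ∫ ξ, blockFourier e f a ξ =
      ∫ b : α × β → ℝ, f (WithLp.toLp 2 (join (colE e) (padTop e a, padTop e b))) := by
  -- Partial inversion with the left columns and the lower right block held fixed, the latter at
  -- zero; the upper right block is integrated at frequency zero.
  have h := integral_chr_mul_join hf (upperRightE e)
    (join (Equiv.refl _) (padTop e a, (0 : β × β → ℝ))) 0
  rw [integral_chr_mul_fourier_join hf (upperRightE e) (Equiv.refl _)] at h
  simp only [dotProduct_join, zero_dotProduct, neg_zero, chr_zero, one_mul, dotProduct_zero,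
    add_zero, join_upperRightE] at h
  simp only [blockFourier_eq_dual hf]
  exact h.symm

end Value

/-! ### Moving one index from the second block to the first -/

section Transition

variable {α β γ : Type} [Fintype α] [Fintype β] [Fintype γ] [DecidableEq α] [DecidableEq β]
  [DecidableEq γ]

/-- Moving one index from the second block to the first. -/
def shiftEquiv (e : α ⊕ (β ⊕ Unit) ≃ γ) : (α ⊕ Unit) ⊕ β ≃ γ :=
  ((Equiv.sumAssoc α Unit β).trans ((Equiv.refl α).sumCongr (Equiv.sumComm Unit β))).trans e

theorem shiftEquiv_inl_inl (e : α ⊕ (β ⊕ Unit) ≃ γ) (i : α) :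
    shiftEquiv e (Sum.inl (Sum.inl i)) = e (Sum.inl i) := rfl

theorem shiftEquiv_inl_inr (e : α ⊕ (β ⊕ Unit) ≃ γ) (i : Unit) :
    shiftEquiv e (Sum.inl (Sum.inr i)) = e (Sum.inr (Sum.inr i)) := rfl

theorem shiftEquiv_inr (e : α ⊕ (β ⊕ Unit) ≃ γ) (i : β) :
    shiftEquiv e (Sum.inr i) = e (Sum.inr (Sum.inl i)) := rfl

/-- The partition of the entries of a matrix for moving one index from the second block to the
first. -/
def middleE (e : α ⊕ (β ⊕ Unit) ≃ γ) : ((γ × α) ⊕ (β ⊕ Unit)) ⊕ ((γ × β) ⊕ α) ≃ γ × γ where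
  toFun := Sum.elim (Sum.elim (fun p => (p.1, e (Sum.inl p.2)))
      fun i => (e (Sum.inr i), e (Sum.inr (Sum.inr ()))))
    (Sum.elim (fun p => (p.1, e (Sum.inr (Sum.inl p.2))))
      fun i => (e (Sum.inl i), e (Sum.inr (Sum.inr ()))))
  invFun := fun q => Sum.elim (fun j => Sum.inl (Sum.inl (q.1, j)))
    (Sum.elim (fun j => Sum.inr (Sum.inl (q.1, j))) fun _ =>
      Sum.elim (fun i => Sum.inr (Sum.inr i)) (fun i => Sum.inl (Sum.inr i)) (e.symm q.1))
    (e.symm q.2)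
  left_inv := by rintro ((⟨l, j⟩ | i) | (⟨l, j⟩ | i)) <;> simp
  right_inv := by
    rintro ⟨l, m⟩
    obtain ⟨j | (j | j), rfl⟩ := e.surjective m
    · simp
    · simp
    · obtain ⟨i | i, rfl⟩ := e.surjective l <;> simp

section Entries

variable (e : α ⊕ (β ⊕ Unit) ≃ γ) (V : γ × α → ℝ) (y : β ⊕ Unit → ℝ) (W : γ × β → ℝ) (v : α → ℝ)

theorem middleE_first (l : γ) (j : α) :
    join (middleE e) (join (Equiv.refl _) (V, y), join (Equiv.refl _) (W, v)) (l, e (Sum.inl j)) =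
      V (l, j) :=
  (join_inl (middleE e) _ (Sum.inl (l, j))).trans (join_inl (Equiv.refl _) _ (l, j))

theorem middleE_second (l : γ) (j : β) :
    join (middleE e) (join (Equiv.refl _) (V, y), join (Equiv.refl _) (W, v))
      (l, e (Sum.inr (Sum.inl j))) = W (l, j) :=
  (join_inr (middleE e) _ (Sum.inl (l, j))).trans (join_inl (Equiv.refl _) _ (l, j))

theorem middleE_third_inl (i : α) :
    join (middleE e) (join (Equiv.refl _) (V, y), join (Equiv.refl _) (W, v))
      (e (Sum.inl i), e (Sum.inr (Sum.inr ()))) = v i :=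
  (join_inr (middleE e) _ (Sum.inr i)).trans (join_inr (Equiv.refl _) _ i)

theorem middleE_third_inr (i : β ⊕ Unit) :
    join (middleE e) (join (Equiv.refl _) (V, y), join (Equiv.refl _) (W, v))
      (e (Sum.inr i), e (Sum.inr (Sum.inr ()))) = y i :=
  (join_inl (middleE e) _ (Sum.inr i)).trans (join_inr (Equiv.refl _) _ i)

/-- On the position side the last column, with top v and bottom (0, t), enlarges a to a triangular
matrix. On the frequency side, in `join_middleE_padBot`, the bottom of the same column enlarges ξ.
-/
theorem join_middleE_tri (a : α × α → ℝ) (t : ℝ) :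
    join (middleE e) (join (Equiv.refl _) (padTop e a, snoc (0, t)), join (Equiv.refl _) (W, v)) =
      join (colE (shiftEquiv e)) (padTop (shiftEquiv e) (tri (a, (v, t))), W) := by
  funext ⟨l, m⟩
  obtain ⟨(j | j) | j, rfl⟩ := (shiftEquiv e).surjective m
  · rw [join_colE_inl, shiftEquiv_inl_inl, middleE_first]
    obtain ⟨(i | i) | i, rfl⟩ := (shiftEquiv e).surjective l
    · rw [padTop_inl, tri_inl_inl, shiftEquiv_inl_inl, padTop_inl]
    · rw [padTop_inl, tri_inr_inl, shiftEquiv_inl_inr, padTop_inr]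
    · rw [padTop_inr, shiftEquiv_inr, padTop_inr]
  · rw [join_colE_inl, shiftEquiv_inl_inr]
    obtain ⟨(i | i) | i, rfl⟩ := (shiftEquiv e).surjective l
    · rw [padTop_inl, tri_inl_inr, shiftEquiv_inl_inl, middleE_third_inl]
    · rw [padTop_inl, tri_inr_inr, shiftEquiv_inl_inr, middleE_third_inr]; rfl
    · rw [padTop_inr, shiftEquiv_inr, middleE_third_inr]; rfl
  · rw [join_colE_inr, shiftEquiv_inr, middleE_second]

theorem join_middleE_padBot (ξ : β × β → ℝ) (p : (β → ℝ) × ℝ) :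
    join (middleE e) (join (Equiv.refl _) (V, snoc p),
      join (Equiv.refl _) (padBot (shiftEquiv e) ξ, 0)) =
      join (colE e) (V, padBot e (tri (ξ, p))) := by
  funext ⟨l, m⟩
  obtain ⟨j | (j | j), rfl⟩ := e.surjective m
  · rw [join_colE_inl, middleE_first]
  · rw [join_colE_inr, middleE_second]
    obtain ⟨i | (i | i), rfl⟩ := e.surjective l
    · rw [← shiftEquiv_inl_inl, padBot_inl, shiftEquiv_inl_inl, padBot_inl]
    · rw [← shiftEquiv_inr, padBot_inr, shiftEquiv_inr, padBot_inr, tri_inl_inl]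
    · rw [← shiftEquiv_inl_inr, padBot_inl, shiftEquiv_inl_inr, padBot_inr, tri_inr_inl]
  · rw [join_colE_inr]
    obtain ⟨i | (i | i), rfl⟩ := e.surjective l
    · rw [padBot_inl]; exact middleE_third_inl e _ _ _ _ i
    · rw [padBot_inr, tri_inl_inr]; exact middleE_third_inr e _ _ _ _ (Sum.inl i)
    · rw [padBot_inr, tri_inr_inr]; exact middleE_third_inr e _ _ _ _ (Sum.inr i)

end Entries

variable {f : EuclideanSpace ℝ (γ × γ) → ℂ}

/-- The one-dimensional Fourier transform relating the block Fourier transforms before and after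
moving one index. -/
theorem integral_blockFourier_tri (hf : IsNice f) (e : α ⊕ (β ⊕ Unit) ≃ γ) (a : α × α → ℝ)
    (ξ : β × β → ℝ) (t : ℝ) :
    ∫ v : α → ℝ, blockFourier (shiftEquiv e) f (tri (a, (v, t))) ξ =
      ∫ p : (β → ℝ) × ℝ, chr (p.2 * t) * blockFourier e f a (tri (ξ, p)) := by
  -- Held fixed are the left columns and the bottom (0, t) of the last column. Integrated are the
  -- middle columns, at frequency ξ in their lower rows, and the top of the last column, at
  -- frequency 0.
  have h := integral_chr_mul_join hf (middleE e)
    (join (Equiv.refl _) (padTop e a, snoc ((0 : β → ℝ), t)))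
    (join (Equiv.refl _) (padBot (shiftEquiv e) ξ, (0 : α → ℝ)))
  rw [integral_chr_mul_fourier_join hf (middleE e) (Equiv.refl _),
    integral_join ((Equiv.sumComm α (γ × β)).trans (Equiv.refl _))] at h
  · simp only [← join_swap, dotProduct_join, zero_dotProduct, add_zero, join_middleE_tri] at h
    refine h.trans ?_
    rw [← integral_comp_of_measurePreserving measurePreserving_snoc]
    · refine integral_congr_ae (Filter.Eventually.of_forall fun p => ?_)
      dsimp only
      rw [blockFourier_eq_dual hf, ← integral_const_mul]
      refine integral_congr_ae (Filter.Eventually.of_forall fun V => ?_)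
      have hs : snoc p ⬝ᵥ snoc ((0 : β → ℝ), t) = p.2 * t := by
        simp [dotProduct, snoc]
      dsimp only
      rw [join_middleE_padBot, hs, add_comm, chr_add, mul_assoc]
    · have hF := hf.continuous_fourier
      have hm : StronglyMeasurable fun q : (β ⊕ Unit → ℝ) × (γ × α → ℝ) =>
          chr (q.2 ⬝ᵥ padTop e a + q.1 ⬝ᵥ snoc ((0 : β → ℝ), t)) *
            𝓕 f (WithLp.toLp 2 (join (middleE e) (join (Equiv.refl _) (q.2, q.1),
              join (Equiv.refl _) (padBot (shiftEquiv e) ξ, 0)))) :=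
        Continuous.stronglyMeasurable (by fun_prop)
      exact (hm.integral_prod_right').aestronglyMeasurable
  · refine integrable_mul_comp hf.continuous hf.rapidDecay (by fun_prop)
      (fun v => nsq_le_nsq_join_right (middleE e) _ v) (by fun_prop) fun v => (norm_chr _).le

end Transition

/-! ### The functional equation of determinant integrals -/

/-- The complex power `|x|^z`. -/
def apow (x : ℝ) (z : ℂ) : ℂ := ((|x| : ℝ) : ℂ) ^ z

theorem measurable_apow (z : ℂ) : Measurable fun x => apow x z :=
  (Complex.measurable_ofReal.comp continuous_abs.measurable).pow_const z

theorem apow_mul (x y : ℝ) (z : ℂ) : apow (x * y) z = apow x z * apow y z := by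
  unfold apow
  rw [abs_mul, Complex.ofReal_mul, Complex.mul_cpow_ofReal_nonneg (abs_nonneg _) (abs_nonneg _)]

theorem norm_apow {x : ℝ} (hx : x ≠ 0) (z : ℂ) : ‖apow x z‖ = |x| ^ z.re :=
  Complex.norm_cpow_eq_rpow_re_of_pos (abs_pos.2 hx) z

theorem norm_apow_le (x : ℝ) (z : ℂ) : ‖apow x z‖ ≤ |x| ^ z.re := by
  by_cases hx : x = 0
  · subst hx
    by_cases hz : z = 0
    · simp [apow, hz]
    · simp only [apow, abs_zero, Complex.ofReal_zero, Complex.zero_cpow hz, norm_zero]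
      positivity
  · exact (norm_apow hx z).le

@[simp] theorem apow_zero (x : ℝ) : apow x 0 = 1 := by simp [apow]

theorem apow_ne_zero {x : ℝ} (hx : x ≠ 0) (z : ℂ) : apow x z ≠ 0 := by
  rw [← norm_ne_zero_iff, norm_apow hx]
  have := abs_pos.2 hx
  positivity

theorem abs_mul_apow {x : ℝ} (hx : x ≠ 0) (z : ℂ) : ((|x| : ℝ) : ℂ) * apow x z = apow x (z + 1) := by
  unfold apow
  have : ((|x| : ℝ) : ℂ) ≠ 0 := by exact_mod_cast (abs_pos.2 hx).ne'
  rw [Complex.cpow_add _ _ this, Complex.cpow_one, mul_comm]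

theorem apow_eq_exp {x : ℝ} (hx : x ≠ 0) (z : ℂ) :
    apow x z = Complex.exp (z * (Real.log |x| : ℝ)) := by
  have : ((|x| : ℝ) : ℂ) ≠ 0 := by exact_mod_cast (abs_pos.2 hx).ne'
  rw [apow, Complex.cpow_def_of_ne_zero this, Complex.ofReal_log (abs_nonneg x), mul_comm]

/-- The functional equation for functions given as integrals over additional variables. -/
theorem functional_equation_prod {V W : Type*} [MeasureSpace V] [MeasureSpace W]
    [SFinite (volume : Measure V)] [SFinite (volume : Measure W)] {z : ℂ} (h0 : 0 < z.re)
    (h1 : z.re < 1) {q : W × ℝ → ℂ} {r : V × ℝ → ℂ} (hq : Integrable q)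
    (h2 : Integrable fun p => apow p.2 (-z) * q p) (h3 : Integrable fun p => apow p.2 (z - 1) * r p)
    (hqr : ∀ t, ∫ v, r (v, t) = ∫ p, chr (p.2 * t) * q p) :
    gammaFactor z * ∫ p, apow p.2 (-z) * q p =
      gammaFactor (1 - z) * ∫ p, apow p.2 (z - 1) * r p := by
  set u : ℝ → ℂ := fun x => ∫ w, q (w, x) with hu
  rw [Measure.volume_eq_prod] at hq h2 h3
  have hui : Integrable u := hq.integral_prod_right
  have e1 : ∀ x : ℝ, ∫ w, apow x (-z) * q (w, x) = apow x (-z) * u x := fun x =>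
    integral_const_mul _ _
  -- The character in `hqr` has the opposite sign to 𝓕, hence the argument -t; the evenness of
  -- |t|^{z-1} removes it at the end.
  have e2 : ∀ t : ℝ, ∫ v, apow t (z - 1) * r (v, t) = apow t (z - 1) * 𝓕 u (-t) := by
    intro t
    rw [integral_const_mul, hqr, Measure.volume_eq_prod, integral_prod_symm]
    · congr 1
      rw [Real.fourier_real_eq_integral_exp_smul]
      refine integral_congr_ae (Filter.Eventually.of_forall fun x => ?_)
      dsimp only
      rw [integral_const_mul, smul_eq_mul, chr]
      congr 2
      push_cast
      ring
    · refine hq.bdd_mul (c := 1) ((continuous_chr.comp (continuous_id.mul continuous_const)).measurable.comp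
          measurable_snd).aestronglyMeasurable
        (Filter.Eventually.of_forall fun p => (norm_chr _).le)
  have hne : ∀ᵐ x : ℝ, x ≠ 0 := by simp [ae_iff]
  have i2 := h2.integral_prod_right
  have i3 := h3.integral_prod_right
  simp only [e1] at i2
  simp only [e2] at i3
  have i2' : Integrable fun x => ‖u x‖ * |x| ^ (-z.re) := by
    refine i2.norm.congr ?_
    filter_upwards [hne] with x hx
    rw [norm_mul, norm_apow hx, Complex.neg_re, mul_comm]
  have i3' : Integrable fun x => ‖𝓕 u x‖ * |x| ^ (z.re - 1) := by
    have i4 := i3.comp_neg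
    refine i4.norm.congr ?_
    filter_upwards [hne] with x hx
    rw [norm_mul, norm_apow (neg_ne_zero.2 hx), abs_neg, neg_neg, mul_comm]
    simp
  have h := functional_equation_line h0 h1 hui i2' i3'
  rw [Measure.volume_eq_prod, Measure.volume_eq_prod, integral_prod_symm _ h2,
    integral_prod_symm _ h3]
  simp only [e1, e2]
  have e4 := integral_neg_eq_self (fun t => apow t (z - 1) * 𝓕 u t) volume
  have e5 : ∀ t : ℝ, apow (-t) (z - 1) = apow t (z - 1) := fun t => by simp only [apow, abs_neg]
  simp only [e5] at e4
  rw [e4]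
  exact h

section Param

variable {α : Type} [Fintype α] [DecidableEq α] {A : Type*} [MeasureSpace A]
  [SFinite (volume : Measure A)]

/-- The reduction to triangular matrices with a parameter `a` carried along; Fubini needs joint
integrability on the triangular side. -/
theorem integral_prod_of_isLeftInvariant {G : A × ((α ⊕ Unit) × (α ⊕ Unit) → ℝ) → ℂ}
    (hG : Measurable G) (hGi : ∀ a, IsLeftInvariant fun X => G (a, X)) (hI : Integrable G) :
    Integrable (fun q : A × ((α × α → ℝ) × ((α → ℝ) × ℝ)) =>
      ((|(mat q.2.1).det| : ℝ) : ℂ) * G (q.1, tri q.2)) ∧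
    ∫ q, G q = disConst α * ∫ q : A × ((α × α → ℝ) × ((α → ℝ) × ℝ)),
      ((|(mat q.2.1).det| : ℝ) : ℂ) * G (q.1, tri q.2) := by
  have hm : ∀ a, Measurable fun X => G (a, X) := fun a => hG.comp measurable_prodMk_left
  have hdet : Measurable fun p : (α × α → ℝ) × ((α → ℝ) × ℝ) => ((|(mat p.1).det| : ℝ) : ℂ) :=
    Complex.measurable_ofReal.comp
      ((continuous_mat.matrix_det.measurable.norm).comp measurable_fst)
  have hGm : Measurable (fun q : A × ((α × α → ℝ) × ((α → ℝ) × ℝ)) =>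
      ((|(mat q.2.1).det| : ℝ) : ℂ) * G (q.1, tri q.2)) :=
    (hdet.comp measurable_snd).mul (hG.comp (measurable_fst.prodMk
      (continuous_tri.measurable.comp measurable_snd)))
  have key := fun a => integral_of_isLeftInvariant (hm a) (hGi a)
  have hI2 : Integrable (fun q : A × ((α × α → ℝ) × ((α → ℝ) × ℝ)) =>
      ((|(mat q.2.1).det| : ℝ) : ℂ) * G (q.1, tri q.2)) := by
    rw [Measure.volume_eq_prod, integrable_prod_iff hGm.aestronglyMeasurable]
    rw [Measure.volume_eq_prod, integrable_prod_iff hG.aestronglyMeasurable] at hI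
    refine ⟨hI.1.mono fun a ha => (key a).1.1 ha, ?_⟩
    have h2 := hI.2.const_mul (disConst α)⁻¹
    refine h2.congr (Filter.Eventually.of_forall fun a => ?_)
    -- Joint integrability is obtained by applying the identity to the norm of G.
    have h3 := (integral_of_isLeftInvariant (G := fun X => ((‖G (a, X)‖ : ℝ) : ℂ))
      (Complex.measurable_ofReal.comp (hm a).norm)
      (fun h hh X => congrArg (fun z : ℂ => ((‖z‖ : ℝ) : ℂ)) (hGi a h hh X))).2
    simp only [← Complex.ofReal_mul, integral_complex_ofReal] at h3
    have h4 := Complex.ofReal_injective h3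
    dsimp only
    rw [h4, ← mul_assoc, inv_mul_cancel₀ (disConst_pos α).ne', one_mul]
    refine integral_congr_ae (Filter.Eventually.of_forall fun p => ?_)
    simp
  refine ⟨hI2, ?_⟩
  rw [Measure.volume_eq_prod] at hI hI2 ⊢
  rw [Measure.volume_eq_prod, integral_prod _ hI, integral_prod _ hI2, ← integral_const_mul]
  exact integral_congr_ae (Filter.Eventually.of_forall fun a => (key a).2)

end Param

section DetIntegral

variable {α β γ : Type} [Fintype α] [Fintype β] [Fintype γ] [DecidableEq α] [DecidableEq β]
  [DecidableEq γ]

/-- The integrand of `detIntegral`. -/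
def detIntegrand (e : α ⊕ β ≃ γ) (f : EuclideanSpace ℝ (γ × γ) → ℂ) (z : ℂ)
    (q : (α × α → ℝ) × (β × β → ℝ)) : ℂ :=
  apow (mat q.1).det z * apow (mat q.2).det (-z) * blockFourier e f q.1 q.2

/-- The integral of `|det a|^z |det ξ|^{-z}` against the block Fourier transform of `f`. -/
def detIntegral (e : α ⊕ β ≃ γ) (f : EuclideanSpace ℝ (γ × γ) → ℂ) (z : ℂ) : ℂ :=
  ∫ q, detIntegrand e f z q

variable {f : EuclideanSpace ℝ (γ × γ) → ℂ}

theorem measurable_apow_det (z : ℂ) : Measurable fun a : α × α → ℝ => apow (mat a).det z :=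
  (measurable_apow z).comp continuous_mat.matrix_det.measurable

theorem measurable_detIntegrand (hf : IsNice f) (e : α ⊕ β ≃ γ) (z : ℂ) :
    Measurable (detIntegrand e f z) :=
  (((measurable_apow_det z).comp measurable_fst).mul
    ((measurable_apow_det (-z)).comp measurable_snd)).mul (continuous_blockFourier hf e).measurable

theorem apow_det_lmul {h : Matrix α α ℝ} (hh : h ∈ Matrix.orthogonalGroup α ℝ) (X : α × α → ℝ)
    (z : ℂ) : apow (mat (lmul h X)).det z = apow (mat X).det z := by
  unfold apow
  rw [abs_det_lmul hh]

theorem detIntegrand_lmul (hf : IsNice f)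
    (hi : IsLeftInvariant fun X : γ × γ → ℝ => f (WithLp.toLp 2 X)) (e : α ⊕ β ≃ γ)
    {h : Matrix α α ℝ} (hh : h ∈ Matrix.orthogonalGroup α ℝ) {k : Matrix β β ℝ}
    (hk : k ∈ Matrix.orthogonalGroup β ℝ) (z : ℂ) (a : α × α → ℝ) (ξ : β × β → ℝ) :
    detIntegrand e f z (lmul h a, lmul k ξ) = detIntegrand e f z (a, ξ) := by
  unfold detIntegrand
  rw [apow_det_lmul hh, apow_det_lmul hk, blockFourier_lmul hf hi e hh hk]

theorem IsNice.exists_decayBound {κ : Type} [Fintype κ] {f : EuclideanSpace ℝ κ → ℂ} (hf : IsNice f)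
    (M : ℕ) : ∃ C, DecayBound M C f ∧ DecayBound M C (𝓕 f) := by
  obtain ⟨C, hC⟩ := hf.rapidDecay.exists_decayBound M
  obtain ⟨D, hD⟩ := hf.rapidDecay_fourier.exists_decayBound M
  exact ⟨max C D, hC.mono le_rfl (le_max_left _ _), hD.mono le_rfl (le_max_right _ _)⟩

theorem lmul_one (X : α × β → ℝ) : lmul (1 : Matrix α α ℝ) X = X := by simp [lmul]

theorem nsq_snoc (p : (β → ℝ) × ℝ) : nsq (snoc p) = nsq p.1 + p.2 ^ 2 := by
  simp [nsq, snoc]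

theorem integrable_decay_snoc {N : ℕ} (hN : Fintype.card (β ⊕ Unit) < N) :
    Integrable fun p : (β → ℝ) × ℝ => decay N (nsq p.1 + p.2 ^ 2) := by
  have hi := measurePreserving_snoc.integrable_comp_of_integrable
    (integrable_decay_nsq (κ := β ⊕ Unit) hN)
  refine hi.congr (Filter.Eventually.of_forall fun p => ?_)
  rw [Function.comp_apply, nsq_snoc]

theorem integrable_blockFourier_tri (hf : IsNice f) (e : α ⊕ (β ⊕ Unit) ≃ γ) (a : α × α → ℝ)
    (ξ : β × β → ℝ) : Integrable fun p => blockFourier e f a (tri (ξ, p)) := by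
  obtain ⟨N, hN⟩ : ∃ N, Fintype.card (β ⊕ Unit) < N := exists_gt _
  obtain ⟨M, K, hK, h⟩ := exists_norm_blockFourier_le e N
  obtain ⟨C, h1, h2⟩ := hf.exists_decayBound M
  have hb := h f C hf h1 h2 a
  have hc : Continuous fun p => blockFourier e f a (tri (ξ, p)) :=
    (continuous_blockFourier hf e).comp (f := fun p => (a, tri (ξ, p))) (continuous_const.prodMk
      (continuous_tri.comp (Continuous.prodMk_right ξ)))
  have hKC : 0 ≤ K * C := mul_nonneg hK h1.nonneg
  refine ((integrable_decay_snoc hN).const_mul (K * C)).mono' hc.aestronglyMeasurable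
    (Filter.Eventually.of_forall fun p => (hb _).trans (mul_le_mul_of_nonneg_left ?_ hKC))
  refine (mul_le_of_le_one_left (decay_pos _ _).le (decay_le_one _ _)).trans
    (decay_le_decay _ (add_nonneg (nsq_nonneg _) (sq_nonneg _)) ?_)
  rw [nsq_tri]
  linarith [nsq_nonneg ξ]

set_option maxHeartbeats 1000000 in
/-- The functional equation that moves one index from the second block to the first. -/
theorem detIntegral_shift (hf : IsNice f)
    (hi : IsLeftInvariant fun X : γ × γ → ℝ => f (WithLp.toLp 2 X)) (e : α ⊕ (β ⊕ Unit) ≃ γ) {z : ℂ}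
    (h0 : 0 < z.re) (h1 : z.re < 1) (H₁ : Integrable (detIntegrand e f z))
    (H₂ : Integrable (detIntegrand (shiftEquiv e) f (z - 1))) :
    disConst α * (gammaFactor z * detIntegral e f z) =
      disConst β * (gammaFactor (1 - z) * detIntegral (shiftEquiv e) f (z - 1)) := by
  -- Before the shift it is the frequency matrix that is reduced to triangular form; after the
  -- shift, in `A₂`, it is the position matrix.
  have A₁ := integral_prod_of_isLeftInvariant (measurable_detIntegrand hf e z)
    (fun a k hk X => by
      have := detIntegrand_lmul hf hi e (Submonoid.one_mem _) hk z a X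
      rwa [lmul_one] at this) H₁
  have H₂' := (Measure.measurePreserving_swap (μ := (volume : Measure (β × β → ℝ)))
    (ν := (volume : Measure ((α ⊕ Unit) × (α ⊕ Unit) → ℝ)))).integrable_comp_of_integrable H₂
  have A₂ := integral_prod_of_isLeftInvariant
    (G := fun q => detIntegrand (shiftEquiv e) f (z - 1) q.swap)
    ((measurable_detIntegrand hf (shiftEquiv e) (z - 1)).comp measurable_swap)
    (fun ξ k hk X => by
      have := detIntegrand_lmul hf hi (shiftEquiv e) hk (Submonoid.one_mem _) (z - 1) X ξ
      rwa [lmul_one] at this) H₂'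
  have S₂ : detIntegral (shiftEquiv e) f (z - 1) = ∫ q : (β × β → ℝ) × ((α ⊕ Unit) × (α ⊕ Unit) → ℝ),
      detIntegrand (shiftEquiv e) f (z - 1) q.swap :=
    (integral_prod_swap (μ := (volume : Measure ((α ⊕ Unit) × (α ⊕ Unit) → ℝ)))
      (ν := (volume : Measure (β × β → ℝ))) (detIntegrand (shiftEquiv e) f (z - 1))).symm
  obtain ⟨I₁, E₁⟩ := A₁
  obtain ⟨I₂, E₂⟩ := A₂
  rw [← S₂] at E₂
  -- Regroup both integrals so that the outer variables are the same pair (a, ξ) and the inner ones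
  -- are the column that has been split off.
  have P₁ := measurePreserving_prodAssoc (volume : Measure (α × α → ℝ))
    (volume : Measure (β × β → ℝ)) (volume : Measure ((β → ℝ) × ℝ))
  have P₂ := (measurePreserving_prodAssoc (volume : Measure (β × β → ℝ))
    (volume : Measure (α × α → ℝ)) (volume : Measure ((α → ℝ) × ℝ))).comp
    ((Measure.measurePreserving_swap (μ := (volume : Measure (α × α → ℝ)))
      (ν := (volume : Measure (β × β → ℝ)))).prod (MeasurePreserving.id
        (volume : Measure ((α → ℝ) × ℝ))))
  have J₁ := P₁.integrable_comp_of_integrable I₁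
  have J₂ := P₂.integrable_comp_of_integrable I₂
  have F₁ := integral_comp_of_measurePreserving P₁ I₁.aestronglyMeasurable
  have F₂ := integral_comp_of_measurePreserving P₂ I₂.aestronglyMeasurable
  rw [show detIntegral e f z = _ from E₁, E₂]
  have key : gammaFactor z * ∫ q : (α × α → ℝ) × (β × β → ℝ) × ((β → ℝ) × ℝ),
        ((|(mat q.2.1).det| : ℝ) : ℂ) * detIntegrand e f z (q.1, tri q.2) =
      gammaFactor (1 - z) * ∫ q : (β × β → ℝ) × (α × α → ℝ) × ((α → ℝ) × ℝ),
        ((|(mat q.2.1).det| : ℝ) : ℂ) * detIntegrand (shiftEquiv e) f (z - 1)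
          (q.1, tri q.2).swap := by
    refine (congrArg (gammaFactor z * ·) F₁.symm).trans
      (Eq.trans ?_ (congrArg (gammaFactor (1 - z) * ·) F₂))
    refine (congrArg (gammaFactor z * ·) (integral_prod _ J₁)).trans
      (Eq.trans ?_ (congrArg (gammaFactor (1 - z) * ·) (integral_prod _ J₂)).symm)
    rw [← integral_const_mul, ← integral_const_mul]
    refine integral_congr_ae ?_
    have n₁ : ∀ᵐ q : (α × α → ℝ) × (β × β → ℝ), (mat q.1).det ≠ 0 :=
      Measure.quasiMeasurePreserving_fst.ae ae_det_mat_ne_zero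
    have n₂ : ∀ᵐ q : (α × α → ℝ) × (β × β → ℝ), (mat q.2).det ≠ 0 :=
      Measure.quasiMeasurePreserving_snd.ae ae_det_mat_ne_zero
    filter_upwards [J₁.prod_right_ae, J₂.prod_right_ae, n₁, n₂] with q hq₁ hq₂ hn₁ hn₂
    obtain ⟨a, ξ⟩ := q
    dsimp only at hn₁ hn₂
    -- The factor common to both sides: before the shift the density |det ξ| meets |det ξ|^{-z},
    -- after it the density |det a| meets |det a|^{z-1}. Only a power of the corner entry is left
    -- under the inner integrals.
    set w : ℂ := apow (mat a).det z * apow (mat ξ).det (1 - z) with hw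
    have hw0 : w ≠ 0 := mul_ne_zero (apow_ne_zero hn₁ _) (apow_ne_zero hn₂ _)
    have c₁ : ∀ p : (β → ℝ) × ℝ, ((|(mat ξ).det| : ℝ) : ℂ) * detIntegrand e f z (a, tri (ξ, p)) =
        w * (apow p.2 (-z) * blockFourier e f a (tri (ξ, p))) := by
      intro p
      rw [detIntegrand, det_tri, apow_mul, hw, show (1 - z : ℂ) = -z + 1 by ring,
        ← abs_mul_apow hn₂ (-z)]
      ring
    have c₂ : ∀ p : (α → ℝ) × ℝ, ((|(mat a).det| : ℝ) : ℂ) *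
        detIntegrand (shiftEquiv e) f (z - 1) (tri (a, p), ξ) =
        w * (apow p.2 (z - 1) * blockFourier (shiftEquiv e) f (tri (a, p)) ξ) := by
      intro p
      rw [detIntegrand, det_tri, apow_mul, hw, show apow (mat a).det z =
        ((|(mat a).det| : ℝ) : ℂ) * apow (mat a).det (z - 1) by rw [abs_mul_apow hn₁]; ring_nf]
      dsimp only
      rw [neg_sub]
      ring
    have d₁ : Integrable fun p : (β → ℝ) × ℝ =>
        w * (apow p.2 (-z) * blockFourier e f a (tri (ξ, p))) :=
      hq₁.congr (Filter.Eventually.of_forall c₁)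
    have d₂ : Integrable fun p : (α → ℝ) × ℝ =>
        w * (apow p.2 (z - 1) * blockFourier (shiftEquiv e) f (tri (a, p)) ξ) :=
      hq₂.congr (Filter.Eventually.of_forall c₂)
    rw [integrable_const_mul_iff (isUnit_iff_ne_zero.2 hw0)] at d₁ d₂
    have h := functional_equation_prod h0 h1 (integrable_blockFourier_tri hf e a ξ) d₁ d₂
      fun t => integral_blockFourier_tri hf e a ξ t
    calc _ = gammaFactor z * (w * ∫ p : (β → ℝ) × ℝ,
          apow p.2 (-z) * blockFourier e f a (tri (ξ, p))) := by
          rw [← integral_const_mul w]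
          exact congrArg _ (integral_congr_ae (Filter.Eventually.of_forall c₁))
      _ = gammaFactor (1 - z) * (w * ∫ p : (α → ℝ) × ℝ,
          apow p.2 (z - 1) * blockFourier (shiftEquiv e) f (tri (a, p)) ξ) := by
          rw [mul_left_comm, h, mul_left_comm]
      _ = _ := by
          rw [← integral_const_mul w]
          exact congrArg _ (integral_congr_ae (Filter.Eventually.of_forall fun p => (c₂ p).symm))
  linear_combination (disConst α : ℂ) * (disConst β : ℂ) * key

end DetIntegral

/-! ### Holomorphy and uniform bounds on a strip -/

theorem differentiableAt_integral_exp {X : Type*} [MeasurableSpace X] {μ : Measure X} {L : X → ℝ}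
    {Q : X → ℂ} (hL : Measurable L) (hQ : AEStronglyMeasurable Q μ) {z₀ : ℂ} {δ : ℝ} (hδ : 0 < δ)
    (hI : ∀ σ ∈ Icc (z₀.re - 2 * δ) (z₀.re + 2 * δ), Integrable (fun x => Real.exp (σ * L x) * ‖Q x‖) μ) :
    DifferentiableAt ℂ (fun z => ∫ x, Complex.exp (z * (L x : ℝ)) * Q x ∂μ) z₀ := by
  have hm : ∀ z : ℂ, Measurable fun x => Complex.exp (z * (L x : ℝ)) := fun z =>
    Complex.measurable_exp.comp ((Complex.measurable_ofReal.comp hL).const_mul z)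
  have i1 := hI (z₀.re - 2 * δ) ⟨le_rfl, by linarith⟩
  have i2 := hI (z₀.re + 2 * δ) ⟨by linarith, le_rfl⟩
  have i3 := hI z₀.re ⟨by linarith, by linarith⟩
  -- For |z - z₀| < δ the derivative L e^{zL} is at most δ⁻¹ e^{Re z₀ L + 2δ|L|}; one δ absorbs the
  -- factor L, the other the variation of z. The sum over both signs of L dominates.
  refine (hasDerivAt_integral_of_dominated_loc_of_deriv_le
    (F' := fun z x => (L x : ℂ) * Complex.exp (z * (L x : ℝ)) * Q x)
    (bound := fun x => δ⁻¹ * (Real.exp ((z₀.re + 2 * δ) * L x) * ‖Q x‖ +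
      Real.exp ((z₀.re - 2 * δ) * L x) * ‖Q x‖)) (Metric.ball_mem_nhds z₀ hδ) ?_ ?_ ?_ ?_ ?_
    ?_).2.differentiableAt
  · exact Filter.Eventually.of_forall fun z => (hm z).aestronglyMeasurable.mul hQ
  · refine i3.mono ((hm z₀).aestronglyMeasurable.mul hQ) (Filter.Eventually.of_forall fun x => ?_)
    rw [norm_mul, Complex.norm_exp, norm_mul, norm_norm]
    simp
  · exact ((Complex.measurable_ofReal.comp hL).mul (hm z₀)).aestronglyMeasurable.mul hQ
  · refine Filter.Eventually.of_forall fun x z hz => ?_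
    have hre : |z.re - z₀.re| ≤ δ := by
      have := Complex.abs_re_le_norm (z - z₀)
      rw [Complex.sub_re] at this
      exact this.trans (by rw [← dist_eq_norm]; exact (Metric.mem_ball.1 hz).le)
    rw [norm_mul, norm_mul, Complex.norm_exp]
    have e1 : (z * (L x : ℝ)).re = z.re * L x := by simp
    rw [e1, Complex.norm_real, Real.norm_eq_abs]
    have h1 : |L x| ≤ δ⁻¹ * Real.exp (δ * |L x|) := by
      rw [← div_eq_inv_mul, le_div_iff₀ hδ]
      nlinarith [Real.add_one_le_exp (δ * |L x|)]
    have h2 : z.re * L x ≤ z₀.re * L x + δ * |L x| := by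
      have : (z.re - z₀.re) * L x ≤ |z.re - z₀.re| * |L x| := by
        rw [← abs_mul]; exact le_abs_self _
      nlinarith [abs_nonneg (L x)]
    have h3 : Real.exp (z₀.re * L x + 2 * δ * |L x|) ≤
        Real.exp ((z₀.re + 2 * δ) * L x) + Real.exp ((z₀.re - 2 * δ) * L x) := by
      rcases le_total 0 (L x) with h | h
      · rw [abs_of_nonneg h]
        have : z₀.re * L x + 2 * δ * L x = (z₀.re + 2 * δ) * L x := by ring
        rw [this]; linarith [Real.exp_pos ((z₀.re - 2 * δ) * L x)]
      · rw [abs_of_nonpos h]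
        have : z₀.re * L x + 2 * δ * -L x = (z₀.re - 2 * δ) * L x := by ring
        rw [this]; linarith [Real.exp_pos ((z₀.re + 2 * δ) * L x)]
    have h4 : |L x| * Real.exp (z.re * L x) ≤ δ⁻¹ * Real.exp (z₀.re * L x + 2 * δ * |L x|) := by
      calc |L x| * Real.exp (z.re * L x)
          ≤ (δ⁻¹ * Real.exp (δ * |L x|)) * Real.exp (z₀.re * L x + δ * |L x|) := by gcongr
        _ = _ := by rw [mul_assoc, ← Real.exp_add]; ring_nf
    calc |L x| * Real.exp (z.re * L x) * ‖Q x‖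
        ≤ δ⁻¹ * (Real.exp ((z₀.re + 2 * δ) * L x) + Real.exp ((z₀.re - 2 * δ) * L x)) * ‖Q x‖ := by
          exact mul_le_mul_of_nonneg_right (h4.trans (mul_le_mul_of_nonneg_left h3
            (inv_pos.2 hδ).le)) (norm_nonneg _)
      _ = _ := by ring
  · exact (i2.add i1).const_mul _
  · refine Filter.Eventually.of_forall fun x z _ => ?_
    have h := (((hasDerivAt_id z).mul_const ((L x : ℝ) : ℂ)).cexp).mul_const (Q x)
    exact h.congr_deriv (by simp only [id]; ring)

/-- The empty determinant is 1, so for n = 0 every exponent is allowed. This is what opens the first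
and the last strip into half-planes. -/
theorem exists_integrable_abs_det_rpow_mul_decay (n : ℕ) {r : ℝ} (hr : -1 < r ∨ n = 0) :
    ∃ N₀, ∀ N, N₀ ≤ N →
      Integrable fun a : Idx n × Idx n → ℝ => |(mat a).det| ^ r * decay N (nsq a) := by
  have key : ∀ r : ℝ, -1 < r → ∃ N₀, ∀ N, N₀ ≤ N →
      Integrable fun a : Idx n × Idx n → ℝ => |(mat a).det| ^ r * decay N (nsq a) := by
    intro r hr
    obtain ⟨N₀, h⟩ := exists_lintegral_abs_det_rpow_mul_decay_lt_top n hr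
    refine ⟨N₀, fun N hN => ⟨((measurable_abs_det_rpow r).mul
      ((continuous_decay N).comp continuous_nsq).measurable).aestronglyMeasurable, ?_⟩⟩
    rw [hasFiniteIntegral_iff_ofReal (Filter.Eventually.of_forall fun v =>
      mul_nonneg (by positivity) (decay_pos _ _).le)]
    exact h N hN
  rcases hr with hr | rfl
  · exact key r hr
  · obtain ⟨N₀, h⟩ := key 0 (by norm_num)
    refine ⟨N₀, fun N hN => (h N hN).congr (Filter.Eventually.of_forall fun a => ?_)⟩
    simp [Matrix.det_isEmpty]

section Bounds

variable {γ : Type} [Fintype γ] [DecidableEq γ] {k p : ℕ}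

/-- The strip on which `detIntegral` converges. -/
def strip (k p : ℕ) : Set ℂ := {z | (-1 < z.re ∨ k = 0) ∧ (z.re < 1 ∨ p = 0)}

theorem isOpen_strip (k p : ℕ) : IsOpen (strip k p) := by
  have h1 : IsOpen {z : ℂ | -1 < z.re ∨ k = 0} := by
    by_cases h : k = 0
    · simp [h]
    · simpa [h] using isOpen_lt continuous_const Complex.continuous_re
  have h2 : IsOpen {z : ℂ | z.re < 1 ∨ p = 0} := by
    by_cases h : p = 0
    · simp [h]
    · simpa [h] using isOpen_lt Complex.continuous_re continuous_const
  exact h1.inter h2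

/-- The integrals over a and ξ separate once the block Fourier transform is bounded by a product.
Again M and K do not depend on f. -/
theorem exists_norm_detIntegral_le (e : Idx k ⊕ Idx p ≃ γ) {z : ℂ} (hz : z ∈ strip k p) :
    ∃ M : ℕ, ∃ K : ℝ, 0 ≤ K ∧ ∀ (f : EuclideanSpace ℝ (γ × γ) → ℂ) (C : ℝ), IsNice f →
      DecayBound M C f → DecayBound M C (𝓕 f) →
      Integrable (detIntegrand e f z) ∧ ‖detIntegral e f z‖ ≤ K * C := by
  obtain ⟨N₁, h₁⟩ := exists_integrable_abs_det_rpow_mul_decay k hz.1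
  obtain ⟨N₂, h₂⟩ := exists_integrable_abs_det_rpow_mul_decay p (r := -z.re)
    (hz.2.imp_left fun h => by linarith)
  set N := max N₁ N₂
  have i := (h₁ N (le_max_left _ _)).mul_prod (h₂ N (le_max_right _ _))
  obtain ⟨M, K, hK, hb⟩ := exists_norm_blockFourier_le e N
  refine ⟨M, K * ∫ q : (Idx k × Idx k → ℝ) × (Idx p × Idx p → ℝ),
    |(mat q.1).det| ^ z.re * decay N (nsq q.1) * (|(mat q.2).det| ^ (-z.re) * decay N (nsq q.2)),
    mul_nonneg hK (integral_nonneg fun q => ?_), fun f C hf h1 h2 => ?_⟩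
  · have d1 := decay_pos N (nsq q.1)
    have d2 := decay_pos N (nsq q.2)
    positivity
  · have hle : ∀ q : (Idx k × Idx k → ℝ) × (Idx p × Idx p → ℝ), ‖detIntegrand e f z q‖ ≤
        K * C * (|(mat q.1).det| ^ z.re * decay N (nsq q.1) *
          (|(mat q.2).det| ^ (-z.re) * decay N (nsq q.2))) := by
      intro q
      rw [detIntegrand, norm_mul, norm_mul]
      calc ‖apow (mat q.1).det z‖ * ‖apow (mat q.2).det (-z)‖ * ‖blockFourier e f q.1 q.2‖
          ≤ |(mat q.1).det| ^ z.re * |(mat q.2).det| ^ (-z.re) *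
            (K * C * (decay N (nsq q.1) * decay N (nsq q.2))) := by
            gcongr
            · exact norm_apow_le _ _
            · exact norm_apow_le _ (-z)
            · exact hb f C hf h1 h2 _ _
        _ = _ := by ring
    have hi := i.const_mul (K * C)
    refine ⟨hi.mono' (measurable_detIntegrand hf e z).aestronglyMeasurable
      (Filter.Eventually.of_forall hle), ?_⟩
    refine (norm_integral_le_of_norm_le hi (Filter.Eventually.of_forall hle)).trans (le_of_eq ?_)
    rw [integral_const_mul, Measure.volume_eq_prod]
    ring

theorem integrable_detIntegrand {f : EuclideanSpace ℝ (γ × γ) → ℂ} (hf : IsNice f)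
    (e : Idx k ⊕ Idx p ≃ γ) {z : ℂ} (hz : z ∈ strip k p) : Integrable (detIntegrand e f z) := by
  obtain ⟨M, K, -, h⟩ := exists_norm_detIntegral_le e hz
  obtain ⟨C, h1, h2⟩ := hf.exists_decayBound M
  exact (h f C hf h1 h2).1

theorem ae_det_ne_zero_prod : ∀ᵐ q : (Idx k × Idx k → ℝ) × (Idx p × Idx p → ℝ),
    (mat q.1).det ≠ 0 ∧ (mat q.2).det ≠ 0 := by
  have n₁ : ∀ᵐ q : (Idx k × Idx k → ℝ) × (Idx p × Idx p → ℝ), (mat q.1).det ≠ 0 :=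
    Measure.quasiMeasurePreserving_fst.ae ae_det_mat_ne_zero
  have n₂ : ∀ᵐ q : (Idx k × Idx k → ℝ) × (Idx p × Idx p → ℝ), (mat q.2).det ≠ 0 :=
    Measure.quasiMeasurePreserving_snd.ae ae_det_mat_ne_zero
  exact n₁.and n₂

/-- Off the null set of singular matrices the integrand is e^{zL} times a function independent of z,
where L = log|det a| - log|det ξ|. Convergence in a neighbourhood of z supplies the domination. -/
theorem differentiableAt_detIntegral {f : EuclideanSpace ℝ (γ × γ) → ℂ} (hf : IsNice f)
    (e : Idx k ⊕ Idx p ≃ γ) {z : ℂ} (hz : z ∈ strip k p) :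
    DifferentiableAt ℂ (detIntegral e f) z := by
  set L : (Idx k × Idx k → ℝ) × (Idx p × Idx p → ℝ) → ℝ := fun q =>
    Real.log |(mat q.1).det| - Real.log |(mat q.2).det| with hL
  have hLm : Measurable L :=
    ((Real.measurable_log.comp continuous_mat.matrix_det.measurable.norm).comp measurable_fst).sub
      ((Real.measurable_log.comp continuous_mat.matrix_det.measurable.norm).comp measurable_snd)
  have hQ : Continuous fun q : (Idx k × Idx k → ℝ) × (Idx p × Idx p → ℝ) =>
    blockFourier e f q.1 q.2 := continuous_blockFourier hf e
  have heq : ∀ z : ℂ, detIntegrand e f z =ᵐ[volume] fun q =>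
      Complex.exp (z * (L q : ℝ)) * blockFourier e f q.1 q.2 := by
    intro z
    filter_upwards [ae_det_ne_zero_prod] with q hq
    rw [detIntegrand, apow_eq_exp hq.1, apow_eq_exp hq.2, ← Complex.exp_add, hL]
    congr 2
    push_cast
    ring
  obtain ⟨ε, hε, hball⟩ := Metric.isOpen_iff.1 (isOpen_strip k p) z hz
  have h := differentiableAt_integral_exp (μ := volume) (z₀ := z) (δ := ε / 4) hLm
    hQ.aestronglyMeasurable (by positivity) fun σ hσ => by
      have hmem : (σ + z.im * Complex.I : ℂ) ∈ strip k p := by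
        refine hball ?_
        rw [Metric.mem_ball, dist_eq_norm]
        have : (σ + z.im * Complex.I : ℂ) - z = ((σ - z.re : ℝ) : ℂ) := by
          apply Complex.ext <;> simp
        rw [this, Complex.norm_real, Real.norm_eq_abs]
        have := abs_le.2 ⟨(by linarith [hσ.1] : -(ε / 2) ≤ σ - z.re), by linarith [hσ.2]⟩
        linarith
      refine (integrable_detIntegrand hf e hmem).norm.congr ?_
      filter_upwards [heq (σ + z.im * Complex.I)] with q hq
      rw [hq, norm_mul, Complex.norm_exp]
      simp
  have hfun : detIntegral e f = fun z => ∫ q, Complex.exp (z * (L q : ℝ)) *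
      blockFourier e f q.1 q.2 := by
    funext z
    exact integral_congr_ae (heq z)
  rw [hfun]
  exact h

end Bounds

/-! ### Gluing the strips to an entire function -/

/-- The standard enumeration of `Idx n`. -/
def idxEquiv : (n : ℕ) → Idx n ≃ Fin n
  | 0 => Equiv.equivOfIsEmpty _ _
  | n + 1 => ((idxEquiv n).sumCongr (Equiv.ofUnique Unit (Fin 1))).trans finSumFinEquiv

/-- The partition of `d = k + p` rows into `k` rows and `p` rows. -/
def chain {d : ℕ} : (k p : ℕ) → k + p = d → (Idx k ⊕ Idx p ≃ Fin d)
  | 0, p, h => ((Equiv.emptySum (Idx 0) (Idx p)).trans (idxEquiv p)).trans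
      (finCongr (by omega))
  | k + 1, p, h => shiftEquiv (α := Idx k) (β := Idx p) (chain k (p + 1) (by omega))

/-- Each shift hands the last index of the second block over to the first, so the second block
always consists of the first p coordinates; these will span the reference plane of the Grassmannian.
-/
theorem chain_inr {d : ℕ} (k p : ℕ) (h : k + p = d) (b : Idx p) :
    ((chain k p h (Sum.inr b) : Fin d) : ℕ) = idxEquiv p b := by
  induction k generalizing p with
  | zero => rfl
  | succ k ih =>
    have h1 := ih (p + 1) (by omega) (Sum.inl b)
    have h2 : chain (k + 1) p h (Sum.inr b) = chain k (p + 1) (by omega) (Sum.inr (Sum.inl b)) := rfl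
    rw [h2]
    exact h1

theorem chain_inr_lt {d : ℕ} (k p : ℕ) (h : k + p = d) (b : Idx p) :
    ((chain k p h (Sum.inr b) : Fin d) : ℕ) < p := by
  rw [chain_inr]; exact (idxEquiv p b).2

theorem le_chain_inl {d : ℕ} (k p : ℕ) (h : k + p = d) (a : Idx k) :
    p ≤ ((chain k p h (Sum.inl a) : Fin d) : ℕ) := by
  by_contra hlt
  push Not at hlt
  obtain ⟨b, hb⟩ := (idxEquiv p).surjective ⟨_, hlt⟩
  have h1 : chain k p h (Sum.inr b) = chain k p h (Sum.inl a) := by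
    apply Fin.ext
    rw [chain_inr, hb]
  simpa using (chain k p h).injective h1

section Norm

variable {d : ℕ}

/-- The space of `d × d` matrices. -/
abbrev SqMat (d : ℕ) : Type := EuclideanSpace ℝ (Fin d × Fin d)

/-- The regularised determinant integral in the strip `k - 1 < Re s < k + 1`. -/
def normInt (k p : ℕ) (h : k + p = d) (f : SqMat d → ℂ) (s : ℂ) : ℂ :=
  gammaN k k * gammaN p p * ((gammaN k s)⁻¹ * (gammaN p (d - s))⁻¹) *
    detIntegral (chain k p h) f (s - k)

variable {f : SqMat d → ℂ}

theorem gammaFactor_natCast_ne_zero (n : ℕ) : gammaFactor ((n : ℂ) + 1) ≠ 0 := by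
  refine gammaFactor_ne_zero ?_
  simp only [Complex.add_re, Complex.natCast_re, Complex.one_re]
  positivity

theorem disConst_idx_complex (n : ℕ) :
    (disConst (Idx n) : ℂ) * (2 * gammaFactor ((n : ℂ) + 1)) = 1 := by
  have := disConst_idx n
  have h2 : ((disConst (Idx n) * (2 * gammaReal (n + 1)) : ℝ) : ℂ) = 1 := by rw [this]; simp
  refine Eq.trans ?_ h2
  push_cast
  rw [ofReal_gammaReal]
  push_cast
  rfl

theorem detIntegral_chain_succ (hf : IsNice f)
    (hi : IsLeftInvariant fun X : Fin d × Fin d → ℝ => f (WithLp.toLp 2 X)) (k p : ℕ)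
    (h : k + (p + 1) = d) {z : ℂ} (h0 : 0 < z.re) (h1 : z.re < 1) :
    (disConst (Idx k) : ℂ) * (gammaFactor z * detIntegral (chain k (p + 1) h) f z) =
      disConst (Idx p) * (gammaFactor (1 - z) *
        detIntegral (chain (k + 1) p (by omega)) f (z - 1)) := by
  have H₁ : Integrable (detIntegrand (chain k (p + 1) h) f z) :=
    integrable_detIntegrand hf _ ⟨Or.inl (by linarith), Or.inl h1⟩
  have H₂ : Integrable (detIntegrand (chain (k + 1) p (by omega)) f (z - 1)) :=
    integrable_detIntegrand hf _ ⟨Or.inl (by simpa using h0),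
      Or.inl (by simp only [Complex.sub_re, Complex.one_re]; linarith)⟩
  exact detIntegral_shift (α := Idx k) (β := Idx p) hf hi (chain k (p + 1) h) h0 h1 H₁ H₂

/-- With z = s - k, the extra factors of γ_{p+1}(d - s) and γ_{k+1}(s) are γ(1 - z) and γ(z), as in
the functional equation. The constants γ_k(k) γ_p(p) change by γ(p + 1) and γ(k + 1), which
compensate the disintegration constants. -/
theorem normInt_succ (hf : IsNice f)
    (hi : IsLeftInvariant fun X : Fin d × Fin d → ℝ => f (WithLp.toLp 2 X)) (k p : ℕ)
    (h : k + (p + 1) = d) {s : ℂ} (h0 : k < s.re) (h1 : s.re < k + 1) :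
    normInt k (p + 1) h f s = normInt (k + 1) p (by omega) f s := by
  have hz0 : 0 < (s - k).re := by simpa using h0
  have hz1 : (s - k).re < 1 := by
    simp only [Complex.sub_re, Complex.natCast_re]; linarith
  have key := detIntegral_chain_succ hf hi k p h hz0 hz1
  have hd : (d : ℂ) - s - p = 1 - (s - k) := by
    rw [← h]; push_cast; ring
  have hk : (s : ℂ) - ((k + 1 : ℕ) : ℂ) = s - k - 1 := by push_cast; ring
  have g1 := gammaFactor_ne_zero hz0
  have g2 : gammaFactor (1 - (s - k)) ≠ 0 := gammaFactor_ne_zero (by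
    simp only [Complex.sub_re, Complex.one_re] at hz1 ⊢; linarith)
  have c1 := disConst_idx_complex k
  have c2 := disConst_idx_complex p
  have n1 := gammaFactor_natCast_ne_zero k
  have n2 := gammaFactor_natCast_ne_zero p
  have e1 : gammaN (p + 1) ((p + 1 : ℕ) : ℂ) = gammaFactor ((p : ℂ) + 1) * gammaN p p := by
    rw [gammaN_succ']; push_cast; congr 2; ring
  have e2 : gammaN (k + 1) ((k + 1 : ℕ) : ℂ) = gammaFactor ((k : ℂ) + 1) * gammaN k k := by
    rw [gammaN_succ']; push_cast; congr 2; ring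
  unfold normInt
  rw [e1, e2, gammaN_succ p, gammaN_succ k, hd, hk, mul_inv, mul_inv]
  set D := detIntegral (chain k (p + 1) h) f (s - k)
  set D' := detIntegral (chain (k + 1) p (by omega)) f (s - k - 1)
  have d1 : (disConst (Idx k) : ℂ) = (2 * gammaFactor ((k : ℂ) + 1))⁻¹ := eq_inv_of_mul_eq_one_left c1
  have d2 : (disConst (Idx p) : ℂ) = (2 * gammaFactor ((p : ℂ) + 1))⁻¹ := eq_inv_of_mul_eq_one_left c2
  rw [d1, d2] at key
  have key2 : gammaFactor ((p : ℂ) + 1) * (gammaFactor (1 - (s - k)))⁻¹ * D =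
      gammaFactor ((k : ℂ) + 1) * (gammaFactor (s - k))⁻¹ * D' := by
    field_simp at key ⊢
    linear_combination key
  linear_combination (gammaN k k * gammaN p p * (gammaN k s)⁻¹ * (gammaN p (d - s))⁻¹) * key2

/-- The regularised determinant integral. -/
def regInt (d : ℕ) (f : SqMat d → ℂ) (s : ℂ) : ℂ :=
  normInt (min d ⌊s.re⌋₊) (d - min d ⌊s.re⌋₊) (by omega) f s

theorem normInt_congr {k p k' p' : ℕ} {h : k + p = d} {h' : k' + p' = d} (hk : k = k') (s : ℂ) :
    normInt k p h f s = normInt k' p' h' f s := by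
  subst hk
  obtain rfl : p = p' := by omega
  rfl

/-- In the strip of k the floor of Re s is k or k - 1, and in the latter case `normInt_succ` leads
back to k. The natural floor is 0 for negative Re s and the minimum caps it at d, so the two end
strips are half-planes. -/
theorem regInt_eq (hf : IsNice f)
    (hi : IsLeftInvariant fun X : Fin d × Fin d → ℝ => f (WithLp.toLp 2 X)) (k p : ℕ)
    (h : k + p = d) {s : ℂ} (h0 : (k : ℝ) - 1 < s.re ∨ k = 0) (h1 : s.re < k + 1 ∨ p = 0) :
    regInt d f s = normInt k p h f s := by
  have hfl : (k : ℝ) ≤ s.re ∨ k = 0 → regInt d f s = normInt k p h f s := by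
    intro h2
    refine normInt_congr ?_ s
    rcases h1 with h1 | h1
    · have : ⌊s.re⌋₊ = k := by
        rcases h2 with h2 | h2
        · exact (Nat.floor_eq_iff ((Nat.cast_nonneg k).trans h2)).2 ⟨h2, h1⟩
        · subst h2
          exact Nat.floor_eq_zero.2 (by simpa using h1)
      omega
    · have : k ≤ ⌊s.re⌋₊ := by
        rcases h2 with h2 | h2
        · exact Nat.le_floor h2
        · omega
      omega
  by_cases h2 : (k : ℝ) ≤ s.re ∨ k = 0
  · exact hfl h2
  · push Not at h2
    obtain ⟨h2, h3⟩ := h2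
    have h0' : (k : ℝ) - 1 < s.re := h0.resolve_right h3
    obtain ⟨j, rfl⟩ := Nat.exists_eq_succ_of_ne_zero h3
    push_cast at h0' h2
    rw [← normInt_succ hf hi j p (by omega) (by linarith) h2]
    refine normInt_congr ?_ s
    have : ⌊s.re⌋₊ = j := (Nat.floor_eq_iff ((Nat.cast_nonneg j).trans (by linarith))).2
      ⟨by linarith, h2⟩
    omega

theorem mem_strip_sub {k p : ℕ} {s : ℂ} :
    s - k ∈ strip k p ↔ ((k : ℝ) - 1 < s.re ∨ k = 0) ∧ (s.re < k + 1 ∨ p = 0) := by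
  simp only [strip, Complex.sub_re, Complex.natCast_re, mem_ofPred_eq]
  constructor <;> rintro ⟨h1, h2⟩ <;>
    exact ⟨h1.imp_left fun h => by linarith, h2.imp_left fun h => by linarith⟩

theorem floor_mem_strip (d : ℕ) (s : ℂ) :
    s - ((min d ⌊s.re⌋₊ : ℕ) : ℂ) ∈ strip (min d ⌊s.re⌋₊) (d - min d ⌊s.re⌋₊) := by
  rw [mem_strip_sub]
  constructor
  · by_cases h : min d ⌊s.re⌋₊ = 0
    · exact Or.inr h
    · left
      have h1 : ⌊s.re⌋₊ ≠ 0 := by omega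
      have h2 : 0 ≤ s.re := by
        by_contra hn
        exact h1 (Nat.floor_of_nonpos (not_le.1 hn).le)
      have h3 := Nat.floor_le h2
      have h4 : ((min d ⌊s.re⌋₊ : ℕ) : ℝ) ≤ ⌊s.re⌋₊ := by exact_mod_cast min_le_right _ _
      linarith
  · by_cases h : ⌊s.re⌋₊ ≤ d
    · left
      rw [min_eq_right h]
      exact Nat.lt_floor_add_one _
    · right; omega

/-- Strips are open and overlap, so near any s the function is a single `normInt`: a convergent
integral times reciprocals of gamma factors. -/
theorem differentiable_regInt (hf : IsNice f)
    (hi : IsLeftInvariant fun X : Fin d × Fin d → ℝ => f (WithLp.toLp 2 X)) :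
    Differentiable ℂ (regInt d f) := by
  intro s
  set k := min d ⌊s.re⌋₊ with hk
  have hs := floor_mem_strip d s
  rw [← hk] at hs
  have hkp : k + (d - k) = d := by omega
  have h1 : regInt d f =ᶠ[nhds s] normInt k (d - k) hkp f := by
    have ho : IsOpen {w : ℂ | w - k ∈ strip k (d - k)} :=
      (isOpen_strip _ _).preimage (continuous_id.sub continuous_const)
    filter_upwards [ho.mem_nhds hs] with w hw
    have := mem_strip_sub.1 hw
    exact regInt_eq hf hi k (d - k) hkp this.1 this.2
  refine DifferentiableAt.congr_of_eventuallyEq ?_ h1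
  have h2 : DifferentiableAt ℂ (fun w : ℂ => detIntegral (chain k (d - k) hkp) f (w - k)) s :=
    DifferentiableAt.comp (f := fun w : ℂ => w - k) s
      (differentiableAt_detIntegral hf (chain k (d - k) hkp) hs) (by fun_prop)
  have h3 := differentiable_inv_gammaN k
  have h4 : Differentiable ℂ fun w : ℂ => (gammaN (d - k) (d - w))⁻¹ :=
    (differentiable_inv_gammaN (d - k)).comp (by fun_prop)
  exact (((h3 s).mul (h4 s)).const_mul _).mul h2

theorem exists_norm_regInt_le (d : ℕ) (s : ℂ) :
    ∃ M : ℕ, ∃ K : ℝ, 0 ≤ K ∧ ∀ (f : SqMat d → ℂ) (C : ℝ), IsNice f →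
      DecayBound M C f → DecayBound M C (𝓕 f) → ‖regInt d f s‖ ≤ K * C := by
  obtain ⟨M, K, hK, h⟩ := exists_norm_detIntegral_le
    (chain (d := d) (min d ⌊s.re⌋₊) (d - min d ⌊s.re⌋₊) (by omega)) (floor_mem_strip d s)
  refine ⟨M, ‖gammaN (min d ⌊s.re⌋₊) (min d ⌊s.re⌋₊ : ℕ) *
    gammaN (d - min d ⌊s.re⌋₊) (d - min d ⌊s.re⌋₊ : ℕ) * ((gammaN (min d ⌊s.re⌋₊) s)⁻¹ *
    (gammaN (d - min d ⌊s.re⌋₊) (d - s))⁻¹)‖ * K, by positivity, fun f C hf h1 h2 => ?_⟩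
  rw [regInt, normInt, norm_mul]
  exact (mul_le_mul_of_nonneg_left (h f C hf h1 h2).2 (norm_nonneg _)).trans
    (le_of_eq (mul_assoc _ _ _).symm)

theorem gammaN_self_ne_zero (n : ℕ) : gammaN n n ≠ 0 :=
  gammaN_ne_zero (by simp)

/-- At s = k the exponents vanish and the gamma factors cancel; the integral over ξ is then Fourier
inversion at zero in the lower right block. -/
theorem regInt_natCast (hf : IsNice f)
    (hi : IsLeftInvariant fun X : Fin d × Fin d → ℝ => f (WithLp.toLp 2 X)) (k p : ℕ)
    (h : k + p = d) :
    regInt d f k = ∫ q : (Idx k × Idx k → ℝ) × (Idx k × Idx p → ℝ),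
      f (WithLp.toLp 2 (join (colE (chain k p h))
        (padTop (chain k p h) q.1, padTop (chain k p h) q.2))) := by
  have hz : (k : ℂ) - k ∈ strip k p := by
    rw [sub_self]
    exact ⟨Or.inl (by simp), Or.inl (by simp)⟩
  have hm := mem_strip_sub.1 hz
  have hd : (d : ℂ) - k = p := by rw [← h]; push_cast; ring
  rw [regInt_eq hf hi k p h hm.1 hm.2, normInt, hd, ← mul_inv,
    mul_inv_cancel₀ (mul_ne_zero (gammaN_self_ne_zero k) (gammaN_self_ne_zero p)), one_mul,
    sub_self]
  have H : Integrable (detIntegrand (chain k p h) f 0) :=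
    integrable_detIntegrand hf _ (by rwa [sub_self] at hz)
  have e1 : ∀ q, detIntegrand (chain k p h) f 0 q = blockFourier (chain k p h) f q.1 q.2 := by
    intro q
    simp [detIntegrand]
  rw [detIntegral]
  simp only [funext e1] at H ⊢
  rw [Measure.volume_eq_prod] at H ⊢
  rw [integral_prod _ H, Measure.volume_eq_prod, integral_prod]
  · exact integral_congr_ae (Filter.Eventually.of_forall fun a => integral_blockFourier hf _ a)
  · have hc1 := continuous_padTop (δ := Idx k) (chain k p h)
    have hc2 := continuous_padTop (δ := Idx p) (chain k p h)
    set g : ((Idx k × Idx k) ⊕ (Idx k × Idx p) → ℝ) → (Fin d × Fin d → ℝ) := fun x =>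
      join (colE (chain k p h)) (padTop (chain k p h) fun i => x (Sum.inl i),
        padTop (chain k p h) fun i => x (Sum.inr i)) with hg
    have hi2 := integrable_mul_comp hf.continuous hf.rapidDecay (g := g) (c := fun _ => 1)
      (by fun_prop) (fun x => by
        rw [hg, nsq_join, nsq_padTop, nsq_padTop, nsq, Fintype.sum_sum_type]; exact le_rfl)
      continuous_const (fun _ => by simp)
    have hi3 := (measurePreserving_join
      (Equiv.refl ((Idx k × Idx k) ⊕ (Idx k × Idx p)))).integrable_comp_of_integrable hi2
    simp only [one_mul] at hi3
    exact hi3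

end Norm

/-! ### Averaging over the orthogonal group -/

section Haar

variable {d : ℕ}

instance : (haarOrth d).IsHaarMeasure := by unfold haarOrth; infer_instance

instance : IsProbabilityMeasure (haarOrth d) := ⟨by
  have := Measure.haarMeasure_self (K₀ := (⊤ : TopologicalSpace.PositiveCompacts (Orth d)))
  simpa [haarOrth] using this⟩

instance : SecondCountableTopology (Orth d) :=
  haveI : SecondCountableTopology (Matrix (Fin d) (Fin d) ℝ) :=
    inferInstanceAs (SecondCountableTopology (Fin d → Fin d → ℝ))
  TopologicalSpace.Subtype.secondCountableTopology _

/-- The image is again a left Haar probability measure, hence the same one: a compact group is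
unimodular. -/
theorem map_mul_right_haarOrth (h : Orth d) : (haarOrth d).map (· * h) = haarOrth d := by
  have : IsProbabilityMeasure ((haarOrth d).map (· * h)) :=
    Measure.isProbabilityMeasure_map (by fun_prop)
  exact Measure.isHaarMeasure_eq_of_isProbabilityMeasure _ _

theorem integral_mul_right_haarOrth {F : Orth d → ℂ} (hF : Continuous F) (h : Orth d) :
    ∫ g, F (g * h) ∂haarOrth d = ∫ g, F g ∂haarOrth d := by
  conv_rhs => rw [← map_mul_right_haarOrth h]
  rw [integral_map (by fun_prop) hF.aestronglyMeasurable]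

variable {n : Type} [Fintype n] [DecidableEq n]

/-- The action of the orthogonal group on matrices by left multiplication, as isometries. -/
def lmulIso (g : Orth d) (n : Type) [Fintype n] [DecidableEq n] :
    EuclideanSpace ℝ (Fin d × n) ≃ₗᵢ[ℝ] EuclideanSpace ℝ (Fin d × n) where
  toFun x := WithLp.toLp 2 (lmul g.1 x.ofLp)
  invFun x := WithLp.toLp 2 (lmul (g⁻¹).1 x.ofLp)
  map_add' x y := by
    ext ⟨i, j⟩
    simp [lmul_apply, mul_add, Finset.sum_add_distrib]
  map_smul' c x := by
    ext ⟨i, j⟩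
    simp [lmul_apply, Finset.mul_sum, mul_left_comm]
  left_inv x := by
    show WithLp.toLp 2 (lmul (g⁻¹).1 (lmul g.1 x.ofLp)) = x
    rw [lmul_lmul, ← Submonoid.coe_mul, inv_mul_cancel, Submonoid.coe_one, lmul_one]
  right_inv x := by
    show WithLp.toLp 2 (lmul g.1 (lmul (g⁻¹).1 x.ofLp)) = x
    rw [lmul_lmul, ← Submonoid.coe_mul, mul_inv_cancel, Submonoid.coe_one, lmul_one]
  norm_map' x := by
    refine (sq_eq_sq₀ (norm_nonneg _) (norm_nonneg _)).1 ?_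
    show ‖WithLp.toLp 2 (lmul g.1 x.ofLp)‖ ^ 2 = _
    rw [norm_sq_toLp, isLeftInvariant_nsq g.1 g.2, ← norm_sq_toLp]

theorem lmulIso_apply (g : Orth d) (x : EuclideanSpace ℝ (Fin d × n)) :
    lmulIso g n x = WithLp.toLp 2 (lmul g.1 x.ofLp) := rfl

theorem continuous_orth_entry (i j : Fin d) :
    Continuous fun g : Orth d => (g : Matrix (Fin d) (Fin d) ℝ) i j :=
  Continuous.matrix_elem continuous_subtype_val i j

theorem continuous_lmulIso :
    Continuous fun q : Orth d × EuclideanSpace ℝ (Fin d × n) => lmulIso q.1 n q.2 := by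
  simp only [lmulIso_apply]
  refine (PiLp.continuous_toLp 2 _).comp (continuous_pi fun p => ?_)
  have h2 : (fun q : Orth d × EuclideanSpace ℝ (Fin d × n) => lmul q.1.1 q.2.ofLp p) = fun q =>
      ∑ i, q.1.1 p.1 i * q.2 (i, p.2) := funext fun q => lmul_apply _ _ _ _
  rw [h2]
  refine continuous_finsetSum _ fun i _ => ?_
  exact ((continuous_orth_entry p.1 i).comp continuous_fst).mul (by fun_prop)

theorem lmulIso_mul (g h : Orth d) (x : EuclideanSpace ℝ (Fin d × n)) :
    lmulIso (g * h) n x = lmulIso g n (lmulIso h n x) := by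
  rw [lmulIso_apply, lmulIso_apply, lmulIso_apply, lmul_lmul]
  rfl

/-- The average of a function of a matrix over the orthogonal group. -/
def avg (f : EuclideanSpace ℝ (Fin d × n) → ℂ) (x : EuclideanSpace ℝ (Fin d × n)) : ℂ :=
  ∫ g, f (lmulIso g n x) ∂haarOrth d

variable {f : EuclideanSpace ℝ (Fin d × n) → ℂ}

theorem avg_lmul (hf : Continuous f) : IsLeftInvariant fun X : Fin d × n → ℝ =>
    avg f (WithLp.toLp 2 X) := by
  intro h hh X
  have h1 : ∀ g : Orth d, f (lmulIso g n (WithLp.toLp 2 (lmul h X))) =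
      f (lmulIso (g * ⟨h, hh⟩) n (WithLp.toLp 2 X)) := by
    intro g
    rw [lmulIso_mul]
    rfl
  have hc : Continuous fun g : Orth d => f (lmulIso g n (WithLp.toLp 2 X)) :=
    hf.comp (continuous_lmulIso.comp (Continuous.prodMk_left _))
  simp only [avg, h1]
  exact integral_mul_right_haarOrth hc ⟨h, hh⟩

theorem DecayBound.avg {M : ℕ} {C : ℝ} (h : DecayBound M C f) : DecayBound M C (avg f) := by
  intro x
  refine (norm_integral_le_of_norm_le_const (C := C * decay M (nsq x))
    (Filter.Eventually.of_forall fun g => ?_)).trans (by simp)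
  have := h (lmul g.1 x)
  rwa [isLeftInvariant_nsq g.1 g.2] at this

theorem continuous_avg (hf : Continuous f) (hd : RapidDecay f) : Continuous (avg f) := by
  obtain ⟨C, hC⟩ := hd.exists_decayBound 0
  refine continuous_of_dominated (bound := fun _ => C) (fun x => ?_)
    (fun x => Filter.Eventually.of_forall fun g => ?_) (integrable_const _)
    (Filter.Eventually.of_forall fun g => hf.comp (lmulIso g n).continuous)
  · exact (hf.comp (continuous_lmulIso.comp (Continuous.prodMk_left _))).aestronglyMeasurable
  · have := hC (lmul g.1 x.ofLp)
    simpa [decay, lmulIso_apply] using this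

/-- Fourier transformation commutes with linear isometries; exchanging the two integrals needs only
the decay of f. -/
theorem fourier_avg (hf : Continuous f) (hd : RapidDecay f) : 𝓕 (avg f) = avg (𝓕 f) := by
  funext ξ
  obtain ⟨C, hC⟩ := hd.exists_decayBound (Fintype.card (Fin d × n) + 1)
  have hint : Integrable (fun q : EuclideanSpace ℝ (Fin d × n) × Orth d =>
      Complex.exp (((-2 * Real.pi * ⟪q.1, ξ⟫ : ℝ) : ℂ) * Complex.I) * f (lmulIso q.2 n q.1))
      (volume.prod (haarOrth d)) := by
    have h1 : Integrable fun x : EuclideanSpace ℝ (Fin d × n) =>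
        decay (Fintype.card (Fin d × n) + 1) (nsq x.ofLp) :=
      (PiLp.volume_preserving_ofLp (Fin d × n)).integrable_comp_of_integrable
        (integrable_decay_nsq (Nat.lt_succ_self _))
    have h2 := (h1.const_mul C).mul_prod (integrable_const (μ := haarOrth d) (1 : ℝ))
    have hfc := hf.comp (continuous_lmulIso.comp continuous_swap)
    refine h2.mono' (Continuous.aestronglyMeasurable ?_) (Filter.Eventually.of_forall fun q => ?_)
    · exact Continuous.mul (by fun_prop) hfc
    · rw [norm_mul, Complex.norm_exp_ofReal_mul_I, one_mul, mul_one]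
      have := hC (lmul q.2.1 q.1)
      rwa [isLeftInvariant_nsq q.2.1 q.2.2] at this
  have e1 : ∀ x : EuclideanSpace ℝ (Fin d × n),
      Complex.exp (((-2 * Real.pi * ⟪x, ξ⟫ : ℝ) : ℂ) * Complex.I) • avg f x =
      ∫ g, Complex.exp (((-2 * Real.pi * ⟪x, ξ⟫ : ℝ) : ℂ) * Complex.I) * f (lmulIso g n x)
        ∂haarOrth d := fun x => (integral_const_mul _ _).symm
  rw [Real.fourier_eq']
  simp only [e1]
  rw [integral_integral_swap hint]
  refine integral_congr_ae (Filter.Eventually.of_forall fun g => ?_)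
  dsimp only
  rw [← Real.fourier_comp_linearIsometry (lmulIso g n) f ξ, Real.fourier_eq']
  rfl

/-- This is what `IsNice` is for: averages inherit it from bounds on f and 𝓕 f alone, with no
derivatives to control. -/
theorem IsNice.avg (hf : IsNice f) : IsNice (avg f) where
  continuous := continuous_avg hf.continuous hf.rapidDecay
  rapidDecay := rapidDecay_of_decayBound fun M =>
    (hf.rapidDecay.exists_decayBound M).imp fun _ h => h.avg
  rapidDecay_fourier := by
    rw [fourier_avg hf.continuous hf.rapidDecay]
    exact rapidDecay_of_decayBound fun M =>
      (hf.rapidDecay_fourier.exists_decayBound M).imp fun _ h => h.avg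

end Haar

/-! ### Configurations as a base point and difference vectors -/

section ConfEquiv

variable {d : ℕ}

/-- The configuration with first point `c` and difference vectors `Y`. -/
def confEquiv (d : ℕ) : (SqMat d × (Fin d → ℝ)) ≃L[ℝ] Conf d :=
  LinearEquiv.toContinuousLinearEquiv
    { toFun := fun p => WithLp.toLp 2 fun q =>
        Fin.cases (p.2 q.2) (fun i => p.2 q.2 + p.1 (q.2, i)) q.1
      invFun := fun x => (WithLp.toLp 2 fun q => x (q.2.succ, q.1) - x (0, q.1), fun l => x (0, l))
      map_add' := fun p q => by
        ext ⟨i, l⟩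
        refine Fin.cases ?_ (fun i => ?_) i
        · simp
        · simp; ring
      map_smul' := fun c p => by
        ext ⟨i, l⟩
        refine Fin.cases ?_ (fun i => ?_) i
        · simp
        · simp; ring
      left_inv := fun p => by
        refine Prod.ext ?_ ?_
        · ext ⟨l, i⟩; simp
        · funext l; simp
      right_inv := fun x => by
        ext ⟨i, l⟩
        refine Fin.cases ?_ (fun i => ?_) i <;> simp }

@[simp] theorem confEquiv_zero (p : SqMat d × (Fin d → ℝ)) (l : Fin d) :
    confEquiv d p (0, l) = p.2 l := rfl

@[simp] theorem confEquiv_succ (p : SqMat d × (Fin d → ℝ)) (i l : Fin d) :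
    confEquiv d p (i.succ, l) = p.2 l + p.1 (l, i) := rfl

/-- The partition of the coordinates into those of the first point and the others. -/
def confIndex (d : ℕ) : (Fin d × Fin d) ⊕ Fin d ≃ Fin (d + 1) × Fin d where
  toFun := Sum.elim (fun q => (q.2.succ, q.1)) fun l => (0, l)
  invFun := fun q => Fin.cases (Sum.inr q.2) (fun i => Sum.inl (q.2, i)) q.1
  left_inv := by rintro (⟨l, i⟩ | l) <;> rfl
  right_inv := by
    rintro ⟨i, l⟩
    refine Fin.cases ?_ (fun i => ?_) i <;> rfl

/-- A relabelling of coordinates composed with the shear (c, Y) ↦ (c, c + Y). -/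
theorem measurePreserving_confEquiv : MeasurePreserving (confEquiv d) (volume.prod volume) volume := by
  have h0 : MeasurePreserving (Prod.map (WithLp.ofLp : SqMat d → (Fin d × Fin d → ℝ))
      (id : (Fin d → ℝ) → (Fin d → ℝ))) (volume.prod volume) (volume.prod volume) :=
    (PiLp.volume_preserving_ofLp _).prod (MeasurePreserving.id _)
  have h1 : MeasurePreserving (fun p : (Fin d → ℝ) × (Fin d × Fin d → ℝ) =>
      (p.1, (fun q : Fin d × Fin d => p.1 q.1) + p.2)) (volume.prod volume) (volume.prod volume) :=
    (MeasurePreserving.id _).skew_product (g := fun (c : Fin d → ℝ) Y => (fun q : Fin d × Fin d => c q.1) + Y)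
      (Continuous.measurable ((continuous_pi fun q =>
        (continuous_apply q.1).comp continuous_fst).add continuous_snd))
      (Filter.Eventually.of_forall fun c => map_add_left_eq_self _ _)
  have h2 := ((PiLp.volume_preserving_toLp (Fin (d + 1) × Fin d)).comp
    (measurePreserving_join (confIndex d))).comp
    ((Measure.measurePreserving_swap.comp h1).comp (Measure.measurePreserving_swap.comp h0))
  refine (show _ = ⇑(confEquiv d) from ?_) ▸ h2
  funext p
  ext ⟨i, l⟩
  symm
  refine Fin.cases ?_ (fun i => ?_) i
  · exact (join_inr (confIndex d) ((fun q : Fin d × Fin d => p.2 q.1) + p.1.ofLp, p.2) l).symm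
  · exact (join_inl (confIndex d) ((fun q : Fin d × Fin d => p.2 q.1) + p.1.ofLp, p.2) (l, i)).symm

/-- Subtract the first column from the others and expand along the first row. The matrix is
transposed so that these become row operations. -/
theorem rho_confEquiv (p : SqMat d × (Fin d → ℝ)) :
    rho (confEquiv d p) = (mat p.1.ofLp).det := by
  set B : Matrix (Fin (d + 1)) (Fin (d + 1)) ℝ := Matrix.of fun j i =>
    Fin.cases (motive := fun _ => ℝ) (Fin.cases (motive := fun _ => ℝ) 1 (fun l => p.2 l) i)
      (fun j => Fin.cases (motive := fun _ => ℝ) 0 (fun l => p.1 (l, j)) i) j with hB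
  rw [rho, ← Matrix.det_transpose]
  rw [Matrix.det_eq_of_forall_row_eq_smul_add_const (B := B)
    (fun j => Fin.cases (motive := fun _ => ℝ) 0 (fun _ => 1) j) 0 rfl]
  · rw [Matrix.det_succ_column_zero, Fin.sum_univ_succ]
    have h0 : ∀ j : Fin d, B j.succ 0 = 0 := fun j => rfl
    simp only [h0, mul_zero, zero_mul, Finset.sum_const_zero, add_zero]
    have h1 : B 0 0 = 1 := rfl
    rw [h1, ← Matrix.det_transpose (mat p.1.ofLp)]
    simp only [Fin.val_zero, pow_zero, one_mul]
    congr 1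
  · intro j i
    refine Fin.cases ?_ (fun j => ?_) j <;> refine Fin.cases ?_ (fun i => ?_) i <;>
      simp [hB]
    ring

/-- The adjoint of the map that takes a configuration to its difference vectors. -/
def diffAdjoint (d : ℕ) : SqMat d →L[ℝ] Conf d :=
  LinearMap.toContinuousLinearMap
    { toFun := fun v => WithLp.toLp 2 fun q =>
        Fin.cases (-∑ i, v (q.2, i)) (fun i => v (q.2, i)) q.1
      map_add' := fun v w => by
        ext ⟨i, l⟩
        refine Fin.cases ?_ (fun i => ?_) i
        · simp [Finset.sum_add_distrib]; ring
        · simp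
      map_smul' := fun c v => by
        ext ⟨i, l⟩
        refine Fin.cases ?_ (fun i => ?_) i
        · simp [Finset.mul_sum]
        · simp }

theorem diffAdjoint_zero (v : SqMat d) (l : Fin d) :
    diffAdjoint d v (0, l) = -∑ i, v (l, i) := rfl

theorem diffAdjoint_succ (v : SqMat d) (i l : Fin d) : diffAdjoint d v (i.succ, l) = v (l, i) := rfl

theorem inner_diffAdjoint (v : SqMat d) (u : SqMat d) (w : Fin d → ℝ) :
    (⟪diffAdjoint d v, confEquiv d (u, w)⟫ : ℝ) = ⟪v, u⟫ := by
  simp only [PiLp.inner_apply, Fintype.sum_prod_type, Fin.sum_univ_succ, diffAdjoint_zero,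
    diffAdjoint_succ, confEquiv_zero, confEquiv_succ, RCLike.inner_apply, conj_trivial]
  rw [Finset.sum_comm (γ := Fin d), ← Finset.sum_add_distrib]
  refine Finset.sum_congr rfl fun l _ => ?_
  rw [mul_neg, Finset.mul_sum, ← Finset.sum_neg_distrib, ← Finset.sum_add_distrib]
  exact Finset.sum_congr rfl fun i _ => by ring

theorem norm_le_norm_diffAdjoint (v : SqMat d) : ‖v‖ ≤ ‖diffAdjoint d v‖ := by
  refine (sq_le_sq₀ (norm_nonneg _) (norm_nonneg _)).1 ?_
  rw [EuclideanSpace.norm_sq_eq, EuclideanSpace.norm_sq_eq, Fintype.sum_prod_type,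
    Fintype.sum_prod_type, Fin.sum_univ_succ, Finset.sum_comm]
  simp only [diffAdjoint_succ]
  have : 0 ≤ ∑ l, ‖diffAdjoint d v (0, l)‖ ^ 2 := Finset.sum_nonneg fun _ _ => sq_nonneg _
  linarith

/-- Integration over the base point, as a map on Schwartz functions. -/
def integrateBase (d : ℕ) : 𝓢(Conf d, ℂ) →L[ℂ] 𝓢(SqMat d, ℂ) :=
  (FourierTransform.fourierInvCLM ℂ 𝓢(SqMat d, ℂ)).comp
    ((SchwartzMap.compCLMOfAntilipschitz ℂ (K := 1) (g := diffAdjoint d)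
      (diffAdjoint d).hasTemperateGrowth
      ((diffAdjoint d).antilipschitz_of_bound fun v => by
        rw [NNReal.coe_one, one_mul]; exact norm_le_norm_diffAdjoint v)).comp
      (FourierTransform.fourierCLM ℂ 𝓢(Conf d, ℂ)))

/-- `integrateBase` is defined on the Fourier side, by restricting 𝓕 φ to the range of
`diffAdjoint`, so that it maps Schwartz functions continuously to Schwartz functions by
construction. Partial inversion identifies it with the integral. -/
theorem integrateBase_apply (φ : 𝓢(Conf d, ℂ)) (Y : SqMat d) :
    integrateBase d φ Y = ∫ c, φ (confEquiv d (Y, c)) := by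
  have h := partial_fourier_inversion φ.isNice (confEquiv d) measurePreserving_confEquiv
    (diffAdjoint d : SqMat d →ₗ[ℝ] Conf d) inner_diffAdjoint 0 (fun u => by simp) Y
  simp only [inner_zero_left, Complex.ofReal_zero, mul_zero, neg_zero, Complex.exp_zero, one_mul,
    add_zero] at h
  rw [h]
  have h2 : integrateBase d φ Y = 𝓕⁻ (fun v : SqMat d => 𝓕 (φ : Conf d → ℂ) (diffAdjoint d v)) Y := by
    rw [integrateBase, ContinuousLinearMap.comp_apply, FourierTransform.fourierInvCLM_apply,
      SchwartzMap.fourierInv_coe]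
    rw [← SchwartzMap.fourier_coe]
    rfl
  rw [h2, Real.fourierInv_eq']
  refine integral_congr_ae (Filter.Eventually.of_forall fun v => ?_)
  simp only [smul_eq_mul, ContinuousLinearMap.coe_coe]
  congr 2
  push_cast
  ring

end ConfEquiv

/-! ### The analytic family -/

section Linear

variable {α β γ : Type} [Fintype α] [Fintype β] [Fintype γ] [DecidableEq α] [DecidableEq β]
  [DecidableEq γ] {f g : EuclideanSpace ℝ (γ × γ) → ℂ}

theorem integrable_blockFourier_integrand (hf : IsNice f) (e : α ⊕ β ≃ γ) (a : α × α → ℝ)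
    (ξ : β × β → ℝ) : Integrable fun w =>
      chr (-(padBot e ξ ⬝ᵥ w)) * f (WithLp.toLp 2 (join (colE e) (padTop e a, w))) :=
  integrable_mul_comp hf.continuous hf.rapidDecay (by fun_prop)
    (fun w => nsq_le_nsq_join_right (colE e) _ w) (by fun_prop) fun w => (norm_chr _).le

theorem blockFourier_add (hf : IsNice f) (hg : IsNice g) (e : α ⊕ β ≃ γ) (a : α × α → ℝ)
    (ξ : β × β → ℝ) : blockFourier e (fun x => f x + g x) a ξ =
      blockFourier e f a ξ + blockFourier e g a ξ := by
  unfold blockFourier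
  rw [← integral_add (integrable_blockFourier_integrand hf e a ξ)
    (integrable_blockFourier_integrand hg e a ξ)]
  simp only [mul_add]

theorem blockFourier_const_mul (c : ℂ) (e : α ⊕ β ≃ γ) (a : α × α → ℝ)
    (ξ : β × β → ℝ) : blockFourier e (fun x => c * f x) a ξ = c * blockFourier e f a ξ := by
  unfold blockFourier
  rw [← integral_const_mul]
  simp only [mul_left_comm]

variable {d : ℕ} {f g : SqMat d → ℂ}

theorem regInt_add (hf : IsNice f) (hg : IsNice g) (s : ℂ) :
    regInt d (fun x => f x + g x) s = regInt d f s + regInt d g s := by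
  have hs := floor_mem_strip d s
  rw [regInt, regInt, regInt, normInt, normInt, normInt, ← mul_add, detIntegral, detIntegral,
    detIntegral, ← integral_add (integrable_detIntegrand hf _ hs) (integrable_detIntegrand hg _ hs)]
  simp only [detIntegrand, blockFourier_add hf hg, mul_add]

theorem regInt_const_mul (c : ℂ) (s : ℂ) :
    regInt d (fun x => c * f x) s = c * regInt d f s := by
  rw [regInt, regInt, normInt, normInt, mul_left_comm c]
  congr 1
  rw [detIntegral, detIntegral, ← integral_const_mul]
  simp only [detIntegrand, blockFourier_const_mul, mul_left_comm _ c]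

variable {n : Type} [Fintype n] [DecidableEq n]

theorem integrable_comp_lmulIso {f : EuclideanSpace ℝ (Fin d × n) → ℂ} (hf : Continuous f)
    (x : EuclideanSpace ℝ (Fin d × n)) : Integrable (fun g => f (lmulIso g n x)) (haarOrth d) :=
  (hf.comp (continuous_lmulIso.comp (Continuous.prodMk_left x))).integrable_of_hasCompactSupport
    (HasCompactSupport.of_compactSpace _)

theorem avg_add {f g : EuclideanSpace ℝ (Fin d × n) → ℂ} (hf : Continuous f) (hg : Continuous g) :
    avg (fun x => f x + g x) = fun x => avg f x + avg g x :=
  funext fun x => integral_add (integrable_comp_lmulIso hf x) (integrable_comp_lmulIso hg x)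

theorem avg_const_mul {f : EuclideanSpace ℝ (Fin d × n) → ℂ} (c : ℂ) :
    avg (fun x => c * f x) = fun x => c * avg f x :=
  funext fun _ => integral_const_mul _ _

end Linear

section Family

variable {d : ℕ}

/-- A continuous seminorm controlling the decay of a Schwartz function. -/
def decayNorm {κ : Type} [Fintype κ] (M : ℕ) (f : 𝓢(EuclideanSpace ℝ κ, ℂ)) : ℝ :=
  2 ^ (2 * M) * (Finset.Iic (2 * M, 0)).sup (fun m => SchwartzMap.seminorm ℂ m.1 m.2) f

theorem continuous_decayNorm {κ : Type} [Fintype κ] (M : ℕ) :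
    Continuous (decayNorm M : 𝓢(EuclideanSpace ℝ κ, ℂ) → ℝ) := by
  unfold decayNorm
  refine continuous_const.mul (Seminorm.continuous_finsetSup fun m _ => ?_)
  exact (schwartz_withSeminorms ℂ (EuclideanSpace ℝ κ) ℂ).continuous_seminorm m

theorem decayNorm_zero {κ : Type} [Fintype κ] (M : ℕ) :
    decayNorm M (0 : 𝓢(EuclideanSpace ℝ κ, ℂ)) = 0 := by
  simp [decayNorm]

theorem decayBound_decayNorm {κ : Type} [Fintype κ] (M : ℕ) (f : 𝓢(EuclideanSpace ℝ κ, ℂ)) :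
    DecayBound M (decayNorm M f) f := by
  intro x
  have h := SchwartzMap.one_add_le_sup_seminorm_apply (𝕜 := ℂ) (m := (2 * M, 0)) (k := 2 * M)
    (n := 0) le_rfl le_rfl f (WithLp.toLp 2 x)
  rw [norm_iteratedFDeriv_zero] at h
  have h3 : (1 + nsq x) ^ M ≤ (1 + ‖WithLp.toLp 2 x‖) ^ (2 * M) := by
    rw [pow_mul, ← norm_sq_toLp]
    have : 0 ≤ ‖WithLp.toLp 2 x‖ := norm_nonneg _
    gcongr
    nlinarith
  rw [decay, abs_of_nonneg (nsq_nonneg x), ← div_eq_mul_inv, le_div_iff₀' (by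
    have := nsq_nonneg x; positivity)]
  refine (mul_le_mul_of_nonneg_right h3 (norm_nonneg _)).trans h

/-- The bound is built from Schwartz seminorms of f and of 𝓕 f; both depend continuously on f and
vanish at f = 0. -/
theorem continuous_of_bound {κ : Type} [Fintype κ] (T : 𝓢(EuclideanSpace ℝ κ, ℂ) →ₗ[ℂ] ℂ) {M : ℕ}
    {K : ℝ} (hT : ∀ f, ‖T f‖ ≤ K * max (decayNorm M f) (decayNorm M (𝓕 f))) : Continuous T := by
  refine continuous_of_continuousAt_zero T ?_
  rw [ContinuousAt, map_zero]
  refine squeeze_zero_norm hT ?_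
  have hF : Continuous fun f : 𝓢(EuclideanSpace ℝ κ, ℂ) => 𝓕 f :=
    (FourierTransform.fourierCLM ℂ 𝓢(EuclideanSpace ℝ κ, ℂ)).continuous
  have h : Continuous fun f : 𝓢(EuclideanSpace ℝ κ, ℂ) =>
      K * max (decayNorm M f) (decayNorm M (𝓕 f)) :=
    continuous_const.mul ((continuous_decayNorm M).max ((continuous_decayNorm M).comp hF))
  have h0 := h.tendsto 0
  have hF0 : 𝓕 (0 : 𝓢(EuclideanSpace ℝ κ, ℂ)) = 0 :=
    map_zero (FourierTransform.fourierCLM ℂ 𝓢(EuclideanSpace ℝ κ, ℂ))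
  simpa [decayNorm_zero, hF0] using h0

/-- The regularised determinant integral as a linear functional. -/
def regLin (d : ℕ) (s : ℂ) : 𝓢(SqMat d, ℂ) →ₗ[ℂ] ℂ where
  toFun f := (gammaN d d)⁻¹ * regInt d (avg f) s
  map_add' f g := by
    have : avg (⇑(f + g)) = fun x => avg f x + avg g x := avg_add f.continuous g.continuous
    rw [this, regInt_add f.isNice.avg g.isNice.avg, mul_add]
  map_smul' c f := by
    have : avg (⇑(c • f)) = fun x => c * avg f x := avg_const_mul c
    rw [this, regInt_const_mul, mul_left_comm]; rfl

theorem continuous_regLin (d : ℕ) (s : ℂ) : Continuous (regLin d s) := by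
  obtain ⟨M, K, hK, h⟩ := exists_norm_regInt_le d s
  refine continuous_of_bound _ (M := M) (K := ‖(gammaN d d)⁻¹‖ * K) fun f => ?_
  show ‖(gammaN d d)⁻¹ * regInt d (avg f) s‖ ≤ _
  rw [norm_mul, mul_assoc]
  refine mul_le_mul_of_nonneg_left (h _ _ f.isNice.avg ?_ ?_) (norm_nonneg _)
  · exact ((decayBound_decayNorm M f).mono le_rfl (le_max_left _ _)).avg
  · rw [fourier_avg f.continuous f.rapidDecay]
    refine DecayBound.avg ?_
    rw [← SchwartzMap.fourier_coe]
    exact (decayBound_decayNorm M (𝓕 f)).mono le_rfl (le_max_right _ _)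

/-- The analytic family of distributions on configurations. -/
def detDist (d : ℕ) (s : ℂ) : 𝓢'(Conf d, ℂ) :=
  ContinuousLinearMap.toPointwiseConvergenceCLM _ _ _ _ ((⟨regLin d s, continuous_regLin d s⟩ : 𝓢(SqMat d, ℂ) →L[ℂ] ℂ).comp (integrateBase d))

theorem detDist_apply (s : ℂ) (φ : 𝓢(Conf d, ℂ)) :
    detDist d s φ = (gammaN d d)⁻¹ * regInt d (avg (integrateBase d φ)) s := rfl

theorem differentiable_detDist (φ : 𝓢(Conf d, ℂ)) : Differentiable ℂ fun s => detDist d s φ := by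
  simp only [detDist_apply]
  exact (differentiable_regInt (integrateBase d φ).isNice.avg
    (avg_lmul (integrateBase d φ).continuous)).const_mul _

end Family

/-! ### Agreement with the convergent integral for Re s > d - 1 -/

section FullBlock

variable {α β γ : Type} [Fintype α] [Fintype β] [Fintype γ] [DecidableEq α] [DecidableEq β]
  [DecidableEq γ] [IsEmpty β]

/-- The enumeration of the indices when the second block is empty. -/
def fullEquiv (e : α ⊕ β ≃ γ) : α ≃ γ := (Equiv.sumEmpty α β).symm.trans e

/-- Reindexing square matrices when the second block is empty. -/
def fullBlock (e : α ⊕ β ≃ γ) (a : α × α → ℝ) : γ × γ → ℝ :=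
  fun q => a ((fullEquiv e).symm q.1, (fullEquiv e).symm q.2)

theorem measurePreserving_fullBlock (e : α ⊕ β ≃ γ) :
    MeasurePreserving (fullBlock e : (α × α → ℝ) → (γ × γ → ℝ)) := by
  have h := volume_measurePreserving_piCongrLeft (fun _ : γ × γ => ℝ)
    ((fullEquiv e).prodCongr (fullEquiv e))
  refine (show _ = fullBlock e from ?_) ▸ h
  funext a q
  obtain ⟨p, rfl⟩ := ((fullEquiv e).prodCongr (fullEquiv e)).surjective q
  rw [MeasurableEquiv.coe_piCongrLeft, Equiv.piCongrLeft_apply_apply]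
  simp [fullBlock]

theorem det_fullBlock (e : α ⊕ β ≃ γ) (a : α × α → ℝ) :
    (mat (fullBlock e a)).det = (mat a).det :=
  Matrix.det_reindex_self (fullEquiv e) (mat a)

theorem nsq_fullBlock (e : α ⊕ β ≃ γ) (a : α × α → ℝ) : nsq (fullBlock e a) = nsq a := by
  unfold nsq
  rw [← ((fullEquiv e).prodCongr (fullEquiv e)).sum_comp]
  simp [fullBlock]

theorem blockFourier_of_isEmpty (e : α ⊕ β ≃ γ) (f : EuclideanSpace ℝ (γ × γ) → ℂ)
    (a : α × α → ℝ) (ξ : β × β → ℝ) :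
    blockFourier e f a ξ = f (WithLp.toLp 2 (fullBlock e a)) := by
  have h : ∀ w : γ × β → ℝ, join (colE e) (padTop e a, w) = fullBlock e a := by
    intro w
    funext ⟨l, m⟩
    obtain ⟨i | i, rfl⟩ := e.surjective l
    · obtain ⟨j | j, rfl⟩ := e.surjective m
      · rw [join_colE_inl, padTop_inl]
        simp [fullBlock, fullEquiv]
      · exact isEmptyElim j
    · exact isEmptyElim i
  have h2 : ∀ w : γ × β → ℝ, padBot e ξ ⬝ᵥ w = 0 := by
    intro w
    simp [dotProduct]
  unfold blockFourier
  simp only [h, h2, neg_zero, chr_zero, one_mul]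
  simp [volume_pi, measureReal_def]

/-- The case p = 0: no frequency is left, and the integral over the empty block is over a single
point of mass 1. -/
theorem detIntegral_of_isEmpty (e : α ⊕ β ≃ γ) {f : EuclideanSpace ℝ (γ × γ) → ℂ}
    (hf : Continuous f) (z : ℂ) : detIntegral e f z =
      ∫ Y : γ × γ → ℝ, apow (mat Y).det z * f (WithLp.toLp 2 Y) := by
  have h : ∀ q : (α × α → ℝ) × (β × β → ℝ), detIntegrand e f z q =
      apow (mat q.1).det z * f (WithLp.toLp 2 (fullBlock e q.1)) := by
    intro q
    rw [detIntegrand, blockFourier_of_isEmpty, Matrix.det_isEmpty (A := mat q.2)]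
    simp [apow]
  have hm : AEStronglyMeasurable (fun Y : γ × γ → ℝ => apow (mat Y).det z * f (WithLp.toLp 2 Y)) :=
    ((measurable_apow_det z).mul (hf.measurable.comp
      (PiLp.continuous_toLp 2 _).measurable)).aestronglyMeasurable
  rw [← integral_comp_of_measurePreserving (measurePreserving_fullBlock e) hm, detIntegral]
  simp only [h, det_fullBlock]
  rw [Measure.volume_eq_prod, integral_fun_fst (fun a : α × α → ℝ =>
    apow (mat a).det z * f (WithLp.toLp 2 (fullBlock e a)))]
  simp [volume_pi, measureReal_def]

end FullBlock

section Range

variable {d : ℕ}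

theorem exists_integrable_abs_det_rpow_mul_decay_fin (d : ℕ) {r : ℝ} (hr : -1 < r) :
    ∃ N₀, ∀ N, N₀ ≤ N →
      Integrable fun Y : Fin d × Fin d → ℝ => |(mat Y).det| ^ r * decay N (nsq Y) := by
  obtain ⟨N₀, h⟩ := exists_integrable_abs_det_rpow_mul_decay d (Or.inl hr)
  refine ⟨N₀, fun N hN => ?_⟩
  set e := chain d 0 (add_zero d)
  rw [← (measurePreserving_fullBlock e).integrable_comp]
  · refine (h N hN).congr (Filter.Eventually.of_forall fun a => ?_)
    rw [Function.comp_apply, det_fullBlock, nsq_fullBlock]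
  · exact ((measurable_abs_det_rpow r).mul
      ((continuous_decay N).comp continuous_nsq).measurable).aestronglyMeasurable

theorem norm_apow_det_mul_le {N : ℕ} {C : ℝ} {f : SqMat d → ℂ} (hf : DecayBound N C f) (z : ℂ)
    (Y : Fin d × Fin d → ℝ) : ‖apow (mat Y).det z * f (WithLp.toLp 2 Y)‖ ≤
      C * (|(mat Y).det| ^ z.re * decay N (nsq Y)) := by
  rw [norm_mul]
  calc _ ≤ |(mat Y).det| ^ z.re * (C * decay N (nsq Y)) := by
        gcongr
        · exact norm_apow_le _ z
        · exact hf Y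
    _ = _ := by ring

/-- Averaging does not change the integral against a power of the determinant. -/
theorem integral_apow_det_mul_avg {f : SqMat d → ℂ} (hf : Continuous f) (hd : RapidDecay f) {z : ℂ}
    (hz : -1 < z.re) : ∫ Y : Fin d × Fin d → ℝ, apow (mat Y).det z * avg f (WithLp.toLp 2 Y) =
      ∫ Y : Fin d × Fin d → ℝ, apow (mat Y).det z * f (WithLp.toLp 2 Y) := by
  obtain ⟨N, hN⟩ := exists_integrable_abs_det_rpow_mul_decay_fin d hz
  obtain ⟨C, hC⟩ := hd.exists_decayBound N
  have hfm : Measurable fun Y : Fin d × Fin d → ℝ => apow (mat Y).det z * f (WithLp.toLp 2 Y) :=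
    (measurable_apow_det z).mul (hf.measurable.comp (PiLp.continuous_toLp 2 _).measurable)
  have hint : Integrable (fun q : (Fin d × Fin d → ℝ) × Orth d =>
      apow (mat q.1).det z * f (lmulIso q.2 (Fin d) (WithLp.toLp 2 q.1)))
      (volume.prod (haarOrth d)) := by
    have h2 := ((hN N le_rfl).const_mul C).mul_prod (integrable_const (μ := haarOrth d) (1 : ℝ))
    have hc : Continuous fun q : (Fin d × Fin d → ℝ) × Orth d =>
        f (lmulIso q.2 (Fin d) (WithLp.toLp 2 q.1)) :=
      hf.comp (continuous_lmulIso.comp (continuous_snd.prodMk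
        ((PiLp.continuous_toLp 2 _).comp continuous_fst)))
    refine h2.mono' (((measurable_apow_det z).comp measurable_fst).mul
      hc.measurable).aestronglyMeasurable (Filter.Eventually.of_forall fun q => ?_)
    have := norm_apow_det_mul_le hC z (lmul q.2.1 q.1)
    rw [apow_det_lmul q.2.2, abs_det_lmul q.2.2, isLeftInvariant_nsq q.2.1 q.2.2] at this
    simpa [lmulIso_apply] using this
  have e1 : ∀ Y : Fin d × Fin d → ℝ, apow (mat Y).det z * avg f (WithLp.toLp 2 Y) =
      ∫ g, apow (mat Y).det z * f (lmulIso g (Fin d) (WithLp.toLp 2 Y)) ∂haarOrth d :=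
    fun Y => (integral_const_mul _ _).symm
  simp only [e1]
  rw [integral_integral_swap hint]
  have e2 : ∀ g : Orth d, ∫ Y : Fin d × Fin d → ℝ, apow (mat Y).det z *
      f (lmulIso g (Fin d) (WithLp.toLp 2 Y)) =
      ∫ Y : Fin d × Fin d → ℝ, apow (mat Y).det z * f (WithLp.toLp 2 Y) := by
    intro g
    rw [← integral_comp_of_measurePreserving (measurePreserving_lmul g.2) hfm.aestronglyMeasurable]
    simp only [apow_det_lmul g.2]
    rfl
  simp only [e2]
  simp

/-- This half-plane is the one of k = d, p = 0, where the regularised integral is the plain one;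
there the average over O(d) can be dropped. -/
theorem regInt_avg {f : SqMat d → ℂ} (hf : IsNice f) {s : ℂ} (hs : (d : ℝ) - 1 < s.re) :
    (gammaN d d)⁻¹ * regInt d (avg f) s = (gammaN d s)⁻¹ *
      ∫ Y : Fin d × Fin d → ℝ, apow (mat Y).det (s - d) * f (WithLp.toLp 2 Y) := by
  rw [regInt_eq hf.avg (avg_lmul hf.continuous) d 0 (add_zero d) (Or.inl hs) (Or.inr rfl), normInt,
    detIntegral_of_isEmpty _ hf.avg.continuous, integral_apow_det_mul_avg hf.continuous hf.rapidDecay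
      (by simp only [Complex.sub_re, Complex.natCast_re]; linarith)]
  have h0 : ∀ z, gammaN 0 z = 1 := fun z => by simp [gammaN]
  rw [h0, h0, inv_one, mul_one, mul_one, mul_assoc, inv_mul_cancel_left₀ (gammaN_self_ne_zero d)]

/-- Decay of a Schwartz function on configurations in terms of the base point and the difference
vectors. -/
theorem exists_norm_confEquiv_le (φ : 𝓢(Conf d, ℂ)) (N : ℕ) : ∃ C, 0 ≤ C ∧
    ∀ p : SqMat d × (Fin d → ℝ),
      ‖φ (confEquiv d p)‖ ≤ C * (decay N (nsq p.1.ofLp) * decay N (nsq p.2)) := by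
  obtain ⟨C, hC⟩ := φ.rapidDecay.exists_decayBound (N + N)
  obtain ⟨K, hK0, hK⟩ := exists_norm_le_of_equiv (confEquiv d)
  refine ⟨C * (1 + K ^ 2) ^ N, mul_nonneg hC.nonneg (by positivity), fun p => ?_⟩
  set x := confEquiv d p with hx
  have h1 : nsq p.1.ofLp ≤ K ^ 2 * nsq x.ofLp := by
    have := norm_sq_toLp p.1.ofLp
    have h3 := norm_sq_toLp x.ofLp
    rw [WithLp.toLp_ofLp] at this h3
    rw [← this, ← h3, ← mul_pow]
    exact pow_le_pow_left₀ (norm_nonneg _) ((norm_fst_le p).trans (hK p)) 2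
  have h2 : nsq p.2 ≤ nsq x.ofLp := by
    unfold nsq
    rw [Fintype.sum_prod_type, Fin.sum_univ_succ]
    have : 0 ≤ ∑ i : Fin d, ∑ l, x.ofLp (i.succ, l) ^ 2 :=
      Finset.sum_nonneg fun _ _ => Finset.sum_nonneg fun _ _ => sq_nonneg _
    have h4 : ∀ l, x.ofLp (0, l) = p.2 l := fun l => rfl
    simp only [h4]
    linarith
  have h3 := hC x.ofLp
  rw [WithLp.toLp_ofLp, decay_add] at h3
  have q1 := nsq_nonneg p.1.ofLp
  have q2 := nsq_nonneg p.2
  have q3 := nsq_nonneg x.ofLp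
  have h4 : decay N (nsq x.ofLp) ≤ (1 + K ^ 2) ^ N * decay N (nsq p.1.ofLp) := by
    unfold decay
    rw [abs_of_nonneg q3, abs_of_nonneg q1, ← div_eq_mul_inv, inv_eq_one_div,
      div_le_div_iff₀ (by positivity) (by positivity), one_mul, ← mul_pow]
    gcongr
    nlinarith [mul_nonneg (sq_nonneg K) q3, sq_nonneg K]
  have h5 : decay N (nsq x.ofLp) ≤ decay N (nsq p.2) := decay_le_decay N q2 h2
  refine h3.trans ?_
  have hC0 := hC.nonneg
  have d1 := decay_pos N (nsq x.ofLp)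
  have d2 := decay_pos N (nsq p.1.ofLp)
  calc C * (decay N (nsq x.ofLp) * decay N (nsq x.ofLp))
      ≤ C * (((1 + K ^ 2) ^ N * decay N (nsq p.1.ofLp)) * decay N (nsq p.2)) := by gcongr
    _ = _ := by ring

/-- Only the formula for Re s > d - 1 remains: the volume preserving coordinates (Y, c) turn ρ into
det Y, and Fubini integrates out c. -/
theorem isDetFamily_detDist (d : ℕ) : IsDetFamily d (detDist d) := by
  refine ⟨differentiable_detDist, fun s hs φ => ?_⟩
  have hz : -1 < (s - d).re := by simp only [Complex.sub_re, Complex.natCast_re]; linarith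
  have hemb : MeasurableEmbedding (confEquiv d) :=
    (confEquiv d).toHomeomorph.measurableEmbedding
  have hmp := measurePreserving_confEquiv (d := d)
  have e1 : ∀ p : SqMat d × (Fin d → ℝ), (gammaN d s)⁻¹ *
      ((|rho (confEquiv d p)| : ℝ) : ℂ) ^ (s - d) * φ (confEquiv d p) =
      (gammaN d s)⁻¹ * (apow (mat p.1.ofLp).det (s - d) * φ (confEquiv d p)) := by
    intro p
    rw [rho_confEquiv, mul_assoc]
    rfl
  have hI : Integrable (fun p : SqMat d × (Fin d → ℝ) =>
      apow (mat p.1.ofLp).det (s - d) * φ (confEquiv d p)) (volume.prod volume) := by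
    obtain ⟨N₀, hN⟩ := exists_integrable_abs_det_rpow_mul_decay_fin d hz
    set N := N₀ + d + 1
    obtain ⟨C, hC0, hC⟩ := exists_norm_confEquiv_le φ N
    have i1 := (PiLp.volume_preserving_ofLp (Fin d × Fin d)).integrable_comp_of_integrable
      (hN N (by omega))
    have i2 := (i1.mul_prod (integrable_decay_nsq (κ := Fin d) (N := N)
      (by rw [Fintype.card_fin]; omega))).const_mul C
    refine i2.mono' (Measurable.aestronglyMeasurable ?_) (Filter.Eventually.of_forall fun p => ?_)
    · exact (((measurable_apow_det _).comp (PiLp.continuous_ofLp 2 _).measurable).comp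
        measurable_fst).mul (φ.continuous.comp (confEquiv d).continuous).measurable
    · rw [norm_mul]
      calc _ ≤ |(mat p.1.ofLp).det| ^ (s - d).re *
            (C * (decay N (nsq p.1.ofLp) * decay N (nsq p.2))) := by
            gcongr
            · exact norm_apow_le _ _
            · exact hC p
        _ = _ := by simp only [Function.comp_apply]; ring
  constructor
  · rw [← hmp.integrable_comp_emb hemb]
    exact (hI.const_mul _).congr (Filter.Eventually.of_forall fun p => (e1 p).symm)
  · rw [detDist_apply, regInt_avg (integrateBase d φ).isNice hs, ← hmp.integral_comp hemb]
    simp only [e1]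
    rw [integral_const_mul, integral_prod _ hI]
    congr 1
    have h2 := (PiLp.volume_preserving_ofLp (Fin d × Fin d)).integral_comp
      (MeasurableEquiv.toLp 2 (Fin d × Fin d → ℝ)).symm.measurableEmbedding
      (fun Y => apow (mat Y).det (s - d) * integrateBase d φ (WithLp.toLp 2 Y))
    rw [← h2]
    refine integral_congr_ae (Filter.Eventually.of_forall fun Y => ?_)
    dsimp only
    rw [WithLp.toLp_ofLp, integrateBase_apply, integral_const_mul]

theorem detFamily_eq (d : ℕ) : detFamily d = detDist d := by
  have h : ∃ A, IsDetFamily d A := ⟨_, isDetFamily_detDist d⟩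
  have h2 : detFamily d = h.choose := by
    unfold detFamily
    exact dif_pos h
  rw [h2]
  exact h.choose_spec.unique (isDetFamily_detDist d)

theorem isDetFamily_detFamily (d : ℕ) : IsDetFamily d (detFamily d) := by
  rw [detFamily_eq]; exact isDetFamily_detDist d

end Range

/-! ### Projections of the surface measure of the sphere -/

section Polar

variable {E : Type*} [NormedAddCommGroup E] [InnerProductSpace ℝ E] [FiniteDimensional ℝ E]
  [MeasurableSpace E] [BorelSpace E]

theorem lintegral_polar [Nontrivial E] {f : E → ℝ≥0∞} (hf : Measurable f) :
    ∫⁻ x, f x = ∫⁻ θ, (∫⁻ r in Ioi (0 : ℝ),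
      ENNReal.ofReal (r ^ (Module.finrank ℝ E - 1)) * f (r • (θ : E))) ∂sphereMeasure E := by
  have h1 : ∫⁻ x, f x = ∫⁻ x : ({0}ᶜ : Set E), f x ∂((volume : Measure E).comap (↑)) := by
    rw [lintegral_subtype_comap (measurableSet_singleton _).compl, restrict_compl_singleton]
  have hg : Measurable fun q : Metric.sphere (0 : E) 1 × Ioi (0 : ℝ) => f (q.2.1 • q.1.1) :=
    hf.comp (by fun_prop)
  have h2 := (volume : Measure E).measurePreserving_homeomorphUnitSphereProd.lintegral_comp hg
  rw [h1]
  have h3 : ∀ x : ({0}ᶜ : Set E), f ((homeomorphUnitSphereProd E x).2.1 •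
      (homeomorphUnitSphereProd E x).1.1) = f x := by
    intro x
    have : ((homeomorphUnitSphereProd E).symm (homeomorphUnitSphereProd E x)).1 = x.1 := by simp
    rw [homeomorphUnitSphereProd_symm_apply_coe] at this
    rw [this]
  simp only [h3] at h2
  rw [h2, lintegral_prod _ hg.aemeasurable]
  refine lintegral_congr fun θ => ?_
  rw [Measure.volumeIoiPow, lintegral_withDensity_eq_lintegral_mul _ (by fun_prop)
    (g := fun r : Ioi (0 : ℝ) => f (r.1 • (θ : E))) (hf.comp (by fun_prop : Measurable fun r : Ioi (0 : ℝ) => r.1 • (θ : E)))]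
  exact lintegral_subtype_comap measurableSet_Ioi
    (fun r : ℝ => ENNReal.ofReal (r ^ (Module.finrank ℝ E - 1)) * f (r • (θ : E)))

theorem lintegral_norm_polar [Nontrivial E] {f : ℝ → ℝ≥0∞} (hf : Measurable f) :
    ∫⁻ x : E, f ‖x‖ = sphereMeasure E univ *
      ∫⁻ r in Ioi (0 : ℝ), ENNReal.ofReal (r ^ (Module.finrank ℝ E - 1)) * f r := by
  rw [lintegral_polar (f := fun x : E => f ‖x‖) (hf.comp measurable_norm)]
  have : ∀ θ : Metric.sphere (0 : E) 1, ∫⁻ r in Ioi (0 : ℝ),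
      ENNReal.ofReal (r ^ (Module.finrank ℝ E - 1)) * f ‖r • (θ : E)‖ =
      ∫⁻ r in Ioi (0 : ℝ), ENNReal.ofReal (r ^ (Module.finrank ℝ E - 1)) * f r := by
    intro θ
    refine setLIntegral_congr_fun measurableSet_Ioi fun r hr => ?_
    have hr0 : (0 : ℝ) < r := hr
    simp [norm_smul, abs_of_pos hr0]
  simp only [this]
  rw [lintegral_const, mul_comm]

theorem lintegral_inv_smul {r : ℝ} (hr : 0 < r) {f : E → ℝ≥0∞} (hf : Measurable f) :
    ∫⁻ x, f (r⁻¹ • x) = ENNReal.ofReal (r ^ Module.finrank ℝ E) * ∫⁻ x, f x := by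
  have h := Measure.map_addHaar_smul (volume : Measure E) (inv_ne_zero hr.ne')
  rw [← lintegral_map hf (by fun_prop), h, lintegral_smul_measure, smul_eq_mul, inv_pow, inv_inv,
    abs_of_pos (by positivity)]

/-- The density `(1 - s)_+^e`, with the value `0 ^ e` at `s = 1`. -/
def capWeight (e s : ℝ) : ℝ := if s ≤ 1 then (1 - s) ^ e else 0

theorem measurable_capWeight (e : ℝ) : Measurable (capWeight e) :=
  Measurable.ite measurableSet_Iic (by fun_prop) measurable_const

theorem capWeight_nonneg (e s : ℝ) : 0 ≤ capWeight e s := by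
  unfold capWeight
  split_ifs with h
  · exact Real.rpow_nonneg (by linarith) _
  · exact le_rfl

theorem capWeight_le_one {e s : ℝ} (he : 0 ≤ e) (hs : 0 ≤ s) : capWeight e s ≤ 1 := by
  unfold capWeight
  split_ifs with h
  · exact Real.rpow_le_one (by linarith) (by linarith) he
  · exact zero_le_one

/-- The substitution t = √(r² - s²). Its Jacobian r/t turns t^{n-1} dt into r^{n-1} (1 -
s²/r²)^{(n-2)/2} dr, with the cut-off of `capWeight` encoding r ≥ s. -/
theorem lintegral_pow_mul_sqrt_add {n : ℕ} (hn : 1 ≤ n) {s : ℝ} (hs : 0 ≤ s) (G : ℝ → ℝ≥0∞) :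
    ∫⁻ t in Ioi (0 : ℝ), ENNReal.ofReal (t ^ (n - 1)) * G (√(t ^ 2 + s ^ 2)) =
      ∫⁻ r in Ioi (0 : ℝ), ENNReal.ofReal (r ^ (n - 1)) *
        (ENNReal.ofReal (capWeight (((n : ℝ) - 2) / 2) (s ^ 2 / r ^ 2)) * G r) := by
  have himg : (fun r : ℝ => √(r ^ 2 - s ^ 2)) '' Ioi s = Ioi 0 := by
    ext t
    constructor
    · rintro ⟨r, hr, rfl⟩
      have : s < r := hr
      exact Real.sqrt_pos.2 (by nlinarith)
    · intro ht
      have ht0 : 0 < t := ht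
      refine ⟨√(t ^ 2 + s ^ 2), Real.lt_sqrt_of_sq_lt (by nlinarith), ?_⟩
      dsimp only
      rw [Real.sq_sqrt (by positivity), add_sub_cancel_right, Real.sqrt_sq ht0.le]
  have hder : ∀ r ∈ Ioi s, HasDerivWithinAt (fun r : ℝ => √(r ^ 2 - s ^ 2))
      (r / √(r ^ 2 - s ^ 2)) (Ioi s) r := by
    intro r hr
    have hr' : s < r := hr
    have h0 : r ^ 2 - s ^ 2 ≠ 0 := by nlinarith
    have := (((hasDerivAt_pow 2 r).sub_const (s ^ 2)).sqrt h0).hasDerivWithinAt (s := Ioi s)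
    refine this.congr_deriv ?_
    have : √(r ^ 2 - s ^ 2) ≠ 0 := (Real.sqrt_pos.2 (by nlinarith)).ne'
    field_simp
    norm_num
  have hinj : InjOn (fun r : ℝ => √(r ^ 2 - s ^ 2)) (Ioi s) := by
    intro a ha b hb hab
    have ha' : s < a := ha
    have hb' : s < b := hb
    have := (Real.sqrt_inj (by nlinarith) (by nlinarith)).1 hab
    exact (sq_eq_sq₀ (by linarith) (by linarith)).1 (by linarith)
  have hR : ∫⁻ r in Ioi (0 : ℝ), ENNReal.ofReal (r ^ (n - 1)) *
      (ENNReal.ofReal (capWeight (((n : ℝ) - 2) / 2) (s ^ 2 / r ^ 2)) * G r) =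
      ∫⁻ r in Ici s, (Ioi (0 : ℝ)).indicator (fun r => ENNReal.ofReal (r ^ (n - 1)) *
      (ENNReal.ofReal (capWeight (((n : ℝ) - 2) / 2) (s ^ 2 / r ^ 2)) * G r)) r := by
    rw [← lintegral_indicator measurableSet_Ioi, ← lintegral_indicator measurableSet_Ici]
    refine lintegral_congr fun r => ?_
    by_cases hr : r ∈ Ici s
    · rw [indicator_of_mem hr]
    · rw [indicator_of_notMem hr]
      by_cases hr0 : r ∈ Ioi (0 : ℝ)
      · rw [indicator_of_mem hr0]
        have h1 : r < s := not_le.1 hr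
        have h2 : (0 : ℝ) < r := hr0
        have : ¬ s ^ 2 / r ^ 2 ≤ 1 := by
          rw [not_le, one_lt_div (by positivity)]
          nlinarith
        simp [capWeight, this]
      · rw [indicator_of_notMem hr0]
  rw [hR, setLIntegral_congr Ioi_ae_eq_Ici.symm, ← himg,
    lintegral_image_eq_lintegral_abs_deriv_mul measurableSet_Ioi hder hinj, himg]
  refine setLIntegral_congr_fun measurableSet_Ioi fun r hr => ?_
  have hr' : s < r := hr
  have hr0 : 0 < r := hs.trans_lt hr'
  have hy : 0 < r ^ 2 - s ^ 2 := by nlinarith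
  rw [indicator_of_mem (show r ∈ Ioi (0 : ℝ) from hr0), Real.sq_sqrt hy.le, sub_add_cancel,
    Real.sqrt_sq hr0.le, ← mul_assoc, ← mul_assoc, ← ENNReal.ofReal_mul (abs_nonneg _),
    ← ENNReal.ofReal_mul (by positivity)]
  congr 2
  have hle : s ^ 2 / r ^ 2 ≤ 1 := by
    rw [div_le_one (by positivity)]; nlinarith
  rw [capWeight, if_pos hle, abs_of_pos (by positivity)]
  have e1 : 1 - s ^ 2 / r ^ 2 = (r ^ 2 - s ^ 2) / r ^ 2 := by field_simp
  have hn1 : ((n - 1 : ℕ) : ℝ) = n - 1 := by rw [Nat.cast_sub hn]; simp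
  have f1 : √(r ^ 2 - s ^ 2) ^ (n - 1) = (r ^ 2 - s ^ 2) ^ (1 / 2 * ((n : ℝ) - 1)) := by
    rw [Real.sqrt_eq_rpow, ← Real.rpow_natCast, ← Real.rpow_mul hy.le, hn1]
  have f2 : r ^ (n - 1) = r ^ ((n : ℝ) - 1) := by rw [← Real.rpow_natCast, hn1]
  have f3 : (r ^ 2) ^ (((n : ℝ) - 2) / 2) = r ^ (2 * (((n : ℝ) - 2) / 2)) := by
    rw [← Real.rpow_natCast r 2, ← Real.rpow_mul hr0.le]; norm_num
  rw [e1, Real.div_rpow hy.le (by positivity), f1, f2, f3, Real.sqrt_eq_rpow]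
  have e2 : (r ^ 2 - s ^ 2) ^ (1 / 2 * ((n : ℝ) - 1)) =
      (r ^ 2 - s ^ 2) ^ (((n : ℝ) - 2) / 2) * (r ^ 2 - s ^ 2) ^ (1 / 2 : ℝ) := by
    rw [← Real.rpow_add hy]; congr 1; ring
  have e3 : r ^ ((n : ℝ) - 1) = r ^ (2 * (((n : ℝ) - 2) / 2)) * r := by
    rw [← Real.rpow_add_one hr0.ne']; congr 1; ring
  have p1 : (r ^ 2 - s ^ 2) ^ (1 / 2 : ℝ) ≠ 0 := (Real.rpow_pos_of_pos hy _).ne'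
  have p2 : r ^ (2 * (((n : ℝ) - 2) / 2)) ≠ 0 := (Real.rpow_pos_of_pos hr0 _).ne'
  rw [e2, e3]
  field_simp

end Polar

section SphereProjection

variable {E : Type*} [NormedAddCommGroup E] [InnerProductSpace ℝ E] [FiniteDimensional ℝ E]
  [MeasurableSpace E] [BorelSpace E]

theorem lintegral_orthogonal (U : Submodule ℝ E) {f : E → ℝ≥0∞} (hf : Measurable f) :
    ∫⁻ x, f x = ∫⁻ b : Uᗮ, ∫⁻ u : U, f (u + b) := by
  have h := U.measurePreserving_measurableEquivProd (0 : E)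
  rw [InnerProductSpace.euclideanHausdorffMeasure_eq_volume] at h
  have h2 := h.symm.lintegral_comp hf
  rw [← h2, Measure.volume_eq_prod, lintegral_prod_symm]
  · simp
  · exact (hf.comp h.symm.measurable).aemeasurable

/-- The projection of the surface measure of the sphere to a subspace `Uᗮ`. -/
theorem lintegral_sphere_projection (U : Submodule ℝ E) [Nontrivial U] {Ψ : Uᗮ → ℝ≥0∞}
    (hΨ : Measurable Ψ) :
    ∫⁻ θ, Ψ (Uᗮ.orthogonalProjectionOnto (θ : E)) ∂sphereMeasure E =
      sphereMeasure U univ * ∫⁻ b, ENNReal.ofReal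
        (capWeight (((Module.finrank ℝ U : ℝ) - 2) / 2) (‖b‖ ^ 2)) * Ψ b := by
  have hE : Nontrivial E := by
    obtain ⟨x, hx⟩ := exists_ne (0 : U)
    exact ⟨⟨x, 0, fun h => hx (Subtype.ext h)⟩⟩
  set n := Module.finrank ℝ U with hn
  have hn1 : 1 ≤ n := Module.finrank_pos
  set N := Module.finrank ℝ E with hN
  have hnm : n + Module.finrank ℝ Uᗮ = N := U.finrank_add_finrank_orthogonal
  set e : ℝ := ((n : ℝ) - 2) / 2 with he
  -- The radial mass of the unit ball; positive and finite, it is cancelled at the end.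
  set κ : ℝ≥0∞ := ∫⁻ r in Ioo (0 : ℝ) 1, ENNReal.ofReal (r ^ (N - 1)) with hκ
  have hκ0 : κ ≠ 0 := by
    intro h0
    rw [hκ, lintegral_eq_zero_iff (by fun_prop)] at h0
    have h1 : ∀ᵐ r ∂(volume.restrict (Ioo (0 : ℝ) 1)), False := by
      filter_upwards [h0, ae_restrict_mem measurableSet_Ioo] with r hr hr2
      have : 0 < r ^ (N - 1) := pow_pos hr2.1 _
      simp only [Pi.zero_apply, ENNReal.ofReal_eq_zero] at hr
      linarith
    have h2 := ae_iff.1 h1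
    simp at h2
  have hκt : κ ≠ ⊤ := by
    refine ne_top_of_le_ne_top (b := ∫⁻ r in Ioo (0 : ℝ) 1, 1) (by simp) ?_
    refine setLIntegral_mono measurable_const fun r hr => ?_
    exact ENNReal.ofReal_le_one.2 (pow_le_one₀ hr.1.le hr.2.le)
  -- Integrate Ψ(P x/‖x‖) over the unit ball in two ways: in polar coordinates of E, and after
  -- splitting off Uᗮ with polar coordinates in U.
  set G : Uᗮ → ℝ → ℝ≥0∞ := fun b r => (Iio (1 : ℝ)).indicator (fun r => Ψ (r⁻¹ • b)) r with hG
  have hGm : Measurable fun q : Uᗮ × ℝ => G q.1 q.2 := by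
    have h1 : Measurable fun q : Uᗮ × ℝ => Ψ (q.2⁻¹ • q.1) := hΨ.comp (by fun_prop)
    exact h1.indicator (s := Prod.snd ⁻¹' Iio (1 : ℝ)) (measurableSet_Iio.preimage measurable_snd)
  set P := Uᗮ.orthogonalProjectionOnto with hP
  have hGP : Measurable fun x : E => G (P x) ‖x‖ :=
    hGm.comp (P.continuous.measurable.prodMk measurable_norm)
  have A : ∫⁻ x, G (P x) ‖x‖ = κ * ∫⁻ θ, Ψ (P (θ : E)) ∂sphereMeasure E := by
    rw [lintegral_polar hGP, mul_comm, ← lintegral_mul_const' _ _ hκt]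
    refine lintegral_congr fun θ => ?_
    rw [hκ, ← lintegral_const_mul _ (by fun_prop), ← lintegral_indicator measurableSet_Ioi,
      ← lintegral_indicator measurableSet_Ioo]
    refine lintegral_congr fun r => ?_
    by_cases hr : r ∈ Ioi (0 : ℝ)
    · have hr0 : (0 : ℝ) < r := hr
      rw [indicator_of_mem hr]
      have h1 : ‖r • (θ : E)‖ = r := by simp [norm_smul, abs_of_pos hr0]
      by_cases hr1 : r < 1
      · rw [indicator_of_mem (show r ∈ Ioo (0 : ℝ) 1 from ⟨hr0, hr1⟩), h1, hG]
        dsimp only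
        rw [indicator_of_mem (show r ∈ Iio (1 : ℝ) from hr1), map_smul, inv_smul_smul₀ hr0.ne',
          mul_comm]
      · rw [indicator_of_notMem (fun h => hr1 h.2), h1, hG]
        dsimp only
        rw [indicator_of_notMem (show r ∉ Iio (1 : ℝ) from hr1), mul_zero]
    · rw [indicator_of_notMem hr, indicator_of_notMem fun h => hr h.1]
  have B : ∫⁻ x, G (P x) ‖x‖ = ∫⁻ b : Uᗮ, sphereMeasure U univ *
      ∫⁻ r in Ioi (0 : ℝ), ENNReal.ofReal (r ^ (n - 1)) *
        (ENNReal.ofReal (capWeight e (‖b‖ ^ 2 / r ^ 2)) * G b r) := by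
    rw [lintegral_orthogonal U hGP]
    refine lintegral_congr fun b => ?_
    have h1 : ∀ u : U, G (P (u + b)) ‖(u : E) + b‖ = G b (√(‖u‖ ^ 2 + ‖b‖ ^ 2)) := by
      intro u
      have e1 : P ((u : E) + b) = b := by
        rw [map_add, hP, Submodule.orthogonalProjectionOnto_mem_subspace_eq_self,
          Submodule.orthogonalProjectionOnto_apply_of_mem_orthogonal, zero_add]
        exact Submodule.le_orthogonal_orthogonal U u.2
      have e2 : ‖(u : E) + b‖ = √(‖u‖ ^ 2 + ‖b‖ ^ 2) := by
        have h3 := norm_add_sq_eq_norm_sq_add_norm_sq_real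
          (Submodule.inner_right_of_mem_orthogonal u.2 b.2)
        rw [eq_comm, Real.sqrt_eq_iff_mul_self_eq (by positivity) (norm_nonneg _), h3, sq, sq]
        rfl
      rw [e1, e2]
    simp only [h1]
    have h2 : Measurable fun t : ℝ => G b (√(t ^ 2 + ‖b‖ ^ 2)) :=
      hGm.comp (measurable_const.prodMk (by fun_prop))
    rw [lintegral_norm_polar (E := U) h2, lintegral_pow_mul_sqrt_add hn1 (norm_nonneg b)]
  have C : ∫⁻ x, G (P x) ‖x‖ = κ * (sphereMeasure U univ * ∫⁻ b, ENNReal.ofReal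
        (capWeight e (‖b‖ ^ 2)) * Ψ b) := by
    have hcm : Measurable (capWeight e) := measurable_capWeight e
    have hm2 : Measurable fun q : Uᗮ × ℝ => ENNReal.ofReal (q.2 ^ (n - 1)) *
        (ENNReal.ofReal (capWeight e (‖q.1‖ ^ 2 / q.2 ^ 2)) * G q.1 q.2) := by fun_prop
    rw [B, lintegral_const_mul' _ _ (measure_ne_top _ _), lintegral_lintegral_swap hm2.aemeasurable,
      mul_left_comm]
    congr 1
    rw [mul_comm κ, hκ, ← lintegral_const_mul _ (by fun_prop), ← lintegral_indicator measurableSet_Ioi,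
      ← lintegral_indicator measurableSet_Ioo]
    refine lintegral_congr fun r => ?_
    by_cases hr : r ∈ Ioi (0 : ℝ)
    · have hr0 : (0 : ℝ) < r := hr
      rw [indicator_of_mem hr]
      by_cases hr1 : r < 1
      · rw [indicator_of_mem (show r ∈ Ioo (0 : ℝ) 1 from ⟨hr0, hr1⟩)]
        -- Scaling b by r contributes r^{dim Uᗮ}, which completes r^{n-1} to r^{N-1}.
        have h4 : ∀ b : Uᗮ, ENNReal.ofReal (r ^ (n - 1)) *
            (ENNReal.ofReal (capWeight e (‖b‖ ^ 2 / r ^ 2)) * G b r) =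
            ENNReal.ofReal (r ^ (n - 1)) * (fun b : Uᗮ => ENNReal.ofReal
              (capWeight e (‖b‖ ^ 2)) * Ψ b) (r⁻¹ • b) := by
          intro b
          simp only [hG]
          rw [indicator_of_mem (show r ∈ Iio (1 : ℝ) from hr1), norm_smul, mul_pow, norm_inv,
            Real.norm_of_nonneg hr0.le, inv_pow, div_eq_inv_mul]
        simp only [h4]
        rw [lintegral_const_mul _ (by fun_prop), lintegral_inv_smul hr0
            (f := fun b : Uᗮ => ENNReal.ofReal (capWeight e (‖b‖ ^ 2)) * Ψ b) (by fun_prop), ← mul_assoc,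
          ← ENNReal.ofReal_mul (by positivity), ← pow_add, mul_comm]
        congr 3
        omega
      · rw [indicator_of_notMem (fun h => hr1 h.2)]
        simp [hG, hr1]
    · rw [indicator_of_notMem hr, indicator_of_notMem fun h => hr h.1]
  rw [A] at C
  exact (ENNReal.mul_right_inj hκ0 hκt).1 C

end SphereProjection

/-! ### Convolution of Lebesgue measure on a subspace with the sphere -/

section SphereConvolution

variable {E : Type*} [NormedAddCommGroup E] [InnerProductSpace ℝ E] [FiniteDimensional ℝ E]
  [MeasurableSpace E] [BorelSpace E]

/-- The component of θ along U is absorbed by translation in U, so only the projection of the sphere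
to Uᗮ enters. -/
theorem lintegral_sphere_add (U : Submodule ℝ E) [Nontrivial U] {f : E → ℝ≥0∞}
    (hf : Measurable f) :
    ∫⁻ θ, (∫⁻ u : U, f (u + (θ : E))) ∂sphereMeasure E =
      sphereMeasure U univ * ∫⁻ x, ENNReal.ofReal (capWeight
        (((Module.finrank ℝ U : ℝ) - 2) / 2) (‖Uᗮ.orthogonalProjectionOnto x‖ ^ 2)) * f x := by
  have hm : Measurable fun q : Uᗮ × U => f (q.2 + q.1) := hf.comp (by fun_prop)
  have h1 : ∀ θ : E, ∫⁻ u : U, f (u + θ) =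
      ∫⁻ u : U, f (u + (Uᗮ.orthogonalProjectionOnto θ : E)) := by
    intro θ
    rw [← lintegral_add_right_eq_self (fun u : U => f (u + (Uᗮ.orthogonalProjectionOnto θ : E)))
      (U.orthogonalProjectionOnto θ)]
    refine lintegral_congr fun u => ?_
    congr 1
    rw [Submodule.coe_add, add_assoc]
    congr 1
    have := U.starProjection_add_starProjection_orthogonal θ
    exact this.symm
  rw [lintegral_congr fun θ : Metric.sphere (0 : E) 1 => h1 θ, lintegral_sphere_projection U (Ψ := fun b => ∫⁻ u : U, f (u + (b : E)))
    hm.lintegral_prod_right', lintegral_orthogonal U]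
  · congr 1
    refine lintegral_congr fun b => ?_
    rw [← lintegral_const_mul _ (f := fun u : U => f (u + (b : E))) (hf.comp (by fun_prop))]
    refine lintegral_congr fun u => ?_
    rw [map_add, Submodule.orthogonalProjectionOnto_mem_subspace_eq_self,
          Submodule.orthogonalProjectionOnto_apply_of_mem_orthogonal, zero_add]
    exact Submodule.le_orthogonal_orthogonal U u.2
  · have := measurable_capWeight (((Module.finrank ℝ U : ℝ) - 2) / 2)
    have h2 := Uᗮ.orthogonalProjectionOnto.continuous.measurable
    fun_prop

theorem map_sphere_add (U : Submodule ℝ E) [Nontrivial U] :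
    ((sphereMeasure E).prod (volume : Measure U)).map (fun q => (q.2 : E) + (q.1 : E)) =
      sphereMeasure U univ • (volume : Measure E).withDensity fun x => ENNReal.ofReal (capWeight
        (((Module.finrank ℝ U : ℝ) - 2) / 2) (‖Uᗮ.orthogonalProjectionOnto x‖ ^ 2)) := by
  have hm : Measurable fun q : Metric.sphere (0 : E) 1 × U => (q.2 : E) + (q.1 : E) := by fun_prop
  have hc := measurable_capWeight (((Module.finrank ℝ U : ℝ) - 2) / 2)
  have h2 := Uᗮ.orthogonalProjectionOnto.continuous.measurable
  refine Measure.ext_of_lintegral _ fun f hf => ?_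
  rw [lintegral_map hf hm, lintegral_prod (fun q : Metric.sphere (0 : E) 1 × U => f ((q.2 : E) + (q.1 : E)))
    (hf.comp hm).aemeasurable, lintegral_sphere_add U hf,
    lintegral_smul_measure, lintegral_withDensity_eq_lintegral_mul _ (by fun_prop) hf]
  rfl

/-- For dim U ≥ 2 the exponent is nonnegative and the weight at most 1, so integrability of f
suffices. -/
theorem integral_sphere_add (U : Submodule ℝ E) [Nontrivial U] (hU : 2 ≤ Module.finrank ℝ U)
    {f : E → ℂ} (hf : Integrable f) :
    ∫ θ, (∫ u : U, f (u + (θ : E))) ∂sphereMeasure E =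
      (sphereMeasure U).real univ * ∫ x, (capWeight
        (((Module.finrank ℝ U : ℝ) - 2) / 2) (‖Uᗮ.orthogonalProjectionOnto x‖ ^ 2) : ℂ) * f x := by
  set w : E → ℝ := fun x => capWeight
        (((Module.finrank ℝ U : ℝ) - 2) / 2) (‖Uᗮ.orthogonalProjectionOnto x‖ ^ 2) with hw
  have he : (0 : ℝ) ≤ ((Module.finrank ℝ U : ℝ) - 2) / 2 := by
    have : (2 : ℝ) ≤ Module.finrank ℝ U := by exact_mod_cast hU
    linarith
  have hm : Measurable fun q : Metric.sphere (0 : E) 1 × U => (q.2 : E) + (q.1 : E) := by fun_prop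
  have hc := measurable_capWeight (((Module.finrank ℝ U : ℝ) - 2) / 2)
  have h2 := Uᗮ.orthogonalProjectionOnto.continuous.measurable
  have hwm : Measurable w := by fun_prop
  have hwm' : Measurable fun x => Real.toNNReal (w x) := hwm.real_toNNReal
  have hμ := map_sphere_add U
  have hd : (fun x => ENNReal.ofReal (w x)) = fun x => ((Real.toNNReal (w x) : NNReal) : ℝ≥0∞) := rfl
  have hfi : Integrable f ((sphereMeasure U univ • (volume : Measure E).withDensity
      fun x => ENNReal.ofReal (w x))) := by
    refine Integrable.smul_measure ?_ (measure_ne_top _ _)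
    rw [hd, integrable_withDensity_iff_integrable_smul hwm']
    refine hf.norm.mono' (hwm'.aestronglyMeasurable.smul hf.aestronglyMeasurable)
      (Filter.Eventually.of_forall fun x => ?_)
    rw [NNReal.smul_def, norm_smul, Real.coe_toNNReal _ (capWeight_nonneg _ _),
      Real.norm_of_nonneg (capWeight_nonneg _ _)]
    exact mul_le_of_le_one_left (norm_nonneg _) (capWeight_le_one he (sq_nonneg _))
  have hfi' := hfi
  rw [← hμ] at hfi'
  have hp := (integrable_map_measure hfi'.aestronglyMeasurable hm.aemeasurable).1 hfi'
  have h3 := (integral_prod _ hp).symm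
  simp only [Function.comp_apply] at h3
  rw [h3, ← integral_map hm.aemeasurable hfi'.aestronglyMeasurable, hμ, integral_smul_measure]
  rw [hd, integral_withDensity_eq_integral_smul hwm', Complex.real_smul]
  congr 1
  refine integral_congr_ae (Filter.Eventually.of_forall fun x => ?_)
  dsimp only
  rw [NNReal.smul_def, Real.coe_toNNReal _ (capWeight_nonneg _ _), Complex.real_smul]

theorem sphereMeasure_real_univ (E : Type*) [NormedAddCommGroup E] [InnerProductSpace ℝ E]
    [FiniteDimensional ℝ E] [MeasurableSpace E] [BorelSpace E] [Nontrivial E] :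
    (sphereMeasure E).real univ = 2 * Real.pi ^ ((Module.finrank ℝ E : ℝ) / 2) /
      Real.Gamma ((Module.finrank ℝ E : ℝ) / 2) := by
  rw [Measure.toSphere_real_apply_univ, measureReal_def, InnerProductSpace.volume_ball]
  have hn : (0 : ℝ) < Module.finrank ℝ E := by exact_mod_cast Module.finrank_pos
  set n : ℝ := (Module.finrank ℝ E : ℝ) with hn'
  have hG : 0 < Real.Gamma (n / 2) := Real.Gamma_pos_of_pos (by positivity)
  rw [Real.Gamma_add_one (by positivity), ENNReal.ofReal_one, one_pow, one_mul,
    ENNReal.toReal_ofReal (by positivity), Real.sqrt_eq_rpow, ← Real.rpow_natCast,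
    ← Real.rpow_mul Real.pi_pos.le, ← hn']
  field_simp

theorem sphereMeasure_real_univ_eq_sphereArea (E : Type*) [NormedAddCommGroup E]
    [InnerProductSpace ℝ E] [FiniteDimensional ℝ E] [MeasurableSpace E] [BorelSpace E]
    [Nontrivial E] : (sphereMeasure E).real univ = sphereArea (Module.finrank ℝ E) := by
  have h : 0 < Module.finrank ℝ E := Module.finrank_pos
  have : Nonempty (Fin (Module.finrank ℝ E)) := ⟨⟨0, h⟩⟩
  rw [sphereArea, sphereMeasure_real_univ, sphereMeasure_real_univ, finrank_euclideanSpace_fin]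

theorem gammaReal_mul_sphereArea {n : ℕ} (hn : 0 < n) : gammaReal n * sphereArea n = 1 := by
  have : Nonempty (Fin n) := ⟨⟨0, hn⟩⟩
  have h0 : (0 : ℝ) < n := by exact_mod_cast hn
  have hG : 0 < Real.Gamma ((n : ℝ) / 2) := Real.Gamma_pos_of_pos (by positivity)
  rw [sphereArea, sphereMeasure_real_univ, finrank_euclideanSpace_fin, gammaReal]
  have : 0 < Real.pi ^ ((n : ℝ) / 2) := Real.rpow_pos_of_pos Real.pi_pos _
  field_simp

variable {E₁ : Type*} [NormedAddCommGroup E₁] [InnerProductSpace ℝ E₁] [FiniteDimensional ℝ E₁]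
  [MeasurableSpace E₁] [BorelSpace E₁]

/-- Translates of the sphere along the range of an isometry. -/
theorem integral_sphere_add_isometry (L : E₁ →ₗᵢ[ℝ] E) {Lt : E → E₁}
    (hLt : ∀ v x, (⟪L v, x⟫ : ℝ) = ⟪v, Lt x⟫) (hn : 2 ≤ Module.finrank ℝ E₁) {f : E → ℂ}
    (hf : Integrable f) :
    ∫ θ, (∫ v, f (L v + (θ : E))) ∂sphereMeasure E =
      sphereArea (Module.finrank ℝ E₁) * ∫ x, (capWeight
        (((Module.finrank ℝ E₁ : ℝ) - 2) / 2) (‖x‖ ^ 2 - ‖Lt x‖ ^ 2) : ℂ) * f x := by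
  set U : Submodule ℝ E := LinearMap.range L.toLinearMap
  set J : E₁ ≃ₗᵢ[ℝ] U := L.equivRange with hJ
  have hfr : Module.finrank ℝ U = Module.finrank ℝ E₁ := J.toLinearEquiv.finrank_eq.symm
  have hnt : Nontrivial U := Module.nontrivial_of_finrank_pos (R := ℝ) (by omega)
  -- L ∘ Lt is the orthogonal projection onto the range of the isometry, and Pythagoras applies.
  have hP : ∀ x, ‖Uᗮ.orthogonalProjectionOnto x‖ ^ 2 = ‖x‖ ^ 2 - ‖Lt x‖ ^ 2 := by
    intro x
    have h1 : U.starProjection x = L (Lt x) := by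
      refine Submodule.eq_starProjection_of_mem_of_inner_eq_zero ⟨Lt x, rfl⟩ ?_
      rintro w ⟨v, rfl⟩
      show (⟪x - L (Lt x), L v⟫ : ℝ) = 0
      rw [real_inner_comm, inner_sub_right, hLt, L.inner_map_map, sub_self]
    have h2 := U.norm_sq_eq_add_norm_sq_projection x
    have h3 : ‖U.orthogonalProjectionOnto x‖ = ‖Lt x‖ := by
      rw [← L.norm_map (Lt x), ← h1]; rfl
    rw [h3] at h2
    linarith
  have h := integral_sphere_add U (by rw [hfr]; exact hn) hf
  rw [sphereMeasure_real_univ_eq_sphereArea, hfr] at h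
  simp only [hP] at h
  rw [← h]
  refine integral_congr_ae (Filter.Eventually.of_forall fun θ => ?_)
  exact J.measurePreserving.integral_comp J.toHomeomorph.measurableEmbedding
    (fun u : U => f (u + (θ : E)))

end SphereConvolution

/-! ### Matrices with vanishing rows and their orthogonal complement -/

section RowBlocks

variable {α β γ δ : Type} [Fintype α] [Fintype β] [Fintype γ] [Fintype δ] [DecidableEq α]
  [DecidableEq β] [DecidableEq γ] [DecidableEq δ]

/-- The partition of the rows of a matrix into two blocks. -/
def rowE (δ : Type) (e : α ⊕ β ≃ γ) : (α × δ) ⊕ (β × δ) ≃ γ × δ :=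
  (Equiv.sumProdDistrib α β δ).symm.trans (e.prodCongr (Equiv.refl δ))

theorem join_rowE (e : α ⊕ β ≃ γ) (a : α × δ → ℝ) (b : β × δ → ℝ) :
    join (rowE δ e) (a, b) = padTop e a + padBot e b := by
  funext ⟨l, j⟩
  obtain ⟨i | i, rfl⟩ := e.surjective l
  · exact (join_inl (rowE δ e) (a, b) (i, j)).trans (by simp)
  · exact (join_inr (rowE δ e) (a, b) (i, j)).trans (by simp)

theorem padTop_zero (e : α ⊕ β ≃ γ) : padTop e (0 : α × δ → ℝ) = 0 := by
  funext ⟨l, j⟩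
  obtain ⟨i | i, rfl⟩ := e.surjective l <;> simp

theorem padBot_zero (e : α ⊕ β ≃ γ) : padBot e (0 : β × δ → ℝ) = 0 := by
  funext ⟨l, j⟩
  obtain ⟨i | i, rfl⟩ := e.surjective l <;> simp

/-- The partition of the columns of the upper block of a matrix. -/
def topColE (e : α ⊕ β ≃ γ) : (α × α) ⊕ (α × β) ≃ α × γ :=
  (Equiv.prodSumDistrib α α β).symm.trans ((Equiv.refl α).prodCongr e)

theorem join_colE_padTop (e : α ⊕ β ≃ γ) (q : (α × α → ℝ) × (α × β → ℝ)) :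
    join (colE e) (padTop e q.1, padTop e q.2) = padTop e (join (topColE e) q) := by
  funext ⟨l, j⟩
  obtain ⟨i | i, rfl⟩ := e.surjective l <;> obtain ⟨j | j, rfl⟩ := e.surjective j
  · refine Eq.trans ?_ (((padTop_inl e _ i _).trans (join_inl (topColE e) q (i, j))).symm); simp
  · refine Eq.trans ?_ (((padTop_inl e _ i _).trans (join_inr (topColE e) q (i, j))).symm); simp
  · simp
  · simp

/-- The Fourier transform of Lebesgue measure on a coordinate subspace is Lebesgue measure on the
complementary one. -/
theorem integral_padTop {f : EuclideanSpace ℝ (γ × δ) → ℂ} (hf : IsNice f) (e : α ⊕ β ≃ γ) :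
    ∫ u : α × δ → ℝ, f (WithLp.toLp 2 (padTop e u)) =
      ∫ v : β × δ → ℝ, 𝓕 f (WithLp.toLp 2 (padBot e v)) := by
  have h := integral_chr_mul_join hf ((Equiv.sumComm (β × δ) (α × δ)).trans (rowE δ e)) 0 0
  simpa only [← join_swap, join_rowE, padTop_zero, padBot_zero, zero_add, add_zero,
    zero_dotProduct, dotProduct_zero, neg_zero, chr_zero, one_mul] using h

theorem padBot_rmul (e : α ⊕ β ≃ γ) (v : β × δ → ℝ) (B : Matrix δ δ ℝ) :
    padBot e (rmul v B) = rmul (padBot e v) B := by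
  funext ⟨l, j⟩
  obtain ⟨i | i, rfl⟩ := e.surjective l <;> simp [rmul, unmat, mat, Matrix.mul_apply]

theorem integral_rmul {B : Matrix δ δ ℝ} (hB : B.det ≠ 0) {F : (γ × δ → ℝ) → ℂ}
    (hF : Measurable F) :
    ((|B.det| ^ Fintype.card γ : ℝ) : ℂ) * ∫ X, F (rmul X B) = ∫ X, F X := by
  have hm : Measurable fun X : γ × δ → ℝ => rmul X B := (continuous_rmul B).measurable
  have hc : 0 < |B.det| ^ Fintype.card γ := by positivity
  have h1 : ENNReal.ofReal (|B.det| ^ Fintype.card γ) • (volume.map fun X : γ × δ → ℝ => rmul X B)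
      = volume := by
    refine Measure.ext_of_lintegral _ fun f hf => ?_
    rw [lintegral_smul_measure, lintegral_map hf hm, smul_eq_mul, lintegral_rmul hB hf]
  conv_rhs => rw [← h1]
  rw [integral_smul_measure, integral_map hm.aemeasurable hF.aestronglyMeasurable,
    ENNReal.toReal_ofReal hc.le, Complex.real_smul]

/-- Completion by zero rows, as an isometry. -/
def padBotIso (δ : Type) [Fintype δ] [DecidableEq δ] (e : α ⊕ β ≃ γ) :
    EuclideanSpace ℝ (β × δ) →ₗᵢ[ℝ] EuclideanSpace ℝ (γ × δ) where
  toFun v := WithLp.toLp 2 (padBot e v.ofLp)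
  map_add' v w := by
    ext ⟨l, j⟩
    obtain ⟨i | i, rfl⟩ := e.surjective l <;> simp
  map_smul' c v := by
    ext ⟨l, j⟩
    obtain ⟨i | i, rfl⟩ := e.surjective l <;> simp
  norm_map' v := by
    refine (sq_eq_sq₀ (norm_nonneg _) (norm_nonneg _)).1 ?_
    show ‖WithLp.toLp 2 (padBot e v.ofLp)‖ ^ 2 = _
    rw [norm_sq_toLp, nsq_padBot, ← norm_sq_toLp]

theorem padBotIso_apply (e : α ⊕ β ≃ γ) (v : EuclideanSpace ℝ (β × δ)) :
    padBotIso δ e v = WithLp.toLp 2 (padBot e v.ofLp) := rfl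

/-- The lower block of a matrix. -/
def botRows (δ : Type) [Fintype δ] (e : α ⊕ β ≃ γ) (x : EuclideanSpace ℝ (γ × δ)) :
    EuclideanSpace ℝ (β × δ) :=
  WithLp.toLp 2 fun q => x (e (Sum.inr q.1), q.2)

theorem inner_padBotIso (e : α ⊕ β ≃ γ) (v : EuclideanSpace ℝ (β × δ))
    (x : EuclideanSpace ℝ (γ × δ)) : (⟪padBotIso δ e v, x⟫ : ℝ) = ⟪v, botRows δ e x⟫ := by
  simp only [PiLp.inner_apply, Fintype.sum_prod_type]
  rw [← e.sum_comp, Fintype.sum_sum_type]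
  simp [padBotIso_apply, botRows]

end RowBlocks

/-! ### Isometric coordinates on the configurations with sum zero -/

section Spread

variable {d : ℕ}

/-- `(d + 1)^{-1/2}`. -/
def spreadDet (d : ℕ) : ℝ := (√((d : ℝ) + 1))⁻¹

/-- The off-diagonal entry of the spread matrix. -/
def spreadOff (d : ℕ) : ℝ := (spreadDet d - 1) / d

/-- The inverse square root of the matrix with diagonal entries `2` and other entries `1`. -/
def spread (d : ℕ) : Matrix (Fin d) (Fin d) ℝ := 1 + Matrix.of fun _ _ => spreadOff d

theorem spreadDet_pos (d : ℕ) : 0 < spreadDet d := by unfold spreadDet; positivity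

theorem spreadDet_sq (d : ℕ) : spreadDet d ^ 2 = ((d : ℝ) + 1)⁻¹ := by
  rw [spreadDet, inv_pow, Real.sq_sqrt (by positivity)]

theorem one_add_mul_spreadOff (hd : d ≠ 0) : 1 + d * spreadOff d = spreadDet d := by
  have : (d : ℝ) ≠ 0 := by exact_mod_cast hd
  rw [spreadOff]; field_simp; ring

/-- A rank one perturbation of the identity, with determinant 1 + d · `spreadOff d`. -/
theorem det_spread (hd : d ≠ 0) : (spread d).det = spreadDet d := by
  have h : spread d = 1 + Matrix.replicateCol Unit (fun _ => spreadOff d) *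
      Matrix.replicateRow Unit (fun _ => (1 : ℝ)) := by
    ext i j
    simp [spread, Matrix.mul_apply]
  rw [h, Matrix.det_one_add_mul_comm, ← one_add_mul_spreadOff hd]
  simp [Matrix.mul_apply]

theorem rmul_spread {γ : Type} [Fintype γ] (Y : γ × Fin d → ℝ) (l : γ) (j : Fin d) :
    rmul Y (spread d) (l, j) = Y (l, j) + spreadOff d * ∑ i, Y (l, i) := by
  simp [rmul, unmat, mat, Matrix.mul_apply, spread, Matrix.add_apply, add_mul, Finset.sum_add_distrib,
    Matrix.one_apply, Finset.mul_sum, mul_comm]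

theorem sum_rmul_spread (hd : d ≠ 0) {γ : Type} [Fintype γ] (Y : γ × Fin d → ℝ) (l : γ) :
    ∑ j, rmul Y (spread d) (l, j) = spreadDet d * ∑ i, Y (l, i) := by
  simp only [rmul_spread, Finset.sum_add_distrib, Finset.sum_const, Finset.card_univ,
    Fintype.card_fin, nsmul_eq_mul]
  rw [← one_add_mul_spreadOff hd]; ring

/-- The adjoint of `spreadIso`. -/
def spreadAdj (x : Conf d) : SqMat d :=
  WithLp.toLp 2 fun q => x (q.2.succ, q.1) + spreadOff d * ∑ i : Fin d, x (i.succ, q.1) -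
    spreadDet d * x (0, q.1)

theorem spreadAdj_apply (x : Conf d) (l j : Fin d) : spreadAdj x (l, j) =
    x (j.succ, l) + spreadOff d * ∑ i : Fin d, x (i.succ, l) - spreadDet d * x (0, l) := rfl

theorem inner_diffAdjoint_rmul (hd : d ≠ 0) (Y : SqMat d) (x : Conf d) :
    (⟪diffAdjoint d (WithLp.toLp 2 (rmul Y.ofLp (spread d))), x⟫ : ℝ) = ⟪Y, spreadAdj x⟫ := by
  simp only [PiLp.inner_apply, Fintype.sum_prod_type, Fin.sum_univ_succ, diffAdjoint_zero,
    diffAdjoint_succ, RCLike.inner_apply, conj_trivial, spreadAdj_apply, sum_rmul_spread hd]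
  simp only [rmul_spread]
  rw [Finset.sum_comm (γ := Fin d), ← Finset.sum_add_distrib]
  refine Finset.sum_congr rfl fun l _ => ?_
  have h1 : ∑ j, x.ofLp (Fin.succ j, l) * (Y.ofLp (l, j) + spreadOff d * ∑ i, Y.ofLp (l, i)) =
      (∑ j, x.ofLp (Fin.succ j, l) * Y.ofLp (l, j)) +
        (∑ j : Fin d, x.ofLp (Fin.succ j, l)) * (spreadOff d * ∑ i, Y.ofLp (l, i)) := by
    simp only [mul_add, Finset.sum_add_distrib, Finset.sum_mul]
  have h2 : ∑ j, (x.ofLp (Fin.succ j, l) + spreadOff d * ∑ i : Fin d, x.ofLp (i.succ, l) -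
      spreadDet d * x.ofLp (0, l)) * Y.ofLp (l, j) =
      (∑ j, x.ofLp (Fin.succ j, l) * Y.ofLp (l, j)) +
        (spreadOff d * ∑ i : Fin d, x.ofLp (i.succ, l) - spreadDet d * x.ofLp (0, l)) *
          ∑ i, Y.ofLp (l, i) := by
    rw [Finset.mul_sum Finset.univ (fun i => Y.ofLp (l, i)), ← Finset.sum_add_distrib]
    exact Finset.sum_congr rfl fun j _ => by ring
  rw [h1, h2]; ring

/-- Composing `diffAdjoint` with its adjoint is right multiplication by 1 + J, J being the all-ones
matrix. The identity says S(1 + J)S = 1 for S = `spread d`, which makes `spreadIso` an isometry. -/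
theorem spreadAdj_diffAdjoint (hd : d ≠ 0) (Y : SqMat d) :
    spreadAdj (diffAdjoint d (WithLp.toLp 2 (rmul Y.ofLp (spread d)))) = Y := by
  ext ⟨l, j⟩
  rw [spreadAdj_apply]
  simp only [diffAdjoint_zero, diffAdjoint_succ, sum_rmul_spread hd]
  rw [rmul_spread]
  have h : spreadOff d + spreadOff d * spreadDet d + spreadDet d ^ 2 = 0 := by
    have hd' : (d : ℝ) ≠ 0 := by exact_mod_cast hd
    have h2 := spreadDet_sq d
    have h3 : ((d : ℝ) + 1) * spreadDet d ^ 2 = 1 := by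
      rw [h2, mul_inv_cancel₀ (by positivity)]
    rw [spreadOff]; field_simp; linarith
  linear_combination (∑ i, Y.ofLp (l, i)) * h

/-- The isometry of the space of matrices onto the configurations with sum zero. -/
def spreadIso (hd : d ≠ 0) : SqMat d →ₗᵢ[ℝ] Conf d where
  toFun Y := diffAdjoint d (WithLp.toLp 2 (rmul Y.ofLp (spread d)))
  map_add' X Y := by
    rw [← map_add]
    congr 1
    ext ⟨l, j⟩
    simp [rmul_spread, Finset.sum_add_distrib]; ring
  map_smul' c Y := by
    rw [← map_smul]
    congr 1
    ext ⟨l, j⟩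
    simp [rmul_spread, ← Finset.mul_sum]; ring
  norm_map' Y := by
    refine (sq_eq_sq₀ (norm_nonneg _) (norm_nonneg _)).1 ?_
    show ‖diffAdjoint d (WithLp.toLp 2 (rmul Y.ofLp (spread d)))‖ ^ 2 = _
    rw [← real_inner_self_eq_norm_sq, inner_diffAdjoint_rmul hd, spreadAdj_diffAdjoint hd,
      real_inner_self_eq_norm_sq]

theorem spreadIso_apply (hd : d ≠ 0) (Y : SqMat d) :
    spreadIso hd Y = diffAdjoint d (WithLp.toLp 2 (rmul Y.ofLp (spread d))) := rfl

theorem inner_spreadIso (hd : d ≠ 0) (Y : SqMat d) (x : Conf d) :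
    (⟪spreadIso hd Y, x⟫ : ℝ) = ⟪Y, spreadAdj x⟫ := inner_diffAdjoint_rmul hd Y x

/-- Both sides equal Σ aᵢbᵢ - (Σ aᵢ)(Σ bᵢ)/(d + 1), the inner product of the projections to the
vectors of sum zero; the left side computes it in isometric coordinates. -/
theorem sum_succ_sub_mean (hd : d ≠ 0) (a b : Fin (d + 1) → ℝ) :
    ∑ j : Fin d, (a j.succ + spreadOff d * ∑ i : Fin d, a i.succ - spreadDet d * a 0) *
      (b j.succ + spreadOff d * ∑ i : Fin d, b i.succ - spreadDet d * b 0) =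
    ∑ i, (a i - ((d : ℝ) + 1)⁻¹ * ∑ j, a j) * (b i - ((d : ℝ) + 1)⁻¹ * ∑ j, b j) := by
  have key : ∀ (n : ℕ) (u v : Fin n → ℝ) (s t : ℝ), ∑ j, (u j + s) * (v j + t) =
      (∑ j, u j * v j) + t * (∑ j, u j) + s * (∑ j, v j) + n * s * t := by
    intro n u v s t
    have : ∀ j, (u j + s) * (v j + t) = u j * v j + t * u j + s * v j + s * t := fun j => by ring
    simp only [this, Finset.sum_add_distrib, ← Finset.mul_sum, Finset.sum_const, Finset.card_univ,
      Fintype.card_fin, nsmul_eq_mul]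
    ring
  simp only [add_sub_assoc]
  rw [key]
  simp only [sub_eq_add_neg]
  rw [key]
  simp only [Fin.sum_univ_succ]
  set A := ∑ i : Fin d, a i.succ
  set B := ∑ i : Fin d, b i.succ
  have hd' : (d : ℝ) ≠ 0 := by exact_mod_cast hd
  have h3 : ((d : ℝ) + 1)⁻¹ = spreadDet d ^ 2 := (spreadDet_sq d).symm
  have h4 : ((d : ℝ) + 1) * spreadDet d ^ 2 = 1 := by
    rw [← h3, mul_inv_cancel₀ (by positivity)]
  have h1 := one_add_mul_spreadOff hd
  have h2 : 2 * spreadOff d + d * spreadOff d ^ 2 = - spreadDet d ^ 2 := by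
    rw [spreadOff]; field_simp; linear_combination h4
  rw [h3]
  push_cast
  set r := spreadDet d
  set s := spreadOff d
  have h5 : (d : ℝ) * r ^ 2 = 1 - r ^ 2 := by linarith
  linear_combination (A * B) * h2 + (-(A * b 0 + B * a 0) * r) * h1 + (a 0 * b 0) * h5 -
    ((A + a 0) * (B + b 0) * r ^ 2) * h4

theorem sum_spreadAdj (hd : d ≠ 0) (x : Conf d) (l m : Fin d) :
    ∑ j, spreadAdj x (l, j) * spreadAdj x (m, j) = ((d : ℝ) + 1) * covMatrix x l m := by
  have h := sum_succ_sub_mean hd (fun i => x (i, l)) (fun i => x (i, m))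
  simp only [spreadAdj_apply]
  rw [h]
  have h0 : (d : ℝ) + 1 ≠ 0 := by positivity
  simp only [covMatrix, Matrix.smul_apply, Matrix.sum_apply, Matrix.vecMulVec_apply, smul_eq_mul]
  rw [mul_inv_cancel_left₀ h0]
  simp [mean, point]

end Spread

/-! ### The Fourier transform of the distribution at an integer -/

section Value

/-- Transforming twice is reflection. The factor 2π and the power of 2π reconcile the kernels
e^{-ix·ξ} and e^{-2πix·ξ}. -/
theorem fourier_fourierS {E : Type*} [NormedAddCommGroup E] [InnerProductSpace ℝ E]
    [FiniteDimensional ℝ E] [MeasurableSpace E] [BorelSpace E] (φ : 𝓢(E, ℂ)) (ξ : E) :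
    𝓕 (fourierS φ : E → ℂ) ξ =
      ((2 * Real.pi) ^ Module.finrank ℝ E : ℝ) * φ (-(2 * Real.pi) • ξ) := by
  have h0 : (0 : ℝ) < 2 * Real.pi := by positivity
  set g : E → ℂ := 𝓕 (φ : E → ℂ) with hg
  have h1 : ∀ x, fourierS φ x = g ((2 * Real.pi)⁻¹ • x) := by
    intro x
    rw [hg, ← SchwartzMap.fourier_coe]
    rfl
  have h2 := Measure.integral_comp_smul (volume : Measure E)
    (fun y => Complex.exp (((-2 * Real.pi * ⟪y, (2 * Real.pi) • ξ⟫ : ℝ) : ℂ) * Complex.I) • g y)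
    (2 * Real.pi)⁻¹
  have h3 : 𝓕 (fourierS φ : E → ℂ) ξ = ∫ x, Complex.exp (((-2 * Real.pi *
      ⟪(2 * Real.pi)⁻¹ • x, (2 * Real.pi) • ξ⟫ : ℝ) : ℂ) * Complex.I) • g ((2 * Real.pi)⁻¹ • x) := by
    rw [Real.fourier_eq']
    refine integral_congr_ae (Filter.Eventually.of_forall fun x => ?_)
    dsimp only
    rw [h1, real_inner_smul_left, real_inner_smul_right, inv_mul_cancel_left₀ h0.ne']
  have h4 : 𝓕 g ((2 * Real.pi) • ξ) = φ (-(2 * Real.pi) • ξ) := by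
    rw [hg, neg_smul, ← SchwartzMap.fourier_coe, ← neg_neg ((2 * Real.pi) • ξ),
      ← Real.fourierInv_eq_fourier_neg, ← SchwartzMap.fourierInv_coe,
      FourierTransform.fourierInv_fourier_eq, neg_neg]
  rw [h3, h2, ← Real.fourier_eq', h4, inv_pow, inv_inv, abs_of_pos (by positivity),
    Complex.real_smul]

variable {d : ℕ}

theorem fourier_integrateBase (φ : 𝓢(Conf d, ℂ)) :
    𝓕 (integrateBase d φ : SqMat d → ℂ) = fun Y => 𝓕 (φ : Conf d → ℂ) (diffAdjoint d Y) := by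
  funext Y
  rw [← SchwartzMap.fourier_coe, integrateBase, ContinuousLinearMap.comp_apply,
    FourierTransform.fourierInvCLM_apply, FourierTransform.fourier_fourierInv_eq,
    ← SchwartzMap.fourier_coe]
  rfl

/-- The value at k is an integral over the matrices whose second row block vanishes; dually, 𝓕 f is
integrated over those whose first row block vanishes. -/
theorem regInt_natCast_eq {f : SqMat d → ℂ} (hf : IsNice f)
    (hi : IsLeftInvariant fun X : Fin d × Fin d → ℝ => f (WithLp.toLp 2 X)) (k p : ℕ)
    (h : k + p = d) :
    regInt d f k = ∫ v : Idx p × Fin d → ℝ, 𝓕 f (WithLp.toLp 2 (padBot (chain k p h) v)) := by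
  have hc := hf.continuous
  have hp := continuous_padTop (δ := Fin d) (chain k p h)
  rw [regInt_natCast hf hi k p h, ← integral_padTop hf,
    ← integral_comp_of_measurePreserving (measurePreserving_join (topColE (chain k p h)))
      (Continuous.aestronglyMeasurable (by fun_prop))]
  simp only [join_colE_padTop]
  rfl

theorem integrable_comp_orth {κ ι : Type} [Fintype κ] [Fintype ι] {f : EuclideanSpace ℝ κ → ℂ}
    (hf : Continuous f) (hd : RapidDecay f) {M : (ι → ℝ) × Orth d → EuclideanSpace ℝ κ}
    (hM : Continuous M) (hn : ∀ q, ‖WithLp.toLp 2 q.1‖ ≤ ‖M q‖) :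
    Integrable (fun q => f (M q)) (volume.prod (haarOrth d)) := by
  obtain ⟨C, hC⟩ := hd.exists_decayBound (Fintype.card ι + 1)
  have h1 := (integrable_decay_nsq (κ := ι) (N := Fintype.card ι + 1) (Nat.lt_succ_self _)).const_mul C
  refine (h1.mul_prod (integrable_const (μ := haarOrth d) (1 : ℝ))).mono'
    (hf.comp hM).aestronglyMeasurable (Filter.Eventually.of_forall fun q => ?_)
  rw [mul_one]
  refine (hC (M q).ofLp).trans (mul_le_mul_of_nonneg_left
    (decay_le_decay _ (nsq_nonneg _) ?_) hC.nonneg)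
  rw [← norm_sq_toLp, ← norm_sq_toLp]
  exact pow_le_pow_left₀ (norm_nonneg _) (hn q) 2

variable {α β : Type} [Fintype α] [Fintype β] [DecidableEq α] [DecidableEq β]

/-- The isometry onto the space of configurations with sum zero in a rotated coordinate plane. -/
def sliceIso (hd : d ≠ 0) (e : α ⊕ β ≃ Fin d) (g : Orth d) :
    EuclideanSpace ℝ (β × Fin d) →ₗᵢ[ℝ] Conf d :=
  (spreadIso hd).comp ((lmulIso g (Fin d)).toLinearIsometry.comp (padBotIso (Fin d) e))

theorem sliceIso_apply (hd : d ≠ 0) (e : α ⊕ β ≃ Fin d) (g : Orth d)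
    (v : EuclideanSpace ℝ (β × Fin d)) :
    sliceIso hd e g v = spreadIso hd (lmulIso g (Fin d) (padBotIso (Fin d) e v)) := rfl

/-- The adjoint of `sliceIso`. -/
def sliceAdj (e : α ⊕ β ≃ Fin d) (g : Orth d) (x : Conf d) : EuclideanSpace ℝ (β × Fin d) :=
  botRows (Fin d) e (lmulIso g⁻¹ (Fin d) (spreadAdj x))

theorem inner_sliceIso (hd : d ≠ 0) (e : α ⊕ β ≃ Fin d) (g : Orth d)
    (v : EuclideanSpace ℝ (β × Fin d)) (x : Conf d) :
    (⟪sliceIso hd e g v, x⟫ : ℝ) = ⟪v, sliceAdj e g x⟫ := by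
  rw [sliceIso_apply, inner_spreadIso, LinearIsometryEquiv.inner_map_eq_flip, inner_padBotIso]
  rfl

/-- The adjoint of an isometry is a contraction. -/
theorem norm_sliceAdj_le (hd : d ≠ 0) (e : α ⊕ β ≃ Fin d) (g : Orth d) (x : Conf d) :
    ‖sliceAdj e g x‖ ≤ ‖x‖ := by
  have h := inner_sliceIso hd e g (sliceAdj e g x) x
  rw [real_inner_self_eq_norm_sq] at h
  have h2 := real_inner_le_norm (sliceIso hd e g (sliceAdj e g x)) x
  rw [h, LinearIsometry.norm_map, sq] at h2
  by_contra hlt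
  push Not at hlt
  nlinarith [norm_nonneg x, norm_nonneg (sliceAdj e g x)]

theorem continuous_sliceIso (hd : d ≠ 0) (e : α ⊕ β ≃ Fin d) :
    Continuous fun q : Orth d × EuclideanSpace ℝ (β × Fin d) => sliceIso hd e q.1 q.2 :=
  (spreadIso hd).continuous.comp (continuous_lmulIso.comp (continuous_fst.prodMk
    ((padBotIso (Fin d) e).continuous.comp continuous_snd)))

theorem continuous_spreadAdj : Continuous (spreadAdj : Conf d → SqMat d) := by
  unfold spreadAdj
  refine (PiLp.continuous_toLp 2 _).comp (continuous_pi fun q => ?_)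
  fun_prop

theorem continuous_sliceAdj (e : α ⊕ β ≃ Fin d) :
    Continuous fun q : Orth d × Conf d => sliceAdj e q.1 q.2 := by
  have h : Continuous fun q : Orth d × Conf d => lmulIso q.1⁻¹ (Fin d) (spreadAdj q.2) :=
    continuous_lmulIso.comp ((continuous_inv.comp continuous_fst).prodMk
      (continuous_spreadAdj.comp continuous_snd))
  unfold sliceAdj botRows
  exact (PiLp.continuous_toLp 2 _).comp (continuous_pi fun q =>
    (EuclideanSpace.proj (𝕜 := ℝ) (e (Sum.inr q.1), q.2)).continuous.comp h)

/-- Scaling by -2π costs one power of 2π per coordinate. Inserting `spread`, to reach the isometry,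
costs its determinant once per row. -/
theorem integral_slice (hd : d ≠ 0) (e : α ⊕ β ≃ Fin d) (g : Orth d) {φ : Conf d → ℂ}
    (hφ : Continuous φ) :
    ∫ v : β × Fin d → ℝ, φ (-(2 * Real.pi) • diffAdjoint d
        (lmulIso g (Fin d) (WithLp.toLp 2 (padBot e v)))) =
      ((((2 * Real.pi) ^ (Fintype.card β * d))⁻¹ * spreadDet d ^ Fintype.card β : ℝ) : ℂ) *
        ∫ v, φ (sliceIso hd e g v) := by
  set H : (β × Fin d → ℝ) → ℂ := fun v =>
    φ (diffAdjoint d (lmulIso g (Fin d) (WithLp.toLp 2 (padBot e v)))) with hH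
  have hp := continuous_padBot (δ := Fin d) e
  have hHc : Continuous H := hφ.comp ((diffAdjoint d).continuous.comp
    ((lmulIso g (Fin d)).continuous.comp ((PiLp.continuous_toLp 2 _).comp hp)))
  have e1 : ∀ v, φ (-(2 * Real.pi) • diffAdjoint d
      (lmulIso g (Fin d) (WithLp.toLp 2 (padBot e v)))) = H (-(2 * Real.pi) • v) := by
    intro v
    have : WithLp.toLp 2 (padBot e (-(2 * Real.pi) • v)) =
        -(2 * Real.pi) • WithLp.toLp 2 (padBot e v) :=
      (padBotIso (Fin d) e).map_smul (-(2 * Real.pi)) (WithLp.toLp 2 v)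
    simp only [hH]
    rw [this, map_smul, map_smul]
  have hB : (spread d).det ≠ 0 := by rw [det_spread hd]; exact (spreadDet_pos d).ne'
  simp only [e1]
  rw [Measure.integral_comp_smul, ← integral_rmul (γ := β) hB hHc.measurable, det_spread hd,
    abs_of_pos (spreadDet_pos d), Complex.real_smul, ← mul_assoc, ← Complex.ofReal_mul]
  congr 1
  · congr 2
    rw [abs_inv, abs_pow, abs_neg, abs_of_pos (by positivity)]
    simp
  · rw [← (PiLp.volume_preserving_ofLp (β × Fin d)).integral_comp
      (MeasurableEquiv.toLp 2 (β × Fin d → ℝ)).symm.measurableEmbedding]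
    refine integral_congr_ae (Filter.Eventually.of_forall fun v => ?_)
    simp only [hH]
    rw [sliceIso_apply, spreadIso_apply, padBot_rmul, lmulIso_apply, lmulIso_apply]
    simp only [padBotIso_apply, rmul_lmul]

/-- The value of the Fourier transform of the determinant distribution at an integer. -/
theorem detDist_fourierS (hd : d ≠ 0) (k p : ℕ) (h : k + p = d) (φ : 𝓢(Conf d, ℂ)) :
    detDist d k (fourierS φ) = (gammaN d d)⁻¹ *
      (((2 * Real.pi) ^ (d * (k + 1)) * spreadDet d ^ p : ℝ) : ℂ) *
        ∫ g, (∫ v, φ (sliceIso hd (chain k p h) g v)) ∂haarOrth d := by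
  set e := chain k p h
  set f : 𝓢(SqMat d, ℂ) := integrateBase d (fourierS φ) with hf
  have hp := continuous_padBot (δ := Fin d) e
  have hfin : Module.finrank ℝ (Conf d) = (d + 1) * d := by simp
  have e1 : 𝓕 (f : SqMat d → ℂ) = fun Y => ((2 * Real.pi) ^ ((d + 1) * d) : ℝ) *
      φ (-(2 * Real.pi) • diffAdjoint d Y) := by
    rw [hf, fourier_integrateBase]
    funext Y
    rw [fourier_fourierS, hfin]
  have hM : Continuous fun q : (Idx p × Fin d → ℝ) × Orth d => -(2 * Real.pi) • diffAdjoint d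
      (lmulIso q.2 (Fin d) (WithLp.toLp 2 (padBot e q.1))) :=
    (continuous_const_smul (-(2 * Real.pi))).comp ((diffAdjoint d).continuous.comp
      (continuous_lmulIso.comp (continuous_snd.prodMk
        ((PiLp.continuous_toLp 2 _).comp (hp.comp continuous_fst)))))
  have hint := integrable_comp_orth φ.continuous φ.rapidDecay hM (fun q => by
    rw [norm_smul, norm_neg, Real.norm_of_nonneg (by positivity)]
    have h1 : ‖WithLp.toLp 2 q.1‖ = ‖lmulIso q.2 (Fin d) (WithLp.toLp 2 (padBot e q.1))‖ := by
      rw [LinearIsometryEquiv.norm_map]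
      exact ((padBotIso (Fin d) e).norm_map (WithLp.toLp 2 q.1)).symm
    rw [h1]
    refine (norm_le_norm_diffAdjoint _).trans ?_
    refine le_mul_of_one_le_left (norm_nonneg _) ?_
    linarith [Real.pi_gt_three])
  rw [detDist_apply, regInt_natCast_eq f.isNice.avg (avg_lmul f.continuous) k p h,
    fourier_avg f.continuous f.rapidDecay, e1, avg_const_mul, mul_assoc]
  congr 1
  rw [integral_const_mul]
  unfold avg
  rw [integral_integral_swap hint]
  refine (congrArg _ (integral_congr_ae (Filter.Eventually.of_forall fun g =>
    integral_slice hd e g φ.continuous))).trans ?_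
  rw [card_idx, integral_const_mul, ← mul_assoc, ← Complex.ofReal_mul]
  congr 2
  -- The double transform on configurations yields d(d + 1) powers of 2π and the rescaling of the
  -- slice takes back pd of them, leaving d(k + 1).
  have : (2 * Real.pi) ^ ((d + 1) * d) = (2 * Real.pi) ^ (d * (k + 1)) * (2 * Real.pi) ^ (p * d) := by
    rw [← pow_add]
    congr 1
    rw [← h]; ring
  rw [this]
  have h0 : (2 * Real.pi) ^ (p * d) ≠ 0 := by positivity
  field_simp

end Value

/-! ### The density of the convolution -/

section Density

variable {d : ℕ} {α β : Type} [Fintype α] [Fintype β] [DecidableEq α] [DecidableEq β]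

theorem integrable_inv_one_add_norm_pow (E : Type*) [NormedAddCommGroup E] [NormedSpace ℝ E]
    [FiniteDimensional ℝ E] [MeasureSpace E] [BorelSpace E]
    [(volume : Measure E).IsAddHaarMeasure] :
    Integrable fun v : E => ((1 + ‖v‖) ^ (Module.finrank ℝ E + 1))⁻¹ := by
  refine (integrable_one_add_norm (E := E) (μ := volume)
    (r := (Module.finrank ℝ E + 1 : ℕ)) (by push_cast; linarith)).congr
    (Filter.Eventually.of_forall fun x => ?_)
  dsimp only
  rw [Real.rpow_neg (by positivity), Real.rpow_natCast]

/-- Integrals of a rapidly decreasing function over translated rotated slices depend continuously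
on the rotation and the translation. -/
theorem continuous_integral_sliceIso (hd : d ≠ 0) (e : α ⊕ β ≃ Fin d) {φ : Conf d → ℂ}
    (hφ : Continuous φ) (hr : RapidDecay φ) :
    Continuous fun q : Metric.sphere (0 : Conf d) 1 × Orth d =>
      ∫ v, φ (sliceIso hd e q.2 v + (q.1 : Conf d)) := by
  set N := Module.finrank ℝ (EuclideanSpace ℝ (β × Fin d)) + 1 with hN
  obtain ⟨C, hC⟩ := hr N
  have hC0 : 0 ≤ C := by
    have := (norm_nonneg _).trans (hC 0)
    exact nonneg_of_mul_nonneg_left this (by positivity)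
  refine continuous_of_dominated (bound := fun v => C * 2 ^ N * ((1 + ‖v‖) ^ N)⁻¹) (fun q => ?_)
    (fun q => Filter.Eventually.of_forall fun v => ?_)
    ((integrable_inv_one_add_norm_pow (EuclideanSpace ℝ (β × Fin d))).const_mul _)
    (Filter.Eventually.of_forall fun v => ?_)
  · exact (hφ.comp ((sliceIso hd e q.2).continuous.add continuous_const)).aestronglyMeasurable
  · refine (hC _).trans ?_
    rw [mul_assoc]
    refine mul_le_mul_of_nonneg_left ?_ hC0
    set x := sliceIso hd e q.2 v + (q.1 : Conf d)
    have h1 : ‖v‖ ≤ ‖x‖ + 1 := by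
      rw [← (sliceIso hd e q.2).norm_map v]
      have h2 : sliceIso hd e q.2 v = x - (q.1 : Conf d) := (add_sub_cancel_right _ _).symm
      rw [h2]
      refine (norm_sub_le _ _).trans ?_
      rw [norm_eq_of_mem_sphere]
    rw [inv_le_iff_one_le_mul₀ (by positivity), mul_assoc, mul_comm, mul_assoc, mul_comm,
      ← div_eq_mul_inv, ← mul_pow, ← div_pow]
    refine one_le_pow₀ ?_
    rw [le_div_iff₀ (by positivity)]
    nlinarith [norm_nonneg x]
  · exact hφ.comp (((continuous_sliceIso hd e).comp (continuous_snd.prodMk continuous_const)).add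
      (continuous_subtype_val.comp continuous_fst))

/-- The average over rotated slices of the density of the projected sphere. -/
def sliceDensity (e : α ⊕ β ≃ Fin d) (x : Conf d) : ℝ :=
  ∫ g, capWeight (((Fintype.card β * d : ℕ) - 2 : ℝ) / 2) (‖x‖ ^ 2 - ‖sliceAdj e g x‖ ^ 2)
    ∂haarOrth d

theorem continuous_sq_sub (e : α ⊕ β ≃ Fin d) :
    Continuous fun q : Orth d × Conf d => ‖q.2‖ ^ 2 - ‖sliceAdj e q.1 q.2‖ ^ 2 :=
  (continuous_snd.norm.pow 2).sub ((continuous_sliceAdj e).norm.pow 2)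

theorem sq_sub_nonneg (hd : d ≠ 0) (e : α ⊕ β ≃ Fin d) (g : Orth d) (x : Conf d) :
    0 ≤ ‖x‖ ^ 2 - ‖sliceAdj e g x‖ ^ 2 :=
  sub_nonneg.2 (pow_le_pow_left₀ (norm_nonneg _) (norm_sliceAdj_le hd e g x) 2)

/-- The convolution with the surface measure has a density. -/
theorem convSphere_detDist (hd : d ≠ 0) (k p : ℕ) (h : k + p = d) (hp : 2 ≤ p * d)
    (φ : 𝓢(Conf d, ℂ)) :
    Integrable (fun x => (sliceDensity (chain k p h) x : ℂ) * φ x) ∧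
    convSphere (fourierT (detDist d k)) φ = (gammaN d d)⁻¹ *
      (((2 * Real.pi) ^ (d * (k + 1)) * spreadDet d ^ p * sphereArea (p * d) : ℝ) : ℂ) *
        ∫ x, (sliceDensity (chain k p h) x : ℂ) * φ x := by
  set e := chain k p h with he
  set w : Orth d → Conf d → ℝ := fun g x =>
    capWeight (((Fintype.card (Idx p) * d : ℕ) - 2 : ℝ) / 2) (‖x‖ ^ 2 - ‖sliceAdj e g x‖ ^ 2) with hw
  have hcard : Fintype.card (Idx p) * d = p * d := by rw [card_idx]
  have he0 : (0 : ℝ) ≤ ((Fintype.card (Idx p) * d : ℕ) - 2 : ℝ) / 2 := by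
    rw [hcard]
    have : (2 : ℝ) ≤ (p * d : ℕ) := by exact_mod_cast hp
    linarith
  have hfin : Module.finrank ℝ (EuclideanSpace ℝ (Idx p × Fin d)) = Fintype.card (Idx p) * d := by
    simp
  have hwm : Measurable fun q : Orth d × Conf d => w q.1 q.2 :=
    (measurable_capWeight _).comp (continuous_sq_sub e).measurable
  have hint : Integrable (fun q : Orth d × Conf d => (w q.1 q.2 : ℂ) * φ q.2)
      ((haarOrth d).prod volume) := by
    have h1 := (integrable_const (μ := haarOrth d) (1 : ℝ)).mul_prod (φ.integrable (μ := volume)).norm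
    refine h1.mono' ((Complex.measurable_ofReal.comp hwm).mul
      (φ.continuous.measurable.comp measurable_snd)).aestronglyMeasurable
      (Filter.Eventually.of_forall fun q => ?_)
    rw [norm_mul, Complex.norm_real, Real.norm_of_nonneg (capWeight_nonneg _ _)]
    exact mul_le_mul_of_nonneg_right (capWeight_le_one he0 (sq_sub_nonneg hd e q.1 q.2))
      (norm_nonneg _)
  have hdens : ∀ x, (sliceDensity e x : ℂ) * φ x = ∫ g, (w g x : ℂ) * φ x ∂haarOrth d := by
    intro x
    rw [integral_mul_const, integral_complex_ofReal (f := fun g => w g x)]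
    rfl
  refine ⟨?_, ?_⟩
  · simp only [hdens]
    exact hint.integral_prod_right
  · have hT : ∀ θ : Conf d, fourierT (detDist d k) (φ.compSubConstCLM ℂ (-θ)) =
        (gammaN d d)⁻¹ * (((2 * Real.pi) ^ (d * (k + 1)) * spreadDet d ^ p : ℝ) : ℂ) *
          ∫ g, (∫ v, φ (sliceIso hd e g v + θ)) ∂haarOrth d := by
      intro θ
      have h1 := detDist_fourierS hd k p h (φ.compSubConstCLM ℂ (-θ))
      simp only [SchwartzMap.compSubConstCLM_apply, sub_neg_eq_add] at h1
      exact h1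
    have hc := continuous_integral_sliceIso hd e φ.continuous φ.rapidDecay
    have hci : Integrable (fun q : Metric.sphere (0 : Conf d) 1 × Orth d =>
        ∫ v, φ (sliceIso hd e q.2 v + (q.1 : Conf d))) ((sphereMeasure (Conf d)).prod (haarOrth d)) :=
      hc.integrable_of_hasCompactSupport (HasCompactSupport.of_compactSpace _)
    rw [convSphere]
    simp only [hT]
    rw [integral_const_mul, integral_integral_swap hci]
    -- For each rotation this is a single subspace convolved with the sphere; the average over g is
    -- taken outside.
    have hS : ∀ g : Orth d, ∫ θ, (∫ v, φ (sliceIso hd e g v + (θ : Conf d))) ∂sphereMeasure (Conf d) =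
        sphereArea (p * d) * ∫ x, (w g x : ℂ) * φ x := by
      intro g
      have h2 := integral_sphere_add_isometry (sliceIso hd e g) (inner_sliceIso hd e g)
        (by rw [hfin, hcard]; exact hp) φ.integrable
      rw [hfin] at h2
      rw [h2, ← hcard]
    simp only [hS]
    rw [integral_const_mul, integral_integral_swap hint]
    simp only [hdens]
    push_cast
    ring

end Density

/-! ### From the orthogonal group to the Grassmannian -/

section Grassmannian

variable {d : ℕ}

/-- The orthogonal projection to the span of the first `p` coordinate vectors. -/
def coordProj (d p : ℕ) : Matrix (Fin d) (Fin d) ℝ :=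
  Matrix.diagonal fun i => if (i : ℕ) < p then 1 else 0

theorem coordProj_mulVec (p : ℕ) (z : Fin d → ℝ) (i : Fin d) :
    (coordProj d p).mulVec z i = if (i : ℕ) < p then z i else 0 := by
  rw [coordProj, Matrix.mulVec_diagonal]; split_ifs <;> simp

theorem toLp_coordProj_mem (p : ℕ) (hp : p ≤ d) (z : Fin d → ℝ) :
    WithLp.toLp 2 ((coordProj d p).mulVec z) ∈ (coordPlane d p hp).plane := by
  have h : WithLp.toLp 2 ((coordProj d p).mulVec z) = ∑ i : Fin p, z (Fin.castLE hp i) •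
      (EuclideanSpace.single (Fin.castLE hp i) (1 : ℝ) : EuclideanSpace ℝ (Fin d)) := by
    ext l
    simp only [coordProj_mulVec, WithLp.ofLp_sum, Finset.sum_apply, PiLp.smul_apply,
      PiLp.single_apply, smul_eq_mul, mul_ite, mul_one, mul_zero]
    split_ifs with hl
    · rw [Finset.sum_eq_single ⟨l, hl⟩]
      · exact (if_pos (show l = Fin.castLE hp ⟨l, hl⟩ from rfl)).symm
      · intro b _ hb
        rw [if_neg]
        intro hlb
        exact hb (Fin.ext (congrArg Fin.val hlb).symm)
      · simp
    · refine (Finset.sum_eq_zero fun b _ => if_neg fun hlb => hl ?_).symm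
      rw [hlb]; exact b.2
  rw [h]
  exact Submodule.sum_mem _ fun i _ => Submodule.smul_mem _ _ (Submodule.subset_span ⟨i, rfl⟩)

theorem apply_eq_zero_of_mem_coordPlane {p : ℕ} {hp : p ≤ d} {u : EuclideanSpace ℝ (Fin d)}
    (hu : u ∈ (coordPlane d p hp).plane) {l : Fin d} (hl : p ≤ (l : ℕ)) : u l = 0 := by
  have h : (coordPlane d p hp).plane ≤
      LinearMap.ker (EuclideanSpace.proj (𝕜 := ℝ) l : EuclideanSpace ℝ (Fin d) →L[ℝ] ℝ).toLinearMap := by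
    refine Submodule.span_le.2 ?_
    rintro _ ⟨i, rfl⟩
    have : l ≠ Fin.castLE hp i := by
      intro h0
      have := i.2
      rw [h0] at hl
      simp at hl
      omega
    simp [this]
  simpa using h hu

theorem projMatrix_rotate_coordPlane (p : ℕ) (hp : p ≤ d) (g : Orth d) :
    projMatrix (rotate g (coordPlane d p hp)) = g.1 * coordProj d p * g.1.transpose := by
  have hgg : g.1.transpose * g.1 = 1 := (Matrix.mem_orthogonalGroup_iff' _ _).1 g.2
  have key : ∀ y : Fin d → ℝ, (rotate g (coordPlane d p hp)).plane.starProjection (WithLp.toLp 2 y) =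
      WithLp.toLp 2 ((g.1 * coordProj d p * g.1.transpose).mulVec y) := by
    intro y
    refine Submodule.eq_starProjection_of_mem_of_inner_eq_zero
      ⟨_, toLp_coordProj_mem p hp (g.1.transpose.mulVec y), ?_⟩ ?_
    · rw [Matrix.toLpLin_apply]
      simp only [Matrix.mulVec_mulVec, Matrix.mul_assoc]
    · rintro _ ⟨u, hu, rfl⟩
      rw [Matrix.toLpLin_apply, ← WithLp.toLp_sub, inner_toLp, Matrix.dotProduct_mulVec,
        ← Matrix.mulVec_transpose, Matrix.mulVec_sub, Matrix.mulVec_mulVec, ← Matrix.mul_assoc,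
        ← Matrix.mul_assoc, hgg, Matrix.one_mul, ← Matrix.mulVec_mulVec, dotProduct]
      refine Finset.sum_eq_zero fun l _ => ?_
      rw [Pi.sub_apply, coordProj_mulVec]
      split_ifs with hl
      · simp
      · rw [apply_eq_zero_of_mem_coordPlane hu (not_lt.1 hl), mul_zero]
  ext i j
  rw [projMatrix, Matrix.of_apply]
  have := key (Pi.single j 1)
  have h2 : (EuclideanSpace.single j (1 : ℝ) : EuclideanSpace ℝ (Fin d)) =
    WithLp.toLp 2 (Pi.single j 1) := rfl
  rw [h2, this]
  simp

theorem sum_ite_lt_chain (k p : ℕ) (h : k + p = d) (f : Fin d → ℝ) :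
    ∑ i : Fin d, (if (i : ℕ) < p then 1 else 0) * f i = ∑ b, f (chain k p h (Sum.inr b)) := by
  rw [← (chain k p h).sum_comp, Fintype.sum_sum_type]
  have h1 : ∀ a, ¬ ((chain k p h (Sum.inl a) : Fin d) : ℕ) < p := fun a => not_lt.2 (le_chain_inl k p h a)
  simp [h1, chain_inr_lt]

/-- If M is the matrix `spreadAdj x`, then MMᵀ = (d + 1) Var. The square norm of the second row
block of gᵀM is the partial trace of gᵀMMᵀg over the reference plane, and cyclicity of the trace
moves g onto the projection. -/
theorem norm_sq_sliceAdj (hd : d ≠ 0) (k p : ℕ) (h : k + p = d) (hp : p ≤ d) (g : Orth d)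
    (x : Conf d) : ‖sliceAdj (chain k p h) g x‖ ^ 2 =
      ((d : ℝ) + 1) * (projMatrix (rotate g (coordPlane d p hp)) * covMatrix x).trace := by
  set M : Matrix (Fin d) (Fin d) ℝ := mat (spreadAdj x).ofLp with hM
  have hMM : M * M.transpose = ((d : ℝ) + 1) • covMatrix x := by
    ext l m
    rw [Matrix.mul_apply, Matrix.smul_apply, smul_eq_mul, ← sum_spreadAdj hd]
    rfl
  set N : Matrix (Fin d) (Fin d) ℝ := g.1.transpose * M with hN
  have e1 : ‖sliceAdj (chain k p h) g x‖ ^ 2 = ∑ b, (N * N.transpose) (chain k p h (Sum.inr b))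
      (chain k p h (Sum.inr b)) := by
    rw [EuclideanSpace.norm_sq_eq, Fintype.sum_prod_type]
    refine Finset.sum_congr rfl fun b _ => ?_
    rw [Matrix.mul_apply]
    refine Finset.sum_congr rfl fun j _ => ?_
    rw [Real.norm_eq_abs, sq_abs, sq]
    rfl
  have e2 : N * N.transpose = ((d : ℝ) + 1) • (g.1.transpose * covMatrix x * g.1) := by
    rw [hN, Matrix.transpose_mul, Matrix.transpose_transpose, Matrix.mul_assoc,
      ← Matrix.mul_assoc M, hMM, Matrix.smul_mul, Matrix.mul_smul, Matrix.mul_assoc]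
  have e3 : (g.1 * coordProj d p * g.1.transpose * covMatrix x).trace =
      (coordProj d p * (g.1.transpose * covMatrix x * g.1)).trace := by
    rw [Matrix.mul_assoc, Matrix.mul_assoc g.1, Matrix.trace_mul_comm]
    simp only [Matrix.mul_assoc]
  rw [e1, projMatrix_rotate_coordPlane, e3,
    ← sum_ite_lt_chain k p h fun i => (N * N.transpose) i i, e2, Matrix.trace, Finset.mul_sum]
  refine Finset.sum_congr rfl fun i _ => ?_
  rw [Matrix.diag_apply, coordProj, Matrix.diagonal_mul, Matrix.smul_apply, smul_eq_mul]
  ring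

theorem continuous_projMatrix (d m : ℕ) :
    Continuous (projMatrix : Grass d m → Matrix (Fin d) (Fin d) ℝ) := continuous_induced_dom

theorem continuous_rotate_coordPlane (p : ℕ) (hp : p ≤ d) :
    Continuous fun g : Orth d => rotate g (coordPlane d p hp) := by
  refine continuous_induced_rng.2 ?_
  have : (projMatrix ∘ fun g : Orth d => rotate g (coordPlane d p hp)) =
      fun g => g.1 * coordProj d p * g.1.transpose :=
    funext fun g => projMatrix_rotate_coordPlane p hp g
  rw [this]
  exact (continuous_subtype_val.matrix_mul continuous_const).matrix_mul
    continuous_subtype_val.matrix_transpose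

theorem integral_grassMeasure (p : ℕ) (hp : p ≤ d) {f : Grass d p → ℝ} (hf : Continuous f) :
    ∫ W, f W ∂grassMeasure d p hp =
      ((∏ i ∈ Finset.range p, sphereArea (d - i)) / ∏ i ∈ Finset.range p, sphereArea (p - i)) *
        ∫ g, f (rotate g (coordPlane d p hp)) ∂haarOrth d := by
  have h0 : ∀ n, 0 ≤ sphereArea n := fun n => measureReal_nonneg
  rw [grassMeasure, integral_smul_measure, ENNReal.toReal_ofReal
    (div_nonneg (Finset.prod_nonneg fun _ _ => h0 _) (Finset.prod_nonneg fun _ _ => h0 _)),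
    smul_eq_mul, integral_map (continuous_rotate_coordPlane p hp).measurable.aemeasurable
      hf.aestronglyMeasurable]

theorem gammaN_self (n : ℕ) :
    gammaN n n = ((∏ j ∈ Finset.range n, gammaReal ((n - j : ℕ) : ℝ) : ℝ) : ℂ) := by
  rw [gammaN, Complex.ofReal_prod]
  refine Finset.prod_congr rfl fun j hj => ?_
  have : ((n : ℂ) - j) = (((n - j : ℕ) : ℝ) : ℂ) := by
    rw [Nat.cast_sub (Finset.mem_range.1 hj).le]; push_cast; ring
  rw [this]
  exact (ofReal_gammaReal _).symm

theorem sphereArea_eq_inv {n : ℕ} (hn : 0 < n) : sphereArea n = (gammaReal n)⁻¹ :=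
  eq_inv_of_mul_eq_one_right (gammaReal_mul_sphereArea hn)

/-- Since |S^{n-1}| = 1/γ(n), the mass is γ_p(p) divided by the first p factors of γ_d(d); the
remaining factors form γ_k(k). -/
theorem constD_mul_mass (k p : ℕ) (h : k + p = d) :
    1 / (gammaN k k * gammaN p p) * (((∏ i ∈ Finset.range p, sphereArea (d - i)) /
      ∏ i ∈ Finset.range p, sphereArea (p - i) : ℝ) : ℂ) = (gammaN d d)⁻¹ := by
  have hd : gammaN d d = (((∏ i ∈ Finset.range p, gammaReal ((d - i : ℕ) : ℝ)) *
      ∏ i ∈ Finset.range k, gammaReal ((k - i : ℕ) : ℝ) : ℝ) : ℂ) := by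
    rw [gammaN_self]
    congr 1
    have : d = p + k := by omega
    conv_lhs => rw [this, Finset.prod_range_add]
    rw [← this]
    congr 1
    refine Finset.prod_congr rfl fun i _ => ?_
    congr 2
    omega
  have p1 : ∏ i ∈ Finset.range p, sphereArea (d - i) =
      (∏ i ∈ Finset.range p, gammaReal ((d - i : ℕ) : ℝ))⁻¹ := by
    rw [← Finset.prod_inv_distrib]
    exact Finset.prod_congr rfl fun i hi =>
      sphereArea_eq_inv (by have := Finset.mem_range.1 hi; omega)
  have p2 : ∏ i ∈ Finset.range p, sphereArea (p - i) =
      (∏ i ∈ Finset.range p, gammaReal ((p - i : ℕ) : ℝ))⁻¹ := by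
    rw [← Finset.prod_inv_distrib]
    exact Finset.prod_congr rfl fun i hi =>
      sphereArea_eq_inv (by have := Finset.mem_range.1 hi; omega)
  have hk0 := gammaN_self_ne_zero k
  have hp0 := gammaN_self_ne_zero p
  rw [hd, p1, p2]
  rw [gammaN_self] at hk0 hp0 ⊢
  rw [gammaN_self]
  push_cast at hk0 hp0 ⊢
  field_simp

end Grassmannian

/-! ### Continuity of the density -/

section Continuity

theorem capWeight_of_le {e s : ℝ} (hs : s ≤ 1) : capWeight e s = (max 0 (1 - s)) ^ e := by
  rw [capWeight, if_pos hs, max_eq_right (by linarith)]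

theorem capWeight_of_pos {e : ℝ} (he : 0 < e) (s : ℝ) : capWeight e s = (max 0 (1 - s)) ^ e := by
  by_cases hs : s ≤ 1
  · exact capWeight_of_le hs
  · rw [capWeight, if_neg hs, max_eq_left (by linarith), Real.zero_rpow he.ne']

theorem continuousAt_capWeight {e s : ℝ} (he : 0 ≤ e) (hs : s < 1) :
    ContinuousAt (capWeight e) s := by
  have h : Continuous fun s : ℝ => (max 0 (1 - s)) ^ e :=
    (Real.continuous_rpow_const he).comp (by fun_prop)
  refine h.continuousAt.congr ?_
  filter_upwards [Iic_mem_nhds hs] with t ht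
  exact (capWeight_of_le ht).symm

variable {d : ℕ} {α β : Type} [Fintype α] [Fintype β] [DecidableEq α] [DecidableEq β]

theorem continuous_integral_sq_sub (hd : d ≠ 0) (e : α ⊕ β ≃ Fin d) {ψ : ℝ → ℝ}
    (hψ : Continuous ψ) (h1 : ∀ s, 0 ≤ s → ‖ψ s‖ ≤ 1) :
    Continuous fun x : Conf d => ∫ g, ψ (‖x‖ ^ 2 - ‖sliceAdj e g x‖ ^ 2) ∂haarOrth d := by
  refine continuous_of_dominated (bound := fun _ => 1) (fun x => ?_)
    (fun x => Filter.Eventually.of_forall fun g => h1 _ (sq_sub_nonneg hd e g x))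
    (integrable_const _) (Filter.Eventually.of_forall fun g => ?_)
  · have h2 := (continuous_sq_sub e).comp (Continuous.prodMk_left x)
    have h3 := (hψ.comp h2).measurable
    exact h3.aestronglyMeasurable
  · have h2 := (continuous_sq_sub e).comp (Continuous.prodMk_right g)
    exact hψ.comp h2

theorem continuous_integral_max_rpow (hd : d ≠ 0) (e : α ⊕ β ≃ Fin d) {c : ℝ} (hc : 0 ≤ c) :
    Continuous fun x : Conf d =>
      ∫ g, (fun s : ℝ => (max 0 (1 - s)) ^ c) (‖x‖ ^ 2 - ‖sliceAdj e g x‖ ^ 2) ∂haarOrth d := by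
  refine continuous_integral_sq_sub hd e (ψ := fun s : ℝ => (max 0 (1 - s)) ^ c) ((Real.continuous_rpow_const hc).comp
    (continuous_const.max (continuous_const.sub continuous_id)))
    fun s hs => ?_
  rw [Real.norm_of_nonneg (Real.rpow_nonneg (le_max_left _ _) _)]
  exact Real.rpow_le_one (le_max_left _ _) (max_le zero_le_one (by linarith)) hc

/-- On the closed ball the argument of the weight never exceeds 1, so the cut-off is inactive and a
continuous weight may replace it. For exponent 0 this uses the value 1 of the weight at the
boundary. -/
theorem continuousOn_sliceDensity (hd : d ≠ 0) (e : α ⊕ β ≃ Fin d) (hn : 2 ≤ Fintype.card β * d) :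
    ContinuousOn (sliceDensity e) (Metric.closedBall 0 1) := by
  have hc : (0 : ℝ) ≤ ((Fintype.card β * d : ℕ) - 2 : ℝ) / 2 := by
    have : (2 : ℝ) ≤ (Fintype.card β * d : ℕ) := by exact_mod_cast hn
    linarith
  refine (continuous_integral_max_rpow hd e hc).continuousOn.congr fun x hx => ?_
  have hx1 : ‖x‖ ≤ 1 := by simpa using hx
  refine integral_congr_ae (Filter.Eventually.of_forall fun g => capWeight_of_le ?_)
  nlinarith [sq_nonneg ‖sliceAdj e g x‖, norm_nonneg x]

theorem continuous_sliceDensity (hd : d ≠ 0) (e : α ⊕ β ≃ Fin d) (hn : 2 < Fintype.card β * d) :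
    Continuous (sliceDensity e) := by
  have hc : (0 : ℝ) < ((Fintype.card β * d : ℕ) - 2 : ℝ) / 2 := by
    have : (2 : ℝ) < (Fintype.card β * d : ℕ) := by exact_mod_cast hn
    linarith
  have : sliceDensity e = fun x => _ := funext fun x =>
    integral_congr_ae (Filter.Eventually.of_forall fun g => capWeight_of_pos hc _)
  rw [this]
  exact continuous_integral_max_rpow hd e hc.le

/-- The weight can jump only at argument 1, and at a point of the unit sphere this argument occurs
only for rotations with vanishing slice component. Dominated convergence ignores a null set of them.
-/
theorem continuousAt_sliceDensity (hd : d ≠ 0) (e : α ⊕ β ≃ Fin d) (hn : 2 ≤ Fintype.card β * d)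
    {ω : Conf d} (hω : ‖ω‖ = 1) (h0 : ∀ᵐ g ∂haarOrth d, sliceAdj e g ω ≠ 0) :
    ContinuousAt (sliceDensity e) ω := by
  have hc : (0 : ℝ) ≤ ((Fintype.card β * d : ℕ) - 2 : ℝ) / 2 := by
    have : (2 : ℝ) ≤ (Fintype.card β * d : ℕ) := by exact_mod_cast hn
    linarith
  refine continuousAt_of_dominated (bound := fun _ => 1) (Filter.Eventually.of_forall fun x => ?_)
    (Filter.Eventually.of_forall fun x => Filter.Eventually.of_forall fun g => ?_)
    (integrable_const _) ?_
  · exact ((measurable_capWeight _).comp ((continuous_sq_sub e).comp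
      (Continuous.prodMk_left x)).measurable).aestronglyMeasurable
  · rw [Real.norm_of_nonneg (capWeight_nonneg _ _)]
    exact capWeight_le_one hc (sq_sub_nonneg hd e g x)
  · filter_upwards [h0] with g hg
    have h1 : 0 < ‖sliceAdj e g ω‖ := norm_pos_iff.2 hg
    have h2 : ContinuousAt (fun x => ‖x‖ ^ 2 - ‖sliceAdj e g x‖ ^ 2) ω :=
      ((continuous_sq_sub e).comp (Continuous.prodMk_right g)).continuousAt
    exact ContinuousAt.comp (g := capWeight _) (continuousAt_capWeight hc (by
      rw [hω]; nlinarith)) h2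

/-- All rotations of this set have the same Haar measure. Each g lies in at most one of those
indexed by t = tan of the angle, since a unit column cannot be orthogonal to both a and its quarter
turn. Fubini over the infinite line of t forces measure zero. -/
theorem haarOrth_orthogonal_column {a : Fin 2 → ℝ} (ha : a ≠ 0) (i : Fin 2) :
    haarOrth 2 {g | g.1 0 i * a 0 + g.1 1 i * a 1 = 0} = 0 := by
  have c0 := continuous_orth_entry (d := 2) 0 i
  have c1 := continuous_orth_entry (d := 2) 1 i
  set Z : Set (Orth 2 × ℝ) := {q | q.1.1 0 i * (a 0 + q.2 * a 1) + q.1.1 1 i * (a 1 - q.2 * a 0) = 0}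
    with hZ
  have hZm : MeasurableSet Z := by
    refine (isClosed_eq ?_ continuous_const).measurableSet
    have d0 : Continuous fun q : Orth 2 × ℝ => q.1.1 0 i := c0.comp continuous_fst
    have d1 : Continuous fun q : Orth 2 × ℝ => q.1.1 1 i := c1.comp continuous_fst
    exact (d0.mul (by fun_prop)).add (d1.mul (by fun_prop))
  have hpos : 0 < a 0 ^ 2 + a 1 ^ 2 := by
    by_contra hle
    apply ha
    funext j
    have h0 : a 0 = 0 := by nlinarith [sq_nonneg (a 0), sq_nonneg (a 1)]
    have h1 : a 1 = 0 := by nlinarith [sq_nonneg (a 0), sq_nonneg (a 1)]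
    fin_cases j <;> assumption
  have hZ0 : ((haarOrth 2).prod volume) Z = 0 := by
    rw [Measure.measure_prod_null hZm]
    refine Filter.Eventually.of_forall fun g => ?_
    refine Set.Subsingleton.measure_zero ?_ _
    intro s hs t ht
    have hs' : g.1 0 i * (a 0 + s * a 1) + g.1 1 i * (a 1 - s * a 0) = 0 := hs
    have ht' : g.1 0 i * (a 0 + t * a 1) + g.1 1 i * (a 1 - t * a 0) = 0 := ht
    have hu : g.1 0 i ^ 2 + g.1 1 i ^ 2 = 1 := by
      have hgg : g.1.transpose * g.1 = 1 := (Matrix.mem_orthogonalGroup_iff' _ _).1 g.2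
      have h := congrFun (congrFun hgg i) i
      rw [Matrix.mul_apply, Fin.sum_univ_two, Matrix.one_apply_eq, Matrix.transpose_apply,
        Matrix.transpose_apply] at h
      linarith
    by_contra hne
    have hst : s - t ≠ 0 := sub_ne_zero.2 hne
    have h1 : g.1 0 i * a 1 - g.1 1 i * a 0 = 0 := by
      refine (mul_eq_zero.1 ?_).resolve_left hst
      linarith
    have h2 : g.1 0 i * a 0 + g.1 1 i * a 1 = 0 := by linear_combination hs' - s * h1
    have h3 : (g.1 0 i ^ 2 + g.1 1 i ^ 2) * (a 0 ^ 2 + a 1 ^ 2) = 0 := by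
      linear_combination (g.1 0 i * a 1 - g.1 1 i * a 0) * h1 +
        (g.1 0 i * a 0 + g.1 1 i * a 1) * h2
    rw [hu, one_mul] at h3
    exact hpos.ne' h3
  -- The rotation with matrix c(1, -t; t, 1), c = (1 + t²)^{-1/2}, identifies the slice at t with
  -- the original set.
  have hslice : ∀ t : ℝ, haarOrth 2 ((fun g => (g, t)) ⁻¹' Z) =
      haarOrth 2 {g | g.1 0 i * a 0 + g.1 1 i * a 1 = 0} := by
    intro t
    obtain ⟨c, hc0, hc2⟩ : ∃ c : ℝ, c ≠ 0 ∧ c ^ 2 * (1 + t ^ 2) = 1 :=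
      ⟨(√(1 + t ^ 2))⁻¹, by positivity, by
        rw [inv_pow, Real.sq_sqrt (by positivity), inv_mul_cancel₀ (by positivity)]⟩
    have hmem : !![c, -(c * t); c * t, c] ∈ Matrix.orthogonalGroup (Fin 2) ℝ := by
      rw [Matrix.mem_orthogonalGroup_iff]
      ext u v
      fin_cases u <;> fin_cases v <;> simp [Matrix.mul_apply, Fin.sum_univ_two] <;>
        first | linear_combination hc2 | ring
    rw [← measure_preimage_mul (haarOrth 2) ⟨_, hmem⟩ {g | g.1 0 i * a 0 + g.1 1 i * a 1 = 0}]
    congr 1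
    ext g
    have e0 : ((⟨_, hmem⟩ : Orth 2) * g).1 0 i = c * g.1 0 i - c * t * g.1 1 i := by
      rw [Submonoid.coe_mul, Matrix.mul_apply, Fin.sum_univ_two]
      simp; ring
    have e1 : ((⟨_, hmem⟩ : Orth 2) * g).1 1 i = c * t * g.1 0 i + c * g.1 1 i := by
      rw [Submonoid.coe_mul, Matrix.mul_apply, Fin.sum_univ_two]
      simp
    simp only [mem_preimage, hZ, mem_ofPred_eq, e0, e1]
    have e2 : (c * g.1 0 i - c * t * g.1 1 i) * a 0 + (c * t * g.1 0 i + c * g.1 1 i) * a 1 =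
        c * (g.1 0 i * (a 0 + t * a 1) + g.1 1 i * (a 1 - t * a 0)) := by ring
    rw [e2, mul_eq_zero, or_iff_right hc0]
  rw [Measure.prod_apply_symm hZm] at hZ0
  simp only [hslice, lintegral_const, Real.volume_univ, mul_eq_zero, ENNReal.top_ne_zero,
    or_false] at hZ0
  exact hZ0

/-- A nonzero covariance matrix leaves some nonzero column of `spreadAdj x`, and a single entry of
the slice is already nonzero for almost every rotation. -/
theorem ae_sliceAdj_ne_zero {β : Type} [Fintype β] [DecidableEq β] [Nonempty β]
    (e : α ⊕ β ≃ Fin 2) {x : Conf 2} (hx : covMatrix x ≠ 0) :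
    ∀ᵐ g ∂haarOrth 2, sliceAdj e g x ≠ 0 := by
  obtain ⟨b⟩ := ‹Nonempty β›
  obtain ⟨j, hj⟩ : ∃ j : Fin 2, (fun l => spreadAdj x (l, j)) ≠ 0 := by
    by_contra hall
    push Not at hall
    apply hx
    ext l m
    have h := sum_spreadAdj two_ne_zero x l m
    have h0 : ∀ j, spreadAdj x (l, j) = 0 := fun j => congrFun (hall j) l
    simp only [h0, zero_mul, Finset.sum_const_zero] at h
    have h3 : ((2 : ℕ) : ℝ) + 1 ≠ 0 := by positivity
    exact (mul_eq_zero.1 h.symm).resolve_left h3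
  have h := haarOrth_orthogonal_column hj (e (Sum.inr b))
  filter_upwards [compl_mem_ae_iff.2 h] with g hg h0
  apply hg
  have h1 : sliceAdj e g x (b, j) = 0 := by rw [h0]; rfl
  have h2 : sliceAdj e g x (b, j) = lmul (g⁻¹).1 (spreadAdj x).ofLp (e (Sum.inr b), j) := rfl
  rw [h2, lmul_apply, Fin.sum_univ_two] at h1
  exact h1

end Continuity

/-! ### Values on the unit sphere -/

section Restriction

variable {d : ℕ}

theorem sliceDensity_of_norm_eq_one (hd : d ≠ 0) (k p : ℕ) (h : k + p = d) (hp : p ≤ d)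
    {ω : Conf d} (hω : ‖ω‖ = 1) : sliceDensity (chain k p h) ω =
      ((d : ℝ) + 1) ^ (((p * d : ℕ) - 2 : ℝ) / 2) * ∫ g, (projMatrix (rotate g (coordPlane d p hp)) *
        covMatrix ω).trace ^ (((p * d : ℕ) - 2 : ℝ) / 2) ∂haarOrth d := by
  rw [sliceDensity, ← integral_const_mul]
  refine integral_congr_ae (Filter.Eventually.of_forall fun g => ?_)
  have h1 := norm_sq_sliceAdj hd k p h hp g ω
  have h0 : (0 : ℝ) ≤ (d : ℝ) + 1 := by positivity
  have h2 : 0 ≤ (projMatrix (rotate g (coordPlane d p hp)) * covMatrix ω).trace := by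
    have h3 := sq_nonneg ‖sliceAdj (chain k p h) g ω‖
    rw [h1] at h3
    exact nonneg_of_mul_nonneg_right h3 (by positivity)
  dsimp only
  rw [hω, card_idx, capWeight_of_le (by linarith [sq_nonneg ‖sliceAdj (chain k p h) g ω‖]), one_pow,
    sub_sub_cancel, max_eq_right (sq_nonneg _), h1, Real.mul_rpow h0 h2]

theorem spreadDet_pow_mul (p : ℕ) (c : ℝ) : spreadDet d ^ p * ((d : ℝ) + 1) ^ c =
    ((d : ℝ) + 1) ^ (c - p / 2) := by
  have h0 : (0 : ℝ) < (d : ℝ) + 1 := by positivity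
  rw [spreadDet, Real.sqrt_eq_rpow, ← Real.rpow_neg h0.le, ← Real.rpow_natCast,
    ← Real.rpow_mul h0.le, ← Real.rpow_add h0]
  congr 1; ring

/-- Bookkeeping of constants. The exponent of d + 1 is (d(d-k) - 2)/2 from the power of |P_U ω|²,
reduced by (d-k)/2 from the determinant of `spread`. -/
theorem density_of_norm_eq_one {k p : ℕ} (hd : d ≠ 0) (hkd : d - k = p)
    (h : k + p = d) (hn : 2 ≤ p * d) {ω : Conf d} (hω : ‖ω‖ = 1) :
    (gammaN d d)⁻¹ * (((2 * Real.pi) ^ (d * (k + 1)) * spreadDet d ^ p * sphereArea (p * d) : ℝ) : ℂ) *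
      (sliceDensity (chain k p h) ω : ℂ) = (constC d k : ℂ) * constD d k * (weight d k ω : ℂ) := by
  subst hkd
  have hp : d - k ≤ d := Nat.sub_le d k
  have hcast : ((d - k : ℕ) : ℝ) = d - k := by rw [Nat.cast_sub (by omega)]
  have hcastC : ((d - k : ℕ) : ℂ) = d - k := by rw [Nat.cast_sub (by omega)]
  set c : ℝ := ((d : ℝ) * ((d : ℝ) - k) - 2) / 2 with hc
  have hc' : (((d - k) * d : ℕ) - 2 : ℝ) / 2 = c := by
    rw [hc]; push_cast; rw [hcast]; ring
  have hc0 : 0 ≤ c := by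
    rw [← hc']
    have : (2 : ℝ) ≤ ((d - k) * d : ℕ) := by exact_mod_cast hn
    linarith
  have hW : Continuous fun W : Grass d (d - k) => (projMatrix W * covMatrix ω).trace ^ c :=
    (Real.continuous_rpow_const hc0).comp
      (((continuous_projMatrix d (d - k)).matrix_mul continuous_const).matrix_trace)
  have hpow : spreadDet d ^ (d - k) * ((d : ℝ) + 1) ^ c =
      ((d : ℝ) + 1) ^ ((((d : ℝ) - 1) * ((d : ℝ) - k) - 2) / 2) := by
    rw [spreadDet_pow_mul, hcast, hc]; congr 1; ring
  have hmass := constD_mul_mass k (d - k) h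
  rw [weight, integral_grassMeasure (d - k) hp hW, sliceDensity_of_norm_eq_one hd k (d - k) h hp hω,
    hc', constC, constD, ← hpow, ← hmass, mul_comm d (d - k), hcastC]
  push_cast
  ring

/-- The Fourier transform of `A_k` convolved with the surface measure of the sphere. -/
theorem exists_density {k : ℕ} (hd : 2 ≤ d) (hk : 1 ≤ k) (hkd : k ≤ d - 1) :
    ∃ F : Conf d → ℂ, IsGivenBy (convSphere (fourierT (detDist d (k : ℂ)))) F ∧
      ContinuousOn F (Metric.closedBall 0 1) ∧
      (∀ ω ∈ Metric.sphere (0 : Conf d) 1,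
        (d * (d - k) ≠ 2 ∨ covMatrix ω ≠ 0) → ContinuousAt F ω) ∧
      ∀ ω ∈ Metric.sphere (0 : Conf d) 1,
        F ω = (constC d k : ℂ) * constD d k * (weight d k ω : ℂ) := by
  obtain ⟨p, hp⟩ : ∃ p, d - k = p := ⟨_, rfl⟩
  have h : k + p = d := by omega
  have hp0 : 0 < p := by omega
  have hd0 : d ≠ 0 := by omega
  have hn : 2 ≤ p * d := by nlinarith
  have hcard : Fintype.card (Idx p) * d = p * d := by rw [card_idx]
  set C : ℂ := (gammaN d d)⁻¹ *
    (((2 * Real.pi) ^ (d * (k + 1)) * spreadDet d ^ p * sphereArea (p * d) : ℝ) : ℂ) with hC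
  refine ⟨fun x => C * (sliceDensity (chain k p h) x : ℂ), fun φ => ?_, ?_, fun ω hω hor => ?_,
    fun ω hω => ?_⟩
  · obtain ⟨h1, h2⟩ := convSphere_detDist hd0 k p h hn φ
    refine ⟨(h1.const_mul C).congr (Filter.Eventually.of_forall fun x => (mul_assoc _ _ _).symm), ?_⟩
    rw [h2, ← integral_const_mul]
    simp only [mul_assoc, hC]
  · exact continuousOn_const.mul (Complex.continuous_ofReal.comp_continuousOn
      (continuousOn_sliceDensity hd0 _ (by rw [hcard]; exact hn)))
  · refine continuousAt_const.mul (Complex.continuous_ofReal.continuousAt.comp ?_)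
    by_cases h2 : p * d = 2
    · have hcov : covMatrix ω ≠ 0 := hor.resolve_left (by rw [hp, mul_comm, h2]; simp)
      -- The exceptional exponent 0 occurs only for d = 2 and p = 1.
      obtain rfl : d = 2 := by nlinarith
      obtain rfl : p = 1 := by omega
      have : Nonempty (Idx 1) := by
        rw [← Fintype.card_pos_iff, card_idx]; norm_num
      exact continuousAt_sliceDensity hd0 _ (by rw [hcard]) (by simpa using hω)
        (ae_sliceAdj_ne_zero _ hcov)
    · exact (continuous_sliceDensity hd0 _ (by rw [hcard]; omega)).continuousAt
  · exact density_of_norm_eq_one hd0 hp h hn (by simpa using hω)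

end Restriction

end KPlane

end

theorem proposition4p1 (d k : ℕ) (hd : 2 ≤ d) (hk : 1 ≤ k) (hkd : k ≤ d - 1) :
    KPlane.IsDetFamily d (KPlane.detFamily d) ∧
    ∃ F : KPlane.Conf d → ℂ,
      KPlane.IsGivenBy
        (KPlane.convSphere (KPlane.fourierT (KPlane.detFamily d (k : ℂ)))) F ∧
      ContinuousOn F (Metric.closedBall 0 1) ∧
      (∀ ω ∈ Metric.sphere (0 : KPlane.Conf d) 1,
        (d * (d - k) ≠ 2 ∨ KPlane.covMatrix ω ≠ 0) → ContinuousAt F ω) ∧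
      ∀ ω ∈ Metric.sphere (0 : KPlane.Conf d) 1,
        F ω = (KPlane.constC d k : ℂ) * KPlane.constD d k * (KPlane.weight d k ω : ℂ) := by
  refine ⟨KPlane.isDetFamily_detFamily d, ?_⟩
  rw [KPlane.detFamily_eq]
  exact KPlane.exists_density hd hk hkd
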